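/- **Theorem (Asymptotic normality and valid standard errors of the fair adaptive experiment).** *Population.* Let $(X,Y(0),Y(1))$ be a covariate and two real potential outcomes with $\mathbb E|Y(d)|^4<\infty$ for $d=0,1$, and let $\mathcal S_1,\dots,\mathcal S_m$ be a measurable partition of the covariate space into $m$ groups ($m$ fixed). Put $p_j=\mathbb P(X\in\mathcal S_j)$, $\tau_j=\mathbb E[Y(1)-Y(0)\mid X\in\mathcal S_j]$, $\sigma_j^2(d)=\mathbb V[Y(d)\mid X\in\mathcal S_j]$ and $\tau=\mathbb E[Y(1)-Y(0)]$. Assume that there is $\varepsilon>0$ with $p_j\ge\varepsilon$ for all $j$. *Design problem.* Fix $c_1\in(0,1)$ and $c_2\in(0,1/2)$. For $r\ge 0$, proportions $q_j$, variances $s_j(d)$ and effects $t_j$ consider the problem $$\min_{e\in\mathbb R^m}\ \sum_{j=1}^m q_j\Big(\frac{s_j(1)}{e_j}+\frac{s_j(0)}{1-e_j}\Big)\quad\text{s.t.}\quad |e_j-e_\ell|\le c_1\ (j\ne\ell),\quad \log\Big(\frac{e_j}{1-e_j}\Big)t_j\ge -r,\quad c_2\le e_j\le 1-c_2\ \text{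 for all } j .$$ The oracle allocation $e^*=(e_1^*,\dots,e_m^*)$ is a solution for $q_j=p_j$, $s_j(d)=\sigma_j^2(d)$, $t_j=\tau_j$, $r=0$. *Experiment.* An experiment has $T$ stages with $n_t\ge1$ participants in stage $t$; let $N_t=\sum_{s\le t}n_s$ and $N=N_T$. The triples $(X_{it},Y_{it}(0),Y_{it}(1))$ of all participants are i.i.d. copies of $(X,Y(0),Y(1))$. Participant $i$ of stage $t$ is assigned to an arm $D_{it}\in\{0,1\}$, and the observed outcome is $Y_{it}=D_{it}Y_{it}(1)+(1-D_{it})Y_{it}(0)$. For $d\in\{0,1\}$ and $t\ge1$ define (with $0/0:=0$) $$\hat p_{tj}=\frac{1}{N_t}\sum_{s\le t}\sum_{i\le n_s}\mathbf 1(X_{is}\in\mathcal S_j),\qquad \bar Y_{tj}(d)=\frac{\sum_{s\le t}\sum_{i\le n_s}\mathbf 1(X_{is}\in\mathcal S_j,D_{is}=d)Y_{is}}{\sum_{s\le t}\sum_{i\le n_s}\mathbf 1(X_{is}\in\mathcal S_j,D_{is}=d)},$$ $$\hat\tau_{tj}=\bar Y_{tj}(1)-\bar Y_{tj}(0),\qquad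 \hat\sigma_{tj}^2(d)=\frac{\sum_{s\le t}\sum_{i\le n_s}\mathbf 1(X_{is}\in\mathcal S_j,D_{is}=d)(Y_{is}-\bar Y_{tj}(d))^2}{\sum_{s\le t}\sum_{i\le n_s}\mathbf 1(X_{is}\in\mathcal S_j,D_{is}=d)} .$$ The treatment probabilities are $e_{1j}=\frac12$ in stage $1$; in every stage $t\ge2$, $(e_{tj})_{j}$ is a function of the observed history of the stages before $t$ that almost surely solves the design problem with $q_j=\hat p_{t-1,j}$, $s_j(d)=\hat\sigma^2_{t-1,j}(d)$, $t_j=\hat\tau_{t-1,j}$ and $r=\delta(N_{t-1})$. Here $\delta$ is a fixed nonnegative function with $\delta(x)\to0$ and $\sqrt x\,\delta(x)\to\infty$ as $x\to\infty$. Treatments are randomized: conditionally on the covariates and potential outcomes of all participants and on all preceding assignments, $D_{it}=1$ has probability $e_{tj}$ if $X_{it}\in\mathcal S_j$. After the last stage drop the index $T$ from the estimators, and put $\hat\tau=\sum_j\hat p_j\hat\tau_j$, let $\hat e_j$ be the fraction of the participants of group $j$ that were treated, and $$\hat v_j^2=\frac1{\hat p_j}\Big(\frac{\hat\sigma_j^2(1)}{\hat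 e_j}+\frac{\hat\sigma_j^2(0)}{1-\hat e_j}\Big),\qquad \hat v^2=\sum_{j=1}^m\hat p_j^2\hat v_j^2+\sum_{j=1}^m\hat p_j(\hat\tau_j-\hat\tau)^2$$ (with $x/0:=0$). *Claim.* Consider a sequence of such experiments, with the same population, $\mathcal S_j$, $c_1$, $c_2$ and $\delta$, with $T\to\infty$, and with a constant $c\ge1$, the same for the whole sequence, such that $\frac{N}{cT}\le n_t\le\frac{cN}{T}$ for all stages $t$. Let $$v_j^2(e_j^*)=\frac1{p_j}\Big(\frac{\sigma_j^2(1)}{e_j^*}+\frac{\sigma_j^2(0)}{1-e_j^*}\Big),\qquad v^2(e^*)=\sum_{j=1}^m p_j^2v_j^2(e_j^*)+\sum_{j=1}^m p_j(\tau_j-\tau)^2 .$$ Then, for every oracle allocation $e^*$: 1. $\sqrt N(\hat\tau_j-\tau_j)$ converges in distribution to $\mathcal N(0,v_j^2(e_j^*))$ for every $j$, and $\sqrt N(\hat\tau-\tau)$ converges in distribution to $\mathcal N(0,v^2(e^*))$, where $\mathcal N(0,0)$ is the point mass at $0$. 2. $\hat v_j^2\to v_j^2(e_j^*)$ for every $j$,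 and $\hat v^2\to v^2(e^*)$, in probability. 3. The confidence intervals have asymptotically nominal coverage: for every $\alpha\in(0,1)$, with $\Phi$ the standard normal distribution function, $\mathbb P\big(\tau_j\in[\hat\tau_j\pm\Phi^{-1}(1-\alpha/2)\,\hat v_j/\sqrt N]\big)\to1-\alpha$ for every $j$ with $v_j^2(e_j^*)>0$, and $\mathbb P\big(\tau\in[\hat\tau\pm\Phi^{-1}(1-\alpha/2)\,\hat v/\sqrt N]\big)\to1-\alpha$ if $v^2(e^*)>0$. -/

import Mathlib

open MeasureTheory ProbabilityTheory Filter Topology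

noncomputable section

namespace FairExperiment

/-! ### Population quantities

`ν` is the common law of `(X, Y(·))` on `𝒳 × (Bool → ℝ)`; the arm `true` is the treatment arm,
the arm `false` is the control arm. -/

section Population

variable {𝒳 : Type*} [MeasurableSpace 𝒳] {m : ℕ}

/-- The group proportion `p_j = P(X ∈ S_j)`. -/
def groupProp (ν : Measure (𝒳 × (Bool → ℝ))) (S : Fin m → Set 𝒳) (j : Fin m) : ℝ :=
  ν.real (Prod.fst ⁻¹' S j)

/-- The group-level treatment effect `τ_j = E[Y(1) - Y(0) | X ∈ S_j]`. -/
def groupEffect (ν : Measure (𝒳 × (Bool → ℝ))) (S : Fin m → Set 𝒳) (j : Fin m) : ℝ :=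
  ∫ w, (w.2 true - w.2 false) ∂(ProbabilityTheory.cond ν (Prod.fst ⁻¹' S j))

/-- The group-level variance `σ_j²(d) = V[Y(d) | X ∈ S_j]`. -/
def groupVar (ν : Measure (𝒳 × (Bool → ℝ))) (S : Fin m → Set 𝒳) (j : Fin m) (d : Bool) : ℝ :=
  variance (fun w : 𝒳 × (Bool → ℝ) => w.2 d) (ProbabilityTheory.cond ν (Prod.fst ⁻¹' S j))

/-- The average treatment effect `τ = E[Y(1) - Y(0)]`. -/
def ate (ν : Measure (𝒳 × (Bool → ℝ))) : ℝ :=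
  ∫ w, (w.2 true - w.2 false) ∂ν

/-- `v_j²(e) = (σ_j²(1) / e + σ_j²(0) / (1 - e)) / p_j`. -/
def groupAsympVar (ν : Measure (𝒳 × (Bool → ℝ))) (S : Fin m → Set 𝒳) (j : Fin m) (e : ℝ) : ℝ :=
  1 / groupProp ν S j * (groupVar ν S j true / e + groupVar ν S j false / (1 - e))

/-- `v²(e) = ∑_j p_j² v_j²(e_j) + ∑_j p_j (τ_j - τ)²`. -/
def ateAsympVar (ν : Measure (𝒳 × (Bool → ℝ))) (S : Fin m → Set 𝒳) (e : Fin m → ℝ) : ℝ :=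
  ∑ j, groupProp ν S j ^ 2 * groupAsympVar ν S j (e j) +
    ∑ j, groupProp ν S j * (groupEffect ν S j - ate ν) ^ 2

end Population

/-! ### The constrained design problem -/

section Design

variable {m : ℕ}

/-- The design objective `∑_j p_j (σ_j²(1) / e_j + σ_j²(0) / (1 - e_j))`. -/
def objective (p : Fin m → ℝ) (v : Fin m → Bool → ℝ) (e : Fin m → ℝ) : ℝ :=
  ∑ j, p j * (v j true / e j + v j false / (1 - e j))

/-- Allocations that satisfy the envy-freeness constraint (with constant `c₁`), the welfare
constraint (relaxed by `r`) and the feasibility constraint (with constant `c₂`). -/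
def feasible (c₁ c₂ r : ℝ) (τ : Fin m → ℝ) : Set (Fin m → ℝ) :=
  {e | (∀ j l, j ≠ l → -c₁ ≤ e j - e l ∧ e j - e l ≤ c₁) ∧
    (∀ j, -r ≤ Real.log (e j / (1 - e j)) * τ j) ∧
    (∀ j, c₂ ≤ e j ∧ e j ≤ 1 - c₂)}

/-- `e` solves the design problem with proportions `p`, variances `v`, effects `τ` and welfare
relaxation `r`; the oracle problem has `r = 0` and the population quantities. -/
def IsOptimal (c₁ c₂ r : ℝ) (p : Fin m → ℝ) (v : Fin m → Bool → ℝ) (τ : Fin m → ℝ)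
    (e : Fin m → ℝ) : Prop :=
  e ∈ feasible c₁ c₂ r τ ∧ ∀ e' ∈ feasible c₁ c₂ r τ, objective p v e ≤ objective p v e'

end Design

/-! ### One adaptive experiment -/

/-- The variables of one adaptive experiment. The stages are `t = 0, …, T - 1`, the participants
of stage `t` are `i = 0, …, n t - 1`; values at other indices are never used. -/
structure Experiment (Ω 𝒳 : Type*) (m : ℕ) where
  /-- number of stages -/
  T : ℕ
  /-- number of participants of each stage -/
  n : ℕ → ℕ
  /-- covariates -/
  X : ℕ → ℕ → Ω → 𝒳
  /-- potential outcomes -/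
  Y : ℕ → ℕ → Bool → Ω → ℝ
  /-- assigned arms -/
  D : ℕ → ℕ → Ω → Bool
  /-- treatment probabilities of each stage and group -/
  e : ℕ → Fin m → Ω → ℝ

namespace Experiment

variable {Ω 𝒳 : Type*} {m : ℕ} (E : Experiment Ω 𝒳 m)

/-- Number of participants enrolled in the first `t` stages. -/
def size (t : ℕ) : ℕ := ∑ s ∈ Finset.range t, E.n s

/-- Total number of participants. -/
def N : ℕ := E.size E.T

/-- The covariate and the two potential outcomes of a participant. -/
def unit (t i : ℕ) (ω : Ω) : 𝒳 × (Bool → ℝ) := (E.X t i ω, fun d => E.Y t i d ω)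

/-- The observed outcome, i.e. the potential outcome under the assigned arm. -/
def obs (t i : ℕ) (ω : Ω) : ℝ := E.Y t i (E.D t i ω) ω

variable (S : Fin m → Set 𝒳)

/-- The indicator of `X_{ti} ∈ S_j`. -/
def inGroup (j : Fin m) (t i : ℕ) (ω : Ω) : ℝ := (S j).indicator (fun _ => 1) (E.X t i ω)

/-- The indicator of `D_{ti} = d`. -/
def inArm (d : Bool) (t i : ℕ) (ω : Ω) : ℝ := if E.D t i ω = d then 1 else 0

/-- Number of participants of group `j` in the first `t` stages. -/
def groupCount (j : Fin m) (t : ℕ) (ω : Ω) : ℝ :=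
  ∑ s ∈ Finset.range t, ∑ i ∈ Finset.range (E.n s), E.inGroup S j s i ω

/-- Number of participants of group `j` assigned to arm `d` in the first `t` stages. -/
def armCount (j : Fin m) (d : Bool) (t : ℕ) (ω : Ω) : ℝ :=
  ∑ s ∈ Finset.range t, ∑ i ∈ Finset.range (E.n s), E.inGroup S j s i ω * E.inArm d s i ω

/-- `p̂_{tj}`. -/
def pHat (t : ℕ) (j : Fin m) (ω : Ω) : ℝ := E.groupCount S j t ω / E.size t

/-- `Ȳ_{tj}(d)` (equal to `0` if no such participant has been observed). -/
def armMean (t : ℕ) (j : Fin m) (d : Bool) (ω : Ω) : ℝ :=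
  (∑ s ∈ Finset.range t, ∑ i ∈ Finset.range (E.n s),
    E.inGroup S j s i ω * E.inArm d s i ω * E.obs s i ω) / E.armCount S j d t ω

/-- `τ̂_{tj}`. -/
def tauHat (t : ℕ) (j : Fin m) (ω : Ω) : ℝ := E.armMean S t j true ω - E.armMean S t j false ω

/-- `σ̂²_{tj}(d)` (equal to `0` if no such participant has been observed). -/
def varHat (t : ℕ) (j : Fin m) (d : Bool) (ω : Ω) : ℝ :=
  (∑ s ∈ Finset.range t, ∑ i ∈ Finset.range (E.n s),
    E.inGroup S j s i ω * E.inArm d s i ω * (E.obs s i ω - E.armMean S t j d ω) ^ 2) /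
    E.armCount S j d t ω

/-- The final estimate `τ̂ = ∑_j p̂_j τ̂_j` of the average treatment effect. -/
def ateHat (ω : Ω) : ℝ := ∑ j, E.pHat S E.T j ω * E.tauHat S E.T j ω

/-- The actual treatment allocation `ê_j`. -/
def eHat (j : Fin m) (ω : Ω) : ℝ := E.armCount S j true E.T ω / E.groupCount S j E.T ω

/-- `v̂_j²`. -/
def groupVarEst (j : Fin m) (ω : Ω) : ℝ :=
  1 / E.pHat S E.T j ω *
    (E.varHat S E.T j true ω / E.eHat S j ω + E.varHat S E.T j false ω / (1 - E.eHat S j ω))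

/-- `v̂²`. -/
def ateVarEst (ω : Ω) : ℝ :=
  ∑ j, E.pHat S E.T j ω ^ 2 * E.groupVarEst S j ω +
    ∑ j, E.pHat S E.T j ω * (E.tauHat S E.T j ω - E.ateHat S ω) ^ 2

variable [MeasurableSpace 𝒳]

/-- The observed history before stage `t`: covariates, assignments and observed outcomes. -/
abbrev history (t : ℕ) : MeasurableSpace Ω :=
  ⨆ (s : ℕ) (_ : s < t) (i : ℕ) (_ : i < E.n s),
    MeasurableSpace.comap (fun ω => (E.X s i ω, E.D s i ω, E.obs s i ω)) inferInstance

/-- The information that is fixed when participant `i` of stage `t` is randomized: the covariates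
and potential outcomes of all participants, and the assignments of all preceding participants
(in the lexicographic order of the pairs (stage, participant)). -/
abbrev preAssignment (t i : ℕ) : MeasurableSpace Ω :=
  (⨆ (s : ℕ) (_ : s < E.T) (l : ℕ) (_ : l < E.n s),
    MeasurableSpace.comap (E.unit s l) inferInstance) ⊔
  (⨆ (s : ℕ) (_ : s < E.T) (l : ℕ) (_ : l < E.n s) (_ : s < t ∨ (s = t ∧ l < i)),
    MeasurableSpace.comap (E.D s l) inferInstance)

/-- `E` is a run of the fair adaptive experiment with groups `S`, constants `c₁`, `c₂` and welfare
relaxation `δ`, on participants whose covariates and potential outcomes are i.i.d. with law `ν`. -/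
structure IsFairAdaptive [MeasurableSpace Ω] (μ : Measure Ω) (ν : Measure (𝒳 × (Bool → ℝ)))
    (c₁ c₂ : ℝ) (δ : ℕ → ℝ) : Prop where
  n_pos : ∀ t < E.T, 1 ≤ E.n t
  measurable_X : ∀ t < E.T, ∀ i < E.n t, Measurable (E.X t i)
  measurable_Y : ∀ t < E.T, ∀ i < E.n t, ∀ d, Measurable (E.Y t i d)
  measurable_D : ∀ t < E.T, ∀ i < E.n t, Measurable (E.D t i)
  /-- the participants are independent -/
  indep : iIndepFun
    (fun (u : {u : ℕ × ℕ // u.1 < E.T ∧ u.2 < E.n u.1}) => E.unit u.1.1 u.1.2) μ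
  /-- the participants have the law `ν` -/
  law : ∀ t < E.T, ∀ i < E.n t, HasLaw (E.unit t i) ν μ
  /-- the treatment probabilities of a stage are computed from the observed history -/
  measurable_e : ∀ t < E.T, ∀ j, Measurable[E.history t] (E.e t j)
  /-- the first stage uses probability one half -/
  e_zero : ∀ j ω, E.e 0 j ω = 1 / 2
  /-- every later stage uses a solution of the design problem with the current estimates -/
  e_optimal : ∀ t, 1 ≤ t → t < E.T → ∀ᵐ ω ∂μ,
    IsOptimal c₁ c₂ (δ (E.size t)) (fun j => E.pHat S t j ω) (fun j d => E.varHat S t j d ω)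
      (fun j => E.tauHat S t j ω) (fun j => E.e t j ω)
  /-- a participant of group `j` in stage `t` is treated with probability `e t j`, independently
  of everything else -/
  randomized : ∀ t < E.T, ∀ i < E.n t,
    μ[E.inArm true t i | E.preAssignment t i] =ᵐ[μ]
      fun ω => ∑ j, E.inGroup S j t i ω * E.e t j ω

end Experiment

/-- The quantile function `Φ⁻¹` of the standard normal distribution. -/
def normalQuantile (u : ℝ) : ℝ := sInf {x : ℝ | u ≤ cdf (gaussianReal 0 1) x}

/-- The two-sided interval `[a ± Φ⁻¹(1 - α/2) √w / √N]`. -/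
def confInterval (α a w : ℝ) (N : ℕ) : Set ℝ :=
  Set.Icc (a - normalQuantile (1 - α / 2) * √w / √(N : ℝ))
    (a + normalQuantile (1 - α / 2) * √w / √(N : ℝ))

end FairExperiment

end

open FairExperiment

set_option linter.unusedSectionVars false

/-! ### Sequentially randomized trials -/

namespace FairExperiment

/-! ### Independence of joins of σ-algebras. -/

section Independence

variable {Ω : Type*} {mΩ : MeasurableSpace Ω} {μ : Measure Ω} [IsProbabilityMeasure μ]

/-! Listed in the order of enrolment, the participants form a sequential trial: given the past, the
next participant is a fresh draw from `ν`, and the arm depends on everything else only through the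
group and the current treatment probabilities (`indep_past_future`, `integral_mul_outcome`). A sum
over participants minus its conditional means is therefore a martingale whose variance grows at most
linearly in the number of participants.

Law of large numbers. Chebyshev's inequality for these martingales, followed by passage to almost
surely convergent subsequences, makes the estimated proportions, effects and variances consistent
after many participants (`exists_strictMono_isRegular`). The allocation need not converge for this:
the bound `c₂` keeps every arm's count proportional to the sample size.

Stability of the design (`tendsto_of_isOptimal`). A limit point of solutions of the estimated
problems is feasible for the oracle problem. Conversely the oracle allocation is eventually feasible
for the estimated problems: where `τ_j ≠ 0` the estimated effect has the right sign, and where `τ_j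
= 0` the estimate is of order `N^{-1/2}`, hence negligible against the relaxation `δ`. So limit
points are optimal, and strict convexity identifies them with `e*` in every group where some arm has
positive variance. In the remaining groups the oracle allocation need not be unique, but they
contribute no within-group variance. As stages have comparable sizes, early stages carry a vanishing
share of the participants and the convergence passes to averages over the experiment
(`tendsto_average_prob`).

Normality. `tendstoInDistribution_sum` compares the characteristic function of the martingale with
`(1 - x²V/2)^N`, replacing one participant at a time; it needs third moments and conditional
variances that approach `V` on average in mean. For linear statistics the conditional variance is
Lipschitz in the treatment probabilities, with weight zero on degenerate groups. The estimators are
linear statistics except that the random ratio of `N` to an arm count stands where its limit should;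
the error is an `L²`-bounded sum times a factor tending to zero in probability, or it vanishes
because the arm is degenerate (`IsStable.tendstoInDistribution`). For the average effect, the
fluctuation of the group frequencies adds the between-group variance. The variance estimators
converge along the same regular subsequences, and coverage follows from Slutsky's theorem and the
absence of atoms in the normal limit. -/

lemma generateFrom_image2_inter_eq_sup (m₁ m₂ : MeasurableSpace Ω) :
    MeasurableSpace.generateFrom
      (Set.image2 (· ∩ ·) {s | MeasurableSet[m₁] s} {s | MeasurableSet[m₂] s}) = m₁ ⊔ m₂ := by
  apply le_antisymm
  · refine MeasurableSpace.generateFrom_le ?_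
    rintro _ ⟨s, hs, t, ht, rfl⟩
    exact MeasurableSet.inter (le_sup_left (a := m₁) (b := m₂) _ hs)
      (le_sup_right (a := m₁) (b := m₂) _ ht)
  · refine sup_le (fun s hs => ?_) (fun s hs => ?_)
    · exact MeasurableSpace.measurableSet_generateFrom
        ⟨s, hs, Set.univ, MeasurableSet.univ, Set.inter_univ _⟩
    · exact MeasurableSpace.measurableSet_generateFrom
        ⟨Set.univ, MeasurableSet.univ, s, hs, Set.univ_inter _⟩

lemma isPiSystem_image2_inter (m₁ m₂ : MeasurableSpace Ω) :
    IsPiSystem (Set.image2 (· ∩ ·) {s | MeasurableSet[m₁] s} {s | MeasurableSet[m₂] s}) := by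
  rintro _ ⟨s, hs, t, ht, rfl⟩ _ ⟨s', hs', t', ht', rfl⟩ -
  exact ⟨s ∩ s', MeasurableSet.inter hs hs', t ∩ t', MeasurableSet.inter ht ht',
    Set.inter_inter_inter_comm _ _ _ _⟩

/-- Intersections of a set of `m₁` with a set of `m₂` form a π-system that generates the join. The
factor `μ (s ∩ t)` stays unsplit because `m₁` and `m₂` may be dependent. -/
lemma indep_sup_left_of_inter {m₁ m₂ m₃ : MeasurableSpace Ω} (h₁ : m₁ ≤ mΩ) (h₂ : m₂ ≤ mΩ)
    (h₃ : m₃ ≤ mΩ)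
    (h : ∀ s t u, MeasurableSet[m₁] s → MeasurableSet[m₂] t → MeasurableSet[m₃] u →
      μ (s ∩ t ∩ u) = μ (s ∩ t) * μ u) : Indep (m₁ ⊔ m₂) m₃ μ := by
  refine IndepSets.indep (sup_le h₁ h₂) h₃ (isPiSystem_image2_inter m₁ m₂)
    (@MeasurableSpace.isPiSystem_measurableSet Ω m₃)
    (generateFrom_image2_inter_eq_sup m₁ m₂).symm
    (@MeasurableSpace.generateFrom_measurableSet Ω m₃).symm ?_
  rw [IndepSets_iff]
  rintro _ u ⟨s, hs, t, ht, rfl⟩ hu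
  exact h s t u hs ht hu

/-- The contraction rule of independence. It moves the covariates of the current participant from
the future to the past. -/
lemma indep_sup_left_of_indep_sup_right {m₁ m₂ m₃ : MeasurableSpace Ω} (h₁ : m₁ ≤ mΩ)
    (h₂ : m₂ ≤ mΩ) (h₃ : m₃ ≤ mΩ) (h : Indep m₁ (m₂ ⊔ m₃) μ) (h' : Indep m₂ m₃ μ) :
    Indep (m₁ ⊔ m₂) m₃ μ := by
  refine indep_sup_left_of_inter h₁ h₂ h₃ fun s t u hs ht hu => ?_
  rw [Indep_iff] at h h'
  have ht' : MeasurableSet[m₂ ⊔ m₃] t := le_sup_left (a := m₂) (b := m₃) _ ht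
  have hu' : MeasurableSet[m₂ ⊔ m₃] u := le_sup_right (a := m₂) (b := m₃) _ hu
  rw [Set.inter_assoc, h s (t ∩ u) hs (MeasurableSet.inter ht' hu'), h' t u ht hu,
    h s t hs ht', mul_assoc]

lemma indepFun_of_indep {β γ : Type*} [MeasurableSpace β] [MeasurableSpace γ]
    {m₁ m₂ : MeasurableSpace Ω} (h : Indep m₁ m₂ μ) {X : Ω → β} {Y : Ω → γ}
    (hX : Measurable[m₁] X) (hY : Measurable[m₂] Y) : IndepFun X Y μ := by
  rw [IndepFun_iff_Indep]
  exact indep_of_indep_of_le h (measurable_iff_comap_le.1 hX) (measurable_iff_comap_le.1 hY)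

lemma integral_mul_of_indep {𝕜 : Type*} [RCLike 𝕜] {m₁ m₂ : MeasurableSpace Ω}
    (h : Indep m₁ m₂ μ) (h₁ : m₁ ≤ mΩ) (h₂ : m₂ ≤ mΩ) {X Y : Ω → 𝕜} (hX : Measurable[m₁] X)
    (hY : Measurable[m₂] Y) : ∫ ω, X ω * Y ω ∂μ = (∫ ω, X ω ∂μ) * ∫ ω, Y ω ∂μ :=
  (indepFun_of_indep h hX hY).integral_fun_mul_eq_mul_integral
    (hX.mono h₁ le_rfl).aestronglyMeasurable (hY.mono h₂ le_rfl).aestronglyMeasurable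

end Independence

/-- The probability of arm `d` when treatment has probability `p`. -/
def armProb (d : Bool) (p : ℝ) : ℝ := if d then p else 1 - p

/-- The groups form a measurable partition. -/
structure IsMeasurablePartition {𝒲 : Type*} [MeasurableSpace 𝒲] {m : ℕ} (A : Fin m → Set 𝒲) :
    Prop where
  measurableSet : ∀ j, MeasurableSet (A j)
  disjoint : Pairwise (Function.onFun Disjoint A)
  iUnion_eq : ⋃ j, A j = Set.univ

/-- The mean of `f w d` when `w` has law `ν` and `d = true` has probability `p j` on group `j`. -/
noncomputable def designMean {𝒲 : Type*} [MeasurableSpace 𝒲] {m : ℕ} {F : Type*} [NormedAddCommGroup F]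
    [NormedSpace ℝ F] (ν : Measure 𝒲) (A : Fin m → Set 𝒲) (f : 𝒲 → Bool → F) (p : Fin m → ℝ) :
    F := ∑ d : Bool, ∑ j, armProb d (p j) • ∫ w in A j, f w d ∂ν

/-- The information carried by the first `n` participants. -/
@[reducible] def past {Ω 𝒲 : Type*} [MeasurableSpace 𝒲] (W : ℕ → Ω → 𝒲) (D : ℕ → Ω → Bool) (n : ℕ) :
    MeasurableSpace Ω :=
  ⨆ (l : ℕ) (_ : l < n), MeasurableSpace.comap (fun ω => (W l ω, D l ω)) inferInstance

/-- `N` independent participants `W n` with law `ν` are assigned one after the other to the arms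
`D n`, with treatment probabilities `π n` that depend on the past only. -/
structure IsSequentialTrial {Ω 𝒲 : Type*} [mΩ : MeasurableSpace Ω] [MeasurableSpace 𝒲] {m : ℕ}
    (μ : Measure Ω) (ν : Measure 𝒲) (A : Fin m → Set 𝒲) (c : ℝ) (N : ℕ) (W : ℕ → Ω → 𝒲)
    (D : ℕ → Ω → Bool) (π : ℕ → Fin m → Ω → ℝ) : Prop where
  partition : IsMeasurablePartition A
  measurable_W : ∀ n < N, Measurable (W n)
  measurable_D : ∀ n < N, Measurable (D n)
  indep : iIndepFun (fun n : Fin N => W n) μ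
  law : ∀ n < N, μ.map (W n) = ν
  measurable_π : ∀ n < N, ∀ j, Measurable[past W D n] (π n j)
  mem_Icc : ∀ n < N, ∀ᵐ ω ∂μ, ∀ j, π n j ω ∈ Set.Icc c (1 - c)
  pos : 0 < c
  randomized : ∀ n < N, ∃ 𝓖 : MeasurableSpace Ω, 𝓖 ≤ mΩ ∧
    (∀ l < N, Measurable[𝓖] (W l)) ∧ (∀ l < n, Measurable[𝓖] (D l)) ∧
    μ[fun ω => if D n ω = true then (1 : ℝ) else 0 | 𝓖] =ᵐ[μ]
      fun ω => ∑ j, (A j).indicator (fun _ => (1 : ℝ)) (W n ω) * π n j ω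

section Partition

variable {𝒲 : Type*} [MeasurableSpace 𝒲] {m : ℕ} {A : Fin m → Set 𝒲}

lemma IsMeasurablePartition.exists_mem (hA : IsMeasurablePartition A) (w : 𝒲) :
    ∃ j, w ∈ A j := by
  have : w ∈ ⋃ j, A j := hA.iUnion_eq ▸ Set.mem_univ w
  simpa using this

lemma IsMeasurablePartition.sum_indicator (hA : IsMeasurablePartition A) {w : 𝒲} {j : Fin m}
    (hw : w ∈ A j) (x : Fin m → ℝ) :
    ∑ l, (A l).indicator (fun _ => (1 : ℝ)) w * x l = x j := by
  rw [Finset.sum_eq_single j]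
  · simp [hw]
  · intro l _ hl
    have : w ∉ A l := fun h => Set.disjoint_left.1 (hA.disjoint hl) h hw
    simp [this]
  · simp

end Partition

lemma armProb_nonneg {c p : ℝ} (hc : 0 < c) (hp : p ∈ Set.Icc c (1 - c)) (d : Bool) :
    0 ≤ armProb d p := by
  cases d <;> simp [armProb] <;> linarith [hp.1, hp.2]

lemma armProb_le_one {c p : ℝ} (hc : 0 < c) (hp : p ∈ Set.Icc c (1 - c)) (d : Bool) :
    armProb d p ≤ 1 := by
  cases d <;> simp [armProb] <;> linarith [hp.1, hp.2]

lemma measurable_armProb (d : Bool) : Measurable (armProb d) := by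
  cases d
  · exact measurable_const.sub measurable_id
  · exact measurable_id

lemma measurable_past {Ω 𝒲 : Type*} [MeasurableSpace 𝒲] {W : ℕ → Ω → 𝒲} {D : ℕ → Ω → Bool}
    {n l : ℕ} (hl : l < n) : Measurable[past W D n] (fun ω => (W l ω, D l ω)) := by
  rw [measurable_iff_comap_le]
  exact le_iSup₂_of_le (f := fun (l : ℕ) (_ : l < n) =>
    MeasurableSpace.comap (fun ω => (W l ω, D l ω)) inferInstance) l hl le_rfl

lemma past_mono {Ω 𝒲 : Type*} [MeasurableSpace 𝒲] {W : ℕ → Ω → 𝒲} {D : ℕ → Ω → Bool}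
    {n n' : ℕ} (h : n ≤ n') : past W D n ≤ past W D n' :=
  iSup₂_le fun _ hl => measurable_iff_comap_le.1 (measurable_past (hl.trans_le h))

lemma past_le {Ω 𝒲 : Type*} [mΩ : MeasurableSpace Ω] [MeasurableSpace 𝒲] {W : ℕ → Ω → 𝒲}
    {D : ℕ → Ω → Bool} {n : ℕ} (hW : ∀ l < n, Measurable (W l)) (hD : ∀ l < n, Measurable (D l)) :
    past W D n ≤ mΩ :=
  iSup₂_le fun l hl => measurable_iff_comap_le.1 ((hW l hl).prodMk (hD l hl))

/-- The information carried by the covariates of the participants `n, …, N - 1`. -/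
@[reducible] def future {Ω 𝒲 : Type*} [MeasurableSpace 𝒲] (W : ℕ → Ω → 𝒲) (N n : ℕ) : MeasurableSpace Ω :=
  ⨆ (l : Fin N) (_ : l ∈ {l : Fin N | n ≤ l}), MeasurableSpace.comap (W l) inferInstance

/-- Covariates and arm are separated because they join the past for different reasons: the former by
independence of the participants, the latter by randomization. -/
lemma past_succ {Ω 𝒲 : Type*} [MeasurableSpace 𝒲] (W : ℕ → Ω → 𝒲) (D : ℕ → Ω → Bool) (n : ℕ) :
    past W D (n + 1) = (past W D n ⊔ MeasurableSpace.comap (W n) inferInstance) ⊔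
      MeasurableSpace.comap (D n) inferInstance := by
  have h : MeasurableSpace.comap (fun ω => (W n ω, D n ω)) inferInstance =
      MeasurableSpace.comap (W n) inferInstance ⊔ MeasurableSpace.comap (D n) inferInstance :=
    MeasurableSpace.comap_prodMk (W n) (D n)
  rw [sup_assoc, ← h]
  apply le_antisymm
  · refine iSup₂_le fun l hl => ?_
    rcases Nat.lt_succ_iff_lt_or_eq.1 hl with h1 | rfl
    · exact le_sup_of_le_left (measurable_iff_comap_le.1 (measurable_past h1))
    · exact le_sup_right
  · exact sup_le (past_mono (Nat.le_succ n))
      (measurable_iff_comap_le.1 (measurable_past (Nat.lt_succ_self n)))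

lemma future_eq_sup {Ω 𝒲 : Type*} [MeasurableSpace 𝒲] (W : ℕ → Ω → 𝒲) {N n : ℕ} (hn : n < N) :
    future W N n = MeasurableSpace.comap (W n) inferInstance ⊔ future W N (n + 1) := by
  apply le_antisymm
  · refine iSup₂_le fun l hl => ?_
    rcases eq_or_lt_of_le (show n ≤ (l : ℕ) from hl) with h | h
    · rw [h]; exact le_sup_left
    · exact le_sup_of_le_right (le_iSup₂_of_le (f := fun (l : Fin N)
        (_ : l ∈ {l : Fin N | n + 1 ≤ l}) => MeasurableSpace.comap (W l) inferInstance) l h le_rfl)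
  · refine sup_le ?_ (iSup₂_le fun l hl => ?_)
    · exact le_iSup₂_of_le (f := fun (l : Fin N)
        (_ : l ∈ {l : Fin N | n ≤ l}) => MeasurableSpace.comap (W l) inferInstance) ⟨n, hn⟩
        (le_refl n) le_rfl
    · exact le_iSup₂_of_le (f := fun (l : Fin N)
        (_ : l ∈ {l : Fin N | n ≤ l}) => MeasurableSpace.comap (W l) inferInstance) l
        (Nat.le_of_succ_le hl) le_rfl

/-! ### Independence of the past and the future participants. -/

namespace IsSequentialTrial

variable {Ω 𝒲 : Type*} [mΩ : MeasurableSpace Ω] [MeasurableSpace 𝒲] {m : ℕ} {μ : Measure Ω}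
  [IsProbabilityMeasure μ] {ν : Measure 𝒲} {A : Fin m → Set 𝒲} {c : ℝ} {N : ℕ} {W : ℕ → Ω → 𝒲}
  {D : ℕ → Ω → Bool} {π : ℕ → Fin m → Ω → ℝ}

include mΩ in
lemma past_le (h : IsSequentialTrial μ ν A c N W D π) {n : ℕ} (hn : n ≤ N) :
    past W D n ≤ mΩ :=
  FairExperiment.past_le (fun l hl => h.measurable_W l (hl.trans_le hn))
    (fun l hl => h.measurable_D l (hl.trans_le hn))

lemma comap_W_le (h : IsSequentialTrial μ ν A c N W D π) {n : ℕ} (hn : n < N) :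
    MeasurableSpace.comap (W n) inferInstance ≤ mΩ :=
  measurable_iff_comap_le.1 (h.measurable_W n hn)

lemma future_le (h : IsSequentialTrial μ ν A c N W D π) (n : ℕ) : future W N n ≤ mΩ :=
  iSup₂_le fun l _ => h.comap_W_le l.2

lemma indep_comap_future (h : IsSequentialTrial μ ν A c N W D π) {n : ℕ} (hn : n < N) :
    Indep (MeasurableSpace.comap (W n) inferInstance) (future W N (n + 1)) μ := by
  have h1 : iIndep (fun l : Fin N => MeasurableSpace.comap (W l) inferInstance) μ := h.indep
  have h2 := indep_iSup_of_disjoint (fun l : Fin N => h.comap_W_le l.2) h1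
    (S := {⟨n, hn⟩}) (T := {l : Fin N | n + 1 ≤ l}) (by simp)
  simpa [future] using h2

lemma measurableSet_arm (h : IsSequentialTrial μ ν A c N W D π) {n : ℕ} (hn : n < N) (d : Bool) :
    MeasurableSet {ω | D n ω = d} := h.measurable_D n hn (measurableSet_singleton d)

lemma measurable_arm (h : IsSequentialTrial μ ν A c N W D π) {n : ℕ} (hn : n < N) (d : Bool) :
    Measurable (fun ω => if D n ω = d then (1 : ℝ) else 0) :=
  Measurable.ite (h.measurableSet_arm hn d) measurable_const measurable_const

lemma integrable_arm (h : IsSequentialTrial μ ν A c N W D π) {n : ℕ} (hn : n < N) (d : Bool) :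
    Integrable (fun ω => if D n ω = d then (1 : ℝ) else 0) μ :=
  Integrable.of_bound (h.measurable_arm hn d).aestronglyMeasurable 1
    (ae_of_all _ fun ω => by split_ifs <;> simp)

/-- The conditional probability of arm `d` given the information before randomization. -/
lemma exists_condExp_arm (h : IsSequentialTrial μ ν A c N W D π) {n : ℕ} (hn : n < N) (d : Bool) :
    ∃ 𝓖 : MeasurableSpace Ω, 𝓖 ≤ mΩ ∧ past W D n ≤ 𝓖 ∧
      (∀ l < N, MeasurableSpace.comap (W l) inferInstance ≤ 𝓖) ∧
      μ[fun ω => if D n ω = d then (1 : ℝ) else 0 | 𝓖] =ᵐ[μ]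
        fun ω => ∑ j, (A j).indicator (fun _ => (1 : ℝ)) (W n ω) * armProb d (π n j ω) := by
  have hi := h.integrable_arm hn true
  have hex := fun ω => h.partition.exists_mem (W n ω)
  have hsum := fun {ω j} (hj : W n ω ∈ A j) => h.partition.sum_indicator hj
  obtain ⟨𝓖, h𝓖, hW, hD, hr⟩ := h.randomized n hn
  refine ⟨𝓖, h𝓖, FairExperiment.past_le (mΩ := 𝓖) (fun l hl => hW l (hl.trans hn)) hD,
    fun l hl => measurable_iff_comap_le.1 (hW l hl), ?_⟩
  cases d with
  | true => simpa [armProb] using hr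
  | false =>
    have h1 : (fun ω => if D n ω = false then (1 : ℝ) else 0) =
        (fun _ => (1 : ℝ)) - fun ω => if D n ω = true then (1 : ℝ) else 0 := by
      ext ω; cases hω : D n ω <;> simp [hω]
    rw [h1]
    filter_upwards [condExp_sub (integrable_const (1 : ℝ)) hi 𝓖, hr] with ω h2 h3
    rw [h2, Pi.sub_apply, h3, condExp_const h𝓖]
    obtain ⟨j, hj⟩ := hex ω
    rw [hsum hj, hsum hj]
    simp [armProb]

/-- Arm `d` may be replaced by its conditional probability under the integral. -/
lemma integral_arm_mul {𝕜 : Type*} [RCLike 𝕜] (h : IsSequentialTrial μ ν A c N W D π) {n : ℕ}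
    (hn : n < N) (d : Bool) {K : Ω → 𝕜} (hKi : Integrable K μ)
    (hK : Measurable[past W D n ⊔ future W N n] K) :
    ∫ ω, (if D n ω = d then (1 : ℝ) else 0) • K ω ∂μ =
      ∫ ω, (∑ j, (A j).indicator (fun _ => (1 : ℝ)) (W n ω) * armProb d (π n j ω)) • K ω ∂μ := by
  have hi := h.integrable_arm hn d
  have hiK : Integrable ((fun ω => if D n ω = d then (1 : ℝ) else 0) • K) μ := by
    refine hKi.bdd_smul 1 (h.measurable_arm hn d).aestronglyMeasurable
      (ae_of_all _ fun ω => ?_)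
    split_ifs <;> simp
  obtain ⟨𝓖, h𝓖, hp, hW, hc⟩ := h.exists_condExp_arm hn d
  -- The randomization σ-algebra knows the covariates of all participants, so `K` may depend on
  -- future ones. This makes the arm uninformative about the future.
  have hle : past W D n ⊔ future W N n ≤ 𝓖 := sup_le hp (iSup₂_le fun l _ => hW l l.2)
  have hK' : AEStronglyMeasurable[𝓖] K μ :=
    (Measurable.mono hK hle le_rfl).stronglyMeasurable.aestronglyMeasurable
  have h1 := condExp_smul_of_aestronglyMeasurable_right hi hiK hK'
  have h2 : ∫ ω, ((fun ω => if D n ω = d then (1 : ℝ) else 0) • K) ω ∂μ = _ :=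
    (integral_condExp h𝓖 (f := (fun ω => if D n ω = d then (1 : ℝ) else 0) • K)).symm
  refine h2.trans (integral_congr_ae ?_)
  filter_upwards [h1, hc] with ω h3 h4
  rw [h3, Pi.smul_apply', h4]

lemma measurable_group (h : IsSequentialTrial μ ν A c N W D π) {n : ℕ} (hn : n < N) (d : Bool) :
    Measurable[past W D n ⊔ MeasurableSpace.comap (W n) inferInstance]
      (fun ω => ∑ j, (A j).indicator (fun _ => (1 : ℝ)) (W n ω) * armProb d (π n j ω)) := by
  refine Finset.measurable_sum _ fun j _ => Measurable.mul ?_ ?_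
  · exact ((measurable_const.indicator (h.partition.measurableSet j)).comp
      (comap_measurable (W n))).mono le_sup_right le_rfl
  · exact (measurable_armProb d).comp ((h.measurable_π n hn j).mono le_sup_left le_rfl)

/-- Under the integral the arm turns into its conditional probability, a function of the past and of
`W n`, which by `hind` is independent of `u`. -/
lemma measureReal_inter_arm (h : IsSequentialTrial μ ν A c N W D π) {n : ℕ} (hn : n < N)
    (hind : Indep (past W D n ⊔ MeasurableSpace.comap (W n) inferInstance) (future W N (n + 1)) μ)
    {s u : Set Ω} (hs : MeasurableSet[past W D n ⊔ MeasurableSpace.comap (W n) inferInstance] s)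
    (hu : MeasurableSet[future W N (n + 1)] u) (d : Bool) :
    μ.real (s ∩ u ∩ {ω | D n ω = d}) = μ.real (s ∩ {ω | D n ω = d}) * μ.real u := by
  have hsup : past W D n ⊔ MeasurableSpace.comap (W n) inferInstance ≤
      past W D n ⊔ future W N n := sup_le_sup_left (future_eq_sup W hn ▸ le_sup_left) _
  have hu' : MeasurableSet[past W D n ⊔ future W N n] u :=
    (future_eq_sup W hn ▸ le_sup_of_le_right le_sup_right :
      future W N (n + 1) ≤ past W D n ⊔ future W N n) _ hu
  have hle : past W D n ⊔ future W N n ≤ mΩ := sup_le (h.past_le hn.le) (h.future_le n)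
  have key : ∀ v, MeasurableSet[past W D n ⊔ future W N n] v → μ.real (v ∩ {ω | D n ω = d}) =
      ∫ ω, (∑ j, (A j).indicator (fun _ => (1 : ℝ)) (W n ω) * armProb d (π n j ω)) *
        v.indicator (fun _ => (1 : ℝ)) ω ∂μ := by
    intro v hv
    have h1 := h.integral_arm_mul hn d (K := v.indicator (fun _ => (1 : ℝ)))
      ((integrable_const _).indicator (hle _ hv)) (Measurable.indicator measurable_const hv)
    simp only [smul_eq_mul] at h1
    rw [← h1]
    have : (fun ω => (if D n ω = d then (1 : ℝ) else 0) * v.indicator (fun _ => (1 : ℝ)) ω) =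
        (v ∩ {ω | D n ω = d}).indicator (fun _ => (1 : ℝ)) := by
      ext ω; by_cases h1 : ω ∈ v <;> by_cases h2 : D n ω = d <;> simp [h1, h2]
    rw [this, integral_indicator_const _ ((hle _ hv).inter (h.measurableSet_arm hn d))]
    simp
  rw [key _ (MeasurableSet.inter (hsup _ hs) hu'), key _ (hsup _ hs)]
  have h3 := integral_mul_of_indep (𝕜 := ℝ) hind (sup_le (h.past_le hn.le) (h.comap_W_le hn))
    (h.future_le _) (X := fun ω => (∑ j, (A j).indicator (fun _ => (1 : ℝ)) (W n ω) *
      armProb d (π n j ω)) * s.indicator (fun _ => (1 : ℝ)) ω)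
    (Y := u.indicator (fun _ => (1 : ℝ)))
    (Measurable.mul (h.measurable_group hn d) (Measurable.indicator measurable_const hs))
    (Measurable.indicator measurable_const hu)
  rw [integral_indicator_const _ (h.future_le _ _ hu), smul_eq_mul, mul_one] at h3
  rw [← h3]
  congr 1 with ω
  by_cases h1 : ω ∈ s <;> by_cases h2 : ω ∈ u <;> simp [h1, h2]

lemma measureReal_inter_preimage_arm (h : IsSequentialTrial μ ν A c N W D π)
    {n : ℕ} (hn : n < N) (v : Set Ω) (B : Set Bool) :
    μ.real (v ∩ D n ⁻¹' B) = B.indicator (fun _ => μ.real (v ∩ {ω | D n ω = true})) true +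
      B.indicator (fun _ => μ.real (v ∩ {ω | D n ω = false})) false := by
  rw [← measureReal_inter_add_sdiff (μ := μ) (s := v ∩ D n ⁻¹' B) (h.measurableSet_arm hn true)]
  congr 1
  · by_cases hB : true ∈ B
    · rw [Set.indicator_of_mem hB]
      congr 1; ext ω; simp only [Set.mem_inter_iff, Set.mem_preimage, Set.mem_ofPred_eq]
      exact ⟨fun h => ⟨h.1.1, h.2⟩, fun h => ⟨⟨h.1, h.2 ▸ hB⟩, h.2⟩⟩
    · rw [Set.indicator_of_notMem hB]
      convert measureReal_empty
      ext ω; simp only [Set.mem_inter_iff, Set.mem_preimage, Set.mem_ofPred_eq,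
        Set.mem_empty_iff_false, iff_false]
      exact fun h => hB (h.2 ▸ h.1.2)
  · by_cases hB : false ∈ B
    · rw [Set.indicator_of_mem hB]
      congr 1; ext ω; simp only [Set.mem_inter_iff, Set.mem_preimage, Set.mem_ofPred_eq,
        Set.mem_sdiff, Bool.not_eq_true]
      exact ⟨fun h => ⟨h.1.1, h.2⟩, fun h => ⟨⟨h.1, h.2 ▸ hB⟩, h.2⟩⟩
    · rw [Set.indicator_of_notMem hB]
      convert measureReal_empty
      ext ω; simp only [Set.mem_inter_iff, Set.mem_preimage, Set.mem_ofPred_eq,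
        Set.mem_empty_iff_false, iff_false, Set.mem_sdiff, Bool.not_eq_true]
      exact fun h => hB (h.2 ▸ h.1.2)

/-- The past is independent of the covariates of the future participants. -/
lemma indep_past_future (h : IsSequentialTrial μ ν A c N W D π) {n : ℕ} (hn : n ≤ N) :
    Indep (past W D n) (future W N n) μ := by
  induction n with
  | zero =>
    have : past W D 0 = ⊥ := by simp [past]
    rw [this]
    exact indep_bot_left _
  | succ n ih =>
    have h1 := ih (Nat.le_of_succ_le hn)
    rw [future_eq_sup W hn] at h1
    -- The covariates `W n` are moved to the past by contraction; the arm `D n` follows through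
    -- `measureReal_inter_arm`.
    have h2 := indep_sup_left_of_indep_sup_right (h.past_le (Nat.le_of_succ_le hn))
      (h.comap_W_le hn) (h.future_le _) h1 (h.indep_comap_future hn)
    rw [past_succ]
    refine indep_sup_left_of_inter (sup_le (h.past_le (Nat.le_of_succ_le hn)) (h.comap_W_le hn))
      (measurable_iff_comap_le.1 (h.measurable_D n hn)) (h.future_le _) ?_
    rintro s t u hs ⟨B, -, rfl⟩ hu
    have h3 := h.measureReal_inter_arm hn h2 hs hu
    rw [← ENNReal.toReal_eq_toReal_iff' (measure_ne_top _ _)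
      (ENNReal.mul_ne_top (measure_ne_top _ _) (measure_ne_top _ _)), ENNReal.toReal_mul]
    change μ.real _ = μ.real _ * μ.real _
    rw [Set.inter_right_comm, h.measureReal_inter_preimage_arm hn,
      h.measureReal_inter_preimage_arm hn, h3, h3, add_mul]
    congr 1 <;> simp only [Set.indicator] <;> split_ifs <;> simp

/-- The past is independent of the covariates of the present participant. -/
lemma indep_past_comap (h : IsSequentialTrial μ ν A c N W D π) {n : ℕ} (hn : n < N) :
    Indep (past W D n) (MeasurableSpace.comap (W n) inferInstance) μ :=
  indep_of_indep_of_le_right (h.indep_past_future hn.le) (future_eq_sup W hn ▸ le_sup_left)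

end IsSequentialTrial
end FairExperiment

/-! ### Conditional means given the past, and orthogonality of deviations. -/

namespace FairExperiment

namespace IsSequentialTrial

variable {Ω 𝒲 : Type*} [mΩ : MeasurableSpace Ω] [MeasurableSpace 𝒲] {m : ℕ} {μ : Measure Ω}
  [IsProbabilityMeasure μ] {ν : Measure 𝒲} {A : Fin m → Set 𝒲} {c : ℝ} {N : ℕ} {W : ℕ → Ω → 𝒲}
  {D : ℕ → Ω → Bool} {π : ℕ → Fin m → Ω → ℝ}

section MeanOutcome

variable {𝕜 : Type*} [RCLike 𝕜]

lemma integrable_comp_W {f : 𝒲 → 𝕜} (h : IsSequentialTrial μ ν A c N W D π) {n : ℕ} (hn : n < N)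
    (hf : Measurable f) (hfi : Integrable f ν) : Integrable (fun ω => f (W n ω)) μ := by
  rw [← h.law n hn] at hfi
  exact (integrable_map_measure hf.aestronglyMeasurable (h.measurable_W n hn).aemeasurable).1 hfi

lemma integral_comp_W {f : 𝒲 → 𝕜} (h : IsSequentialTrial μ ν A c N W D π) {n : ℕ} (hn : n < N)
    (hf : Measurable f) : ∫ ω, f (W n ω) ∂μ = ∫ w, f w ∂ν := by
  rw [← h.law n hn]
  exact (integral_map (h.measurable_W n hn).aemeasurable hf.aestronglyMeasurable).symm

lemma measurable_comp_W {f : 𝒲 → 𝕜} (hf : Measurable f) (n : ℕ) :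
    Measurable[MeasurableSpace.comap (W n) inferInstance] (fun ω => f (W n ω)) :=
  hf.comp (comap_measurable (W n))

/-- A product of independent integrable functions is integrable, so `H` need not be bounded. It is
later a partial sum of deviations. -/
lemma integrable_mul_comp_W {f : 𝒲 → 𝕜} {H : Ω → 𝕜} (h : IsSequentialTrial μ ν A c N W D π)
    {n : ℕ} (hn : n < N) (hf : Measurable f) (hfi : Integrable f ν) (hH : Measurable[past W D n] H)
    (hHi : Integrable H μ) : Integrable (fun ω => H ω * f (W n ω)) μ :=
  (indepFun_of_indep (h.indep_past_comap hn) hH (measurable_comp_W hf n)).integrable_mul hHi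
    (h.integrable_comp_W hn hf hfi)

lemma outcome_eq_sum (f : 𝒲 → Bool → 𝕜) (w : 𝒲) (d : Bool) :
    f w d = ∑ b : Bool, (if d = b then (1 : ℝ) else 0) • f w b := by
  cases d <;> simp

lemma integrable_armProb_smul {H : Ω → 𝕜} (h : IsSequentialTrial μ ν A c N W D π) {n : ℕ}
    (hn : n < N) (hHi : Integrable H μ) (d : Bool) (j : Fin m) :
    Integrable (fun ω => armProb d (π n j ω) • H ω) μ := by
  refine hHi.bdd_smul 1 (φ := fun ω => armProb d (π n j ω)) ?_ ?_
  · exact ((measurable_armProb d).comp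
      ((h.measurable_π n hn j).mono (h.past_le hn.le) le_rfl)).aestronglyMeasurable
  · filter_upwards [h.mem_Icc n hn] with ω hω
    rw [Real.norm_of_nonneg (armProb_nonneg h.pos (hω j) d)]
    exact armProb_le_one h.pos (hω j) d

lemma integrable_arm_smul {H : Ω → 𝕜} (h : IsSequentialTrial μ ν A c N W D π) {n : ℕ}
    (hn : n < N) (hHi : Integrable H μ) (d : Bool) :
    Integrable (fun ω => (if D n ω = d then (1 : ℝ) else 0) • H ω) μ := by
  refine hHi.bdd_smul 1 (h.measurable_arm hn d).aestronglyMeasurable (ae_of_all _ fun ω => ?_)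
  split_ifs <;> simp

lemma integrable_mul_outcome {f : 𝒲 → Bool → 𝕜} {H : Ω → 𝕜}
    (h : IsSequentialTrial μ ν A c N W D π) {n : ℕ} (hn : n < N) (hf : ∀ d, Measurable (f · d))
    (hfi : ∀ d, Integrable (f · d) ν) (hH : Measurable[past W D n] H) (hHi : Integrable H μ) :
    Integrable (fun ω => H ω * f (W n ω) (D n ω)) μ := by
  simp_rw [outcome_eq_sum f _ (D n _), Finset.mul_sum, mul_smul_comm]
  exact integrable_finsetSum _ fun d _ => h.integrable_arm_smul hn
    (h.integrable_mul_comp_W hn (hf d) (hfi d) hH hHi) d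

lemma integrable_mul_designMean (f : 𝒲 → Bool → 𝕜) {H : Ω → 𝕜}
    (h : IsSequentialTrial μ ν A c N W D π) {n : ℕ} (hn : n < N) (hHi : Integrable H μ) :
    Integrable (fun ω => H ω * designMean ν A f (fun j => π n j ω)) μ := by
  simp only [designMean, Finset.mul_sum]
  refine integrable_finsetSum _ fun d _ => integrable_finsetSum _ fun j _ => ?_
  simp_rw [mul_smul_comm, ← smul_mul_assoc]
  exact (h.integrable_armProb_smul hn hHi d j).mul_const _

/-- Conditionally on the past, the mean of `f (W n) (D n)` is `designMean ν A f (π n)`. -/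
lemma integral_mul_outcome {f : 𝒲 → Bool → 𝕜} {H : Ω → 𝕜}
    (h : IsSequentialTrial μ ν A c N W D π) {n : ℕ} (hn : n < N) (hf : ∀ d, Measurable (f · d))
    (hfi : ∀ d, Integrable (f · d) ν) (hH : Measurable[past W D n] H) (hHi : Integrable H μ) :
    ∫ ω, H ω * f (W n ω) (D n ω) ∂μ =
      ∫ ω, H ω * designMean ν A f (fun j => π n j ω) ∂μ := by
  simp only [designMean, Finset.mul_sum]
  simp_rw [outcome_eq_sum f _ (D n _), Finset.mul_sum, mul_smul_comm]
  have hR : ∀ d j, Integrable (fun ω => armProb d (π n j ω) • (H ω * ∫ w in A j, f w d ∂ν)) μ := by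
    intro d j
    simp_rw [← smul_mul_assoc]
    exact (h.integrable_armProb_smul hn hHi d j).mul_const _
  rw [integral_finsetSum _ fun d _ => h.integrable_arm_smul hn
    (h.integrable_mul_comp_W hn (hf d) (hfi d) hH hHi) d,
    integral_finsetSum _ fun d _ => integrable_finsetSum _ fun j _ => hR d j]
  refine Finset.sum_congr rfl fun d _ => ?_
  rw [integral_finsetSum _ fun j _ => hR d j]
  rw [h.integral_arm_mul hn d (h.integrable_mul_comp_W hn (hf d) (hfi d) hH hHi)]
  swap
  · exact (hH.mono le_sup_left le_rfl).mul ((measurable_comp_W (hf d) n).mono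
      (le_sup_of_le_right (future_eq_sup W hn ▸ le_sup_left)) le_rfl)
  have hAm : ∀ j, Measurable ((A j).indicator (f · d)) := fun j =>
    (hf d).indicator (h.partition.measurableSet j)
  have hAi : ∀ j, Integrable ((A j).indicator (f · d)) ν := fun j =>
    (hfi d).indicator (h.partition.measurableSet j)
  have hHm : ∀ j, Measurable[past W D n] (fun ω => armProb d (π n j ω) • H ω) := fun j =>
    Measurable.smul ((measurable_armProb d).comp (h.measurable_π n hn j)) hH
  -- Once the group indicator is attached to `f`, every summand is a past-measurable factor times a
  -- function of `W n`, and the two are independent.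
  have h1 : ∀ ω, (∑ j, (A j).indicator (fun _ => (1 : ℝ)) (W n ω) * armProb d (π n j ω)) •
      (H ω * f (W n ω) d) =
      ∑ j, (armProb d (π n j ω) • H ω) * (A j).indicator (f · d) (W n ω) := by
    intro ω
    rw [Finset.sum_smul]
    refine Finset.sum_congr rfl fun j _ => ?_
    by_cases hj : W n ω ∈ A j
    · simp [hj]
    · simp [hj]
  simp_rw [h1]
  rw [integral_finsetSum _ fun j _ => h.integrable_mul_comp_W hn (hAm j) (hAi j) (hHm j)
    (h.integrable_armProb_smul hn hHi d j)]
  refine Finset.sum_congr rfl fun j _ => ?_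
  rw [integral_mul_of_indep (h.indep_past_comap hn) (h.past_le hn.le) (h.comap_W_le hn) (hHm j)
    (measurable_comp_W (hAm j) n), h.integral_comp_W hn (hAm j),
    integral_indicator (h.partition.measurableSet j), ← integral_mul_const]
  simp_rw [smul_mul_assoc]

end MeanOutcome

end IsSequentialTrial

section DesignMean

variable {𝒲 : Type*} [MeasurableSpace 𝒲] {m : ℕ} {ν : Measure 𝒲} {A : Fin m → Set 𝒲}
  {F : Type*} [NormedAddCommGroup F] [NormedSpace ℝ F]

/-- The arm probabilities are at most one and the groups partition the space, so the bound does not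
depend on the allocation. -/
lemma norm_designMean_le {c : ℝ} (hc : 0 < c) (hA : IsMeasurablePartition A) {f : 𝒲 → Bool → F}
    (hfi : ∀ d, Integrable (f · d) ν) {p : Fin m → ℝ} (hp : ∀ j, p j ∈ Set.Icc c (1 - c)) :
    ‖designMean ν A f p‖ ≤ ∑ d : Bool, ∫ w, ‖f w d‖ ∂ν := by
  refine (norm_sum_le _ _).trans (Finset.sum_le_sum fun d _ => ?_)
  have h1 : ∫ w, ‖f w d‖ ∂ν = ∑ j, ∫ w in A j, ‖f w d‖ ∂ν := by
    rw [← integral_iUnion_fintype hA.measurableSet hA.disjoint fun j => (hfi d).norm.integrableOn,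
      hA.iUnion_eq, setIntegral_univ]
  rw [h1]
  refine (norm_sum_le _ _).trans (Finset.sum_le_sum fun j _ => ?_)
  rw [norm_smul, Real.norm_of_nonneg (armProb_nonneg hc (hp j) d)]
  calc _ ≤ 1 * ‖∫ w in A j, f w d ∂ν‖ := by gcongr; exact armProb_le_one hc (hp j) d
    _ ≤ _ := by rw [one_mul]; exact norm_integral_le_integral_norm _

lemma measurable_designMean (f : 𝒲 → Bool → ℝ) : Measurable (designMean ν A f) := by
  unfold designMean
  exact Finset.measurable_sum _ fun d _ => Finset.measurable_sum _ fun j _ =>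
    ((measurable_armProb d).comp (measurable_pi_apply j)).smul_const _

end DesignMean

namespace IsSequentialTrial

variable {Ω 𝒲 : Type*} [mΩ : MeasurableSpace Ω] [MeasurableSpace 𝒲] {m : ℕ} {μ : Measure Ω}
  [IsProbabilityMeasure μ] {ν : Measure 𝒲} {A : Fin m → Set 𝒲} {c : ℝ} {N : ℕ} {W : ℕ → Ω → 𝒲}
  {D : ℕ → Ω → Bool} {π : ℕ → Fin m → Ω → ℝ}

lemma measurable_outcome {β : Type*} [MeasurableSpace β] {f : 𝒲 → Bool → β}
    (hf : ∀ d, Measurable (f · d)) {n l : ℕ} (hl : l < n) :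
    Measurable[past W D n] (fun ω => f (W l ω) (D l ω)) :=
  (measurable_from_prod_countable_left (f := fun q : 𝒲 × Bool => f q.1 q.2) hf).comp
    (measurable_past hl)

/-- The deviation of `f (W n) (D n)` from its conditional mean given the past. -/
noncomputable def deviation {Ω 𝒲 : Type*} [MeasurableSpace 𝒲] {m : ℕ} (ν : Measure 𝒲)
    (A : Fin m → Set 𝒲) (W : ℕ → Ω → 𝒲) (D : ℕ → Ω → Bool) (π : ℕ → Fin m → Ω → ℝ)
    (f : 𝒲 → Bool → ℝ) (n : ℕ) (ω : Ω) : ℝ :=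
  f (W n ω) (D n ω) - designMean ν A f (fun j => π n j ω)

variable {f : 𝒲 → Bool → ℝ}

lemma measurable_designMean_π (h : IsSequentialTrial μ ν A c N W D π) {n : ℕ} (hn : n < N) :
    Measurable[past W D n] (fun ω => designMean ν A f (fun j => π n j ω)) :=
  (measurable_designMean f).comp (@measurable_pi_lambda _ _ _ (past W D n) _ _ fun j => h.measurable_π n hn j)

lemma measurable_deviation (h : IsSequentialTrial μ ν A c N W D π) (hf : ∀ d, Measurable (f · d))
    {n l : ℕ} (hl : l < n) (hl' : l < N) :
    Measurable[past W D n] (deviation ν A W D π f l) :=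
  (measurable_outcome hf hl).sub ((h.measurable_designMean_π hl').mono (past_mono hl.le) le_rfl)

lemma memLp_outcome (h : IsSequentialTrial μ ν A c N W D π) {n : ℕ} (hn : n < N)
    (hf : ∀ d, Measurable (f · d)) {q : ENNReal} (hf2 : ∀ d, MemLp (f · d) q ν) :
    MemLp (fun ω => f (W n ω) (D n ω)) q μ := by
  have h1 : ∀ d, MemLp (fun ω => f (W n ω) d) q μ := fun d => by
    have := hf2 d
    rw [← h.law n hn] at this
    exact (memLp_map_measure_iff (hf d).aestronglyMeasurable
      (h.measurable_W n hn).aemeasurable).1 this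
  refine ((h1 true).norm.add (h1 false).norm).of_le
    ((measurable_outcome hf (Nat.lt_succ_self n)).mono (h.past_le hn) le_rfl).aestronglyMeasurable
    (ae_of_all _ fun ω => ?_)
  have h2 : 0 ≤ ‖f (W n ω) true‖ + ‖f (W n ω) false‖ := by positivity
  simp only [Pi.add_apply]
  rw [Real.norm_of_nonneg h2]
  cases D n ω <;> simp

lemma memLp_deviation [IsProbabilityMeasure ν] (h : IsSequentialTrial μ ν A c N W D π) {n : ℕ}
    (hn : n < N) (hf : ∀ d, Measurable (f · d)) (hf2 : ∀ d, MemLp (f · d) 2 ν) :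
    MemLp (deviation ν A W D π f n) 2 μ := by
  refine (h.memLp_outcome hn hf hf2).sub (MemLp.of_bound ((h.measurable_designMean_π hn).mono
    (h.past_le hn.le) le_rfl).aestronglyMeasurable (∑ d : Bool, ∫ w, ‖f w d‖ ∂ν) ?_)
  filter_upwards [h.mem_Icc n hn] with ω hω
  exact norm_designMean_le h.pos h.partition (fun d => (hf2 d).integrable (by norm_num)) hω

/-- A bound for the second moment of a deviation. -/
noncomputable def deviationBound {𝒲 : Type*} [MeasurableSpace 𝒲] (ν : Measure 𝒲)
    (f : 𝒲 → Bool → ℝ) : ℝ :=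
  2 * (∑ d : Bool, ∫ w, f w d ^ 2 ∂ν) + 2 * (∑ d : Bool, ∫ w, ‖f w d‖ ∂ν) ^ 2

/-- From `(x - y)² ≤ 2x² + 2y²`, where the outcome in the chosen arm is dominated by the sum over
both arms. The resulting constant is the same for all participants and all designs. -/
lemma integral_deviation_sq_le [IsProbabilityMeasure ν] (h : IsSequentialTrial μ ν A c N W D π)
    {n : ℕ} (hn : n < N) (hf : ∀ d, Measurable (f · d)) (hf2 : ∀ d, MemLp (f · d) 2 ν) :
    ∫ ω, deviation ν A W D π f n ω ^ 2 ∂μ ≤ deviationBound ν f := by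
  have h1 : ∀ d, Integrable (fun ω => f (W n ω) d ^ 2) μ := fun d =>
    h.integrable_comp_W hn ((hf d).pow_const 2) (hf2 d).integrable_sq
  have h2 : ∀ᵐ ω ∂μ, deviation ν A W D π f n ω ^ 2 ≤
      2 * (∑ d : Bool, f (W n ω) d ^ 2) + 2 * (∑ d : Bool, ∫ w, ‖f w d‖ ∂ν) ^ 2 := by
    filter_upwards [h.mem_Icc n hn] with ω hω
    have h3 := norm_designMean_le h.pos h.partition
      (fun d => (hf2 d).integrable (by norm_num)) hω
    have h4 : f (W n ω) (D n ω) ^ 2 ≤ ∑ d : Bool, f (W n ω) d ^ 2 :=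
      Finset.single_le_sum (f := fun d => f (W n ω) d ^ 2) (fun d _ => sq_nonneg _)
        (Finset.mem_univ (D n ω))
    have h5 : designMean ν A f (fun j => π n j ω) ^ 2 ≤ (∑ d : Bool, ∫ w, ‖f w d‖ ∂ν) ^ 2 := by
      rw [← sq_abs]; exact pow_le_pow_left₀ (abs_nonneg _) h3 2
    unfold deviation
    nlinarith [sq_nonneg (f (W n ω) (D n ω) + designMean ν A f (fun j => π n j ω))]
  have h6 : Integrable (fun ω => ∑ d : Bool, f (W n ω) d ^ 2) μ :=
    integrable_finsetSum _ fun d _ => h1 d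
  refine (integral_mono_ae (h.memLp_deviation hn hf hf2).integrable_sq
    ((h6.const_mul 2).add (integrable_const _)) h2).trans_eq ?_
  simp only [Pi.add_apply]
  rw [integral_add (h6.const_mul 2) (integrable_const _), integral_const_mul,
    integral_finsetSum _ fun d _ => h1 d]
  simp_rw [fun d => h.integral_comp_W hn ((hf d).pow_const 2)]
  simp [deviationBound]

/-- Deviations of different participants are orthogonal. -/
lemma integral_sum_deviation_sq_le [IsProbabilityMeasure ν]
    (h : IsSequentialTrial μ ν A c N W D π) (hf : ∀ d, Measurable (f · d))
    (hf2 : ∀ d, MemLp (f · d) 2 ν) {n : ℕ} (hn : n ≤ N) :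
    MemLp (fun ω => ∑ l ∈ Finset.range n, deviation ν A W D π f l ω) 2 μ ∧
    ∫ ω, (∑ l ∈ Finset.range n, deviation ν A W D π f l ω) ^ 2 ∂μ ≤ n * deviationBound ν f := by
  induction n with
  | zero => simp
  | succ n ih =>
    obtain ⟨ih1, ih2⟩ := ih (Nat.le_of_succ_le hn)
    have hZ := h.memLp_deviation hn hf hf2
    have hint : ∀ d, Integrable (f · d) ν := fun d => (hf2 d).integrable (by norm_num)
    simp only [Finset.sum_range_succ]
    refine ⟨ih1.add hZ, ?_⟩
    set S : Ω → ℝ := fun ω => ∑ l ∈ Finset.range n, deviation ν A W D π f l ω with hS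
    have hSm : Measurable[past W D n] S := Finset.measurable_sum _ fun l hl =>
      h.measurable_deviation hf (Finset.mem_range.1 hl) ((Finset.mem_range.1 hl).trans hn)
    have hSi : Integrable S μ := ih1.integrable (by norm_num)
    -- The partial sum belongs to the past, given which the next deviation has mean zero.
    have hcross : ∫ ω, S ω * deviation ν A W D π f n ω ∂μ = 0 := by
      simp only [deviation, mul_sub]
      rw [integral_sub (h.integrable_mul_outcome hn hf hint hSm hSi)
        (h.integrable_mul_designMean f hn hSi), h.integral_mul_outcome hn hf hint hSm hSi, sub_self]
    have h1 : ∀ ω, (S ω + deviation ν A W D π f n ω) ^ 2 =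
        S ω ^ 2 + 2 * (S ω * deviation ν A W D π f n ω) + deviation ν A W D π f n ω ^ 2 := by
      intro ω; ring
    change ∫ ω, (S ω + deviation ν A W D π f n ω) ^ 2 ∂μ ≤ _
    simp_rw [h1]
    have hc : Integrable (fun ω => 2 * (S ω * deviation ν A W D π f n ω)) μ :=
      (MemLp.integrable_mul ih1 hZ).const_mul 2
    have hd : Integrable (fun ω => S ω ^ 2 + 2 * (S ω * deviation ν A W D π f n ω)) μ :=
      ih1.integrable_sq.add hc
    rw [integral_add hd hZ.integrable_sq,
      integral_add ih1.integrable_sq hc, integral_const_mul, hcross]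
    have h3 := h.integral_deviation_sq_le hn hf hf2
    push_cast
    linarith

end IsSequentialTrial
end FairExperiment

/-! ### The central limit theorem for sequential trials. -/

namespace FairExperiment

section DesignMean

variable {𝒲 : Type*} [MeasurableSpace 𝒲] {m : ℕ} {ν : Measure 𝒲} {A : Fin m → Set 𝒲}

lemma designMean_sub {F : Type*} [NormedAddCommGroup F] [NormedSpace ℝ F] {f g : 𝒲 → Bool → F}
    (hf : ∀ d, Integrable (f · d) ν) (hg : ∀ d, Integrable (g · d) ν) (p : Fin m → ℝ) :
    designMean ν A (fun w d => f w d - g w d) p = designMean ν A f p - designMean ν A g p := by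
  simp only [designMean, ← Finset.sum_sub_distrib, ← smul_sub]
  refine Finset.sum_congr rfl fun d _ => Finset.sum_congr rfl fun j _ => ?_
  rw [integral_sub (hf d).integrableOn (hg d).integrableOn]

lemma designMean_const_mul {𝕜 : Type*} [RCLike 𝕜] (a : 𝕜) (f : 𝒲 → Bool → 𝕜) (p : Fin m → ℝ) :
    designMean ν A (fun w d => a * f w d) p = a * designMean ν A f p := by
  simp only [designMean, Finset.mul_sum, integral_const_mul, mul_smul_comm]

lemma designMean_ofReal (f : 𝒲 → Bool → ℝ) (p : Fin m → ℝ) :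
    designMean ν A (fun w d => (f w d : ℂ)) p = ((designMean ν A f p : ℝ) : ℂ) := by
  simp only [designMean, integral_complex_ofReal, Complex.ofReal_sum, smul_eq_mul,
    Complex.ofReal_mul, Complex.real_smul]

lemma designMean_one [IsProbabilityMeasure ν] (hA : IsMeasurablePartition A) (p : Fin m → ℝ) :
    designMean ν A (fun _ _ => (1 : ℝ)) p = 1 := by
  have h1 : ∑ j, ν.real (A j) = 1 := by
    rw [← measureReal_iUnion_fintype hA.disjoint hA.measurableSet, hA.iUnion_eq]
    simp
  simp only [designMean, Fintype.sum_bool, ← Finset.sum_add_distrib, armProb]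
  refine (Finset.sum_congr rfl fun j _ => ?_).trans h1
  simp
  ring

end DesignMean

/-- For `|y| ≤ 1` this is the remainder of the exponential series; for `|y| > 1` the triangle
inequality gives `2 + |y| + y²/2`, which is at most `4|y|³`. -/
lemma norm_cexp_sub_taylor_two_le (y : ℝ) :
    ‖Complex.exp (y * Complex.I) - ((1 - y ^ 2 / 2 : ℝ) : ℂ) - Complex.I * (y : ℂ)‖ ≤
      4 * |y| ^ 3 := by
  rcases le_or_gt |y| 1 with hy | hy
  · have h1 : ‖(y * Complex.I : ℂ)‖ ≤ 1 := by simpa using hy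
    have h2 := Complex.exp_bound h1 (n := 3) (by norm_num)
    have h3 : ∑ k ∈ Finset.range 3, (y * Complex.I : ℂ) ^ k / (k.factorial : ℂ) =
        ((1 - y ^ 2 / 2 : ℝ) : ℂ) + Complex.I * (y : ℂ) := by
      simp [Finset.sum_range_succ, mul_pow, Nat.factorial]
      ring
    rw [h3, ← sub_sub] at h2
    refine h2.trans ?_
    have : ‖(y * Complex.I : ℂ)‖ = |y| := by simp
    rw [this]
    norm_num [Nat.factorial]
    nlinarith [pow_nonneg (abs_nonneg y) 3]
  · have h1 : ‖Complex.exp (y * Complex.I)‖ = 1 := Complex.norm_exp_ofReal_mul_I y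
    have h2 : ‖((1 - y ^ 2 / 2 : ℝ) : ℂ)‖ ≤ 1 + |y| ^ 2 / 2 := by
      rw [Complex.norm_real, Real.norm_eq_abs, sq_abs]
      refine (abs_sub _ _).trans ?_
      rw [abs_one, abs_of_nonneg (by positivity)]
    have h3 : ‖Complex.I * (y : ℂ)‖ = |y| := by simp
    refine (norm_sub_le _ _).trans ((add_le_add_left (norm_sub_le _ _) _).trans ?_)
    rw [h1, h3]
    nlinarith [mul_pos (sub_pos.2 hy) (sub_pos.2 hy), sq_nonneg (|y|),
      mul_pos (sub_pos.2 hy) (mul_pos (zero_lt_one.trans hy) (zero_lt_one.trans hy))]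

namespace IsSequentialTrial

variable {Ω 𝒲 : Type*} [mΩ : MeasurableSpace Ω] [MeasurableSpace 𝒲] {m : ℕ} {μ : Measure Ω}
  [IsProbabilityMeasure μ] {ν : Measure 𝒲} [IsProbabilityMeasure ν] {A : Fin m → Set 𝒲} {c : ℝ}

section OneTrial

variable {N : ℕ} {W : ℕ → Ω → 𝒲} {D : ℕ → Ω → Bool} {π : ℕ → Fin m → Ω → ℝ}
  {g : 𝒲 → Bool → ℝ}

/-- Second-order expansion of the conditional characteristic function of one summand. The linear
term vanishes by `hQ`, the remainder costs a third moment, and the last term is the price of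
replacing the conditional variance by `V`. -/
lemma norm_designMean_cexp_sub_le (hA : IsMeasurablePartition A) (hc : 0 < c)
    (hg : ∀ d, Measurable (g · d)) (hg3 : ∀ d, MemLp (g · d) 3 ν)
    (hQ : ∀ p, designMean ν A g p = 0) (x V : ℝ) {p : Fin m → ℝ}
    (hp : ∀ j, p j ∈ Set.Icc c (1 - c)) :
    ‖designMean ν A (fun w d => Complex.exp ((x * g w d : ℝ) * Complex.I)) p -
        ((1 - x ^ 2 / 2 * V : ℝ) : ℂ)‖ ≤
      4 * |x| ^ 3 * (∑ d : Bool, ∫ w, |g w d| ^ 3 ∂ν) +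
        x ^ 2 / 2 * |designMean ν A (fun w d => g w d ^ 2) p - V| := by
  have hg1 : ∀ d, Integrable (g · d) ν := fun d => (hg3 d).integrable (by norm_num)
  have hg2 : ∀ d, Integrable (fun w => g w d ^ 2) ν := fun d =>
    ((hg3 d).mono_exponent (by norm_num)).integrable_sq
  have hgc : ∀ d, Integrable (fun w => |g w d| ^ 3) ν := fun d => by
    simpa using (hg3 d).integrable_norm_pow (p := 3) (by norm_num)
  have hE : ∀ d, Integrable (fun w => Complex.exp ((x * g w d : ℝ) * Complex.I)) ν := fun d =>
    Integrable.of_bound (by have := hg d; fun_prop) 1 (ae_of_all _ fun w =>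
      (Complex.norm_exp_ofReal_mul_I _).le)
  have hR : ∀ d, Integrable (fun w => 1 - x ^ 2 / 2 * g w d ^ 2) ν := fun d =>
    (integrable_const _).sub ((hg2 d).const_mul _)
  have hRc : ∀ d, Integrable (fun w => ((1 - x ^ 2 / 2 * g w d ^ 2 : ℝ) : ℂ)) ν := fun d =>
    (hR d).ofReal
  have hI : ∀ d, Integrable (fun w => Complex.I * (x * g w d : ℝ)) ν := fun d =>
    (((hg1 d).const_mul x).ofReal).const_mul _
  have h1 : designMean ν A (fun w d => Complex.exp ((x * g w d : ℝ) * Complex.I) -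
      ((1 - x ^ 2 / 2 * g w d ^ 2 : ℝ) : ℂ) - Complex.I * (x * g w d : ℝ)) p =
      designMean ν A (fun w d => Complex.exp ((x * g w d : ℝ) * Complex.I)) p -
        ((1 - x ^ 2 / 2 * designMean ν A (fun w d => g w d ^ 2) p : ℝ) : ℂ) := by
    have hER : ∀ d, Integrable (fun w => Complex.exp ((x * g w d : ℝ) * Complex.I) -
        ((1 - x ^ 2 / 2 * g w d ^ 2 : ℝ) : ℂ)) ν := fun d => (hE d).sub (hRc d)
    rw [designMean_sub hER hI, designMean_sub hE hRc,
      designMean_const_mul, designMean_ofReal, designMean_ofReal, designMean_const_mul, hQ,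
      designMean_sub (fun _ => integrable_const _) (fun d => (hg2 d).const_mul _),
      designMean_one hA, designMean_const_mul]
    simp
  have h2 := norm_designMean_le hc hA (fun d => ((hE d).sub (hRc d)).sub (hI d)) hp
  simp only [Pi.sub_apply] at h2
  rw [h1] at h2
  have h3 : ∀ d, ∫ w, ‖Complex.exp ((x * g w d : ℝ) * Complex.I) -
      ((1 - x ^ 2 / 2 * g w d ^ 2 : ℝ) : ℂ) - Complex.I * (x * g w d : ℝ)‖ ∂ν ≤
      4 * |x| ^ 3 * ∫ w, |g w d| ^ 3 ∂ν := by
    intro d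
    rw [← integral_const_mul]
    refine integral_mono (((hE d).sub (hRc d)).sub (hI d)).norm ((hgc d).const_mul _) fun w => ?_
    have h4 := norm_cexp_sub_taylor_two_le (x * g w d)
    have h5 : 1 - x ^ 2 / 2 * g w d ^ 2 = 1 - (x * g w d) ^ 2 / 2 := by ring
    rw [← h5] at h4
    refine h4.trans_eq ?_
    rw [abs_mul]; ring
  have h6 : designMean ν A (fun w d => Complex.exp ((x * g w d : ℝ) * Complex.I)) p -
        ((1 - x ^ 2 / 2 * V : ℝ) : ℂ) =
      (designMean ν A (fun w d => Complex.exp ((x * g w d : ℝ) * Complex.I)) p -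
        ((1 - x ^ 2 / 2 * designMean ν A (fun w d => g w d ^ 2) p : ℝ) : ℂ)) -
      ((x ^ 2 / 2 * (designMean ν A (fun w d => g w d ^ 2) p - V) : ℝ) : ℂ) := by
    push_cast; ring
  rw [h6]
  refine (norm_sub_le _ _).trans (add_le_add (h2.trans ?_) ?_)
  · rw [Finset.mul_sum]
    exact Finset.sum_le_sum fun d _ => h3 d
  · rw [Complex.norm_real, norm_mul, Real.norm_of_nonneg (by positivity), Real.norm_eq_abs]

/-- A telescoping argument: the factors are replaced one at a time by `1 - x²V/2`. All other factors
have modulus at most one, so the errors of single participants simply add up. -/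
lemma norm_charFun_sub_pow_le (h : IsSequentialTrial μ ν A c N W D π)
    (hg : ∀ d, Measurable (g · d)) (hg3 : ∀ d, MemLp (g · d) 3 ν)
    (hQ : ∀ p, designMean ν A g p = 0) {x V : ℝ} (hV : |1 - x ^ 2 / 2 * V| ≤ 1) {n : ℕ}
    (hn : n ≤ N) :
    ‖∫ ω, Complex.exp ((x * ∑ l ∈ Finset.range n, g (W l ω) (D l ω) : ℝ) * Complex.I) ∂μ -
        ((1 - x ^ 2 / 2 * V : ℝ) : ℂ) ^ n‖ ≤
      ∑ l ∈ Finset.range n, (4 * |x| ^ 3 * (∑ d : Bool, ∫ w, |g w d| ^ 3 ∂ν) + x ^ 2 / 2 *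
        ∫ ω, |designMean ν A (fun w d => g w d ^ 2) (fun j => π l j ω) - V| ∂μ) := by
  induction n with
  | zero => simp
  | succ n ih =>
    have ih := ih (Nat.le_of_succ_le hn)
    set r : ℂ := ((1 - x ^ 2 / 2 * V : ℝ) : ℂ) with hr
    set H : Ω → ℂ := fun ω =>
      Complex.exp ((x * ∑ l ∈ Finset.range n, g (W l ω) (D l ω) : ℝ) * Complex.I) with hH
    set f : 𝒲 → Bool → ℂ := fun w d => Complex.exp ((x * g w d : ℝ) * Complex.I) with hf
    have hfm : ∀ d, Measurable (f · d) := fun d => by have := hg d; fun_prop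
    have hHn : ∀ ω, ‖H ω‖ = 1 := fun ω => Complex.norm_exp_ofReal_mul_I _
    have hfi : ∀ d, Integrable (f · d) ν := fun d =>
      Integrable.of_bound (hfm d).aestronglyMeasurable 1 (ae_of_all _ fun w =>
        (Complex.norm_exp_ofReal_mul_I _).le)
    have hHm : Measurable[past W D n] H := by
      have h1 : Measurable[past W D n] (fun ω => ∑ l ∈ Finset.range n, g (W l ω) (D l ω)) :=
        Finset.measurable_sum _ fun l hl => measurable_outcome hg (Finset.mem_range.1 hl)
      have h2 : Measurable (fun y : ℝ => Complex.exp ((x * y : ℝ) * Complex.I)) := by fun_prop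
      exact h2.comp h1
    have hHi : Integrable H μ :=
      Integrable.of_bound (hHm.mono (h.past_le (Nat.le_of_succ_le hn)) le_rfl).aestronglyMeasurable
        1 (ae_of_all _ fun ω => (hHn ω).le)
    have h1 : ∀ ω, Complex.exp ((x * ∑ l ∈ Finset.range (n + 1), g (W l ω) (D l ω) : ℝ) *
        Complex.I) = H ω * f (W n ω) (D n ω) := by
      intro ω
      rw [hH, hf, ← Complex.exp_add, Finset.sum_range_succ]
      congr 1; push_cast; ring
    simp_rw [h1]
    rw [h.integral_mul_outcome hn hfm hfi hHm hHi]
    -- The error of the newest factor is separated from the error inherited from the first `n`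
    -- factors.
    have h2 : ∫ ω, H ω * designMean ν A f (fun j => π n j ω) ∂μ - r ^ (n + 1) =
        ∫ ω, H ω * (designMean ν A f (fun j => π n j ω) - r) ∂μ +
          r * (∫ ω, H ω ∂μ - r ^ n) := by
      simp_rw [mul_sub]
      rw [integral_sub (h.integrable_mul_designMean f hn hHi) (hHi.mul_const r),
        integral_mul_const]
      ring
    rw [h2, Finset.sum_range_succ, add_comm (Finset.sum _ _)]
    refine (norm_add_le _ _).trans (add_le_add ?_ ?_)
    · have hqi : Integrable (fun ω =>
          |designMean ν A (fun w d => g w d ^ 2) (fun j => π n j ω) - V|) μ := by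
        have h3 : Integrable (fun ω =>
            1 * designMean ν A (fun w d => g w d ^ 2) (fun j => π n j ω)) μ :=
          h.integrable_mul_designMean _ hn (integrable_const (1 : ℝ))
        simp only [one_mul] at h3
        exact (h3.sub (integrable_const V)).abs
      refine (norm_integral_le_of_norm_le ((integrable_const
        (4 * |x| ^ 3 * (∑ d : Bool, ∫ w, |g w d| ^ 3 ∂ν))).add (hqi.const_mul (x ^ 2 / 2)))
        ?_).trans_eq ?_
      · filter_upwards [h.mem_Icc n hn] with ω hω
        rw [norm_mul, hHn, one_mul]
        exact norm_designMean_cexp_sub_le h.partition h.pos hg hg3 hQ x V hω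
      · simp only [Pi.add_apply]
        rw [integral_add (integrable_const _) (hqi.const_mul _)]
        simp [integral_const_mul]
    · rw [norm_mul]
      have : ‖r‖ ≤ 1 := by rw [hr, Complex.norm_real]; exact hV
      exact (mul_le_of_le_one_left (norm_nonneg _) this).trans ih

end OneTrial

/-- A central limit theorem for sequential trials whose conditional variances stabilize. -/
theorem tendstoInDistribution_sum {N : ℕ → ℕ} {W : ℕ → ℕ → Ω → 𝒲} {D : ℕ → ℕ → Ω → Bool}
    {π : ℕ → ℕ → Fin m → Ω → ℝ} {g : 𝒲 → Bool → ℝ}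
    (h : ∀ k, IsSequentialTrial μ ν A c (N k) (W k) (D k) (π k)) (hN : Tendsto N atTop atTop)
    (hg : ∀ d, Measurable (g · d)) (hg3 : ∀ d, MemLp (g · d) 3 ν)
    (hQ : ∀ p, designMean ν A g p = 0) {V : ℝ} (hV : 0 ≤ V)
    (hq : Tendsto (fun k => (N k : ℝ)⁻¹ * ∑ l ∈ Finset.range (N k),
      ∫ ω, |designMean ν A (fun w d => g w d ^ 2) (fun j => π k l j ω) - V| ∂μ) atTop (𝓝 0)) :
    TendstoInDistribution
      (fun k ω => (√(N k : ℝ))⁻¹ * ∑ l ∈ Finset.range (N k), g (W k l ω) (D k l ω)) atTop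
      (id : ℝ → ℝ) (fun _ => μ) (gaussianReal 0 V.toNNReal) where
  forall_aemeasurable k := by
    have h1 : Measurable[past (W k) (D k) (N k)]
        (fun ω => ∑ l ∈ Finset.range (N k), g (W k l ω) (D k l ω)) :=
      Finset.measurable_sum _ fun l hl => measurable_outcome hg (Finset.mem_range.1 hl)
    exact ((h1.mono ((h k).past_le le_rfl) le_rfl).const_mul _).aemeasurable
  aemeasurable_limit := aemeasurable_id
  tendsto := by
    have hm : ∀ k, Measurable
        (fun ω => (√(N k : ℝ))⁻¹ * ∑ l ∈ Finset.range (N k), g (W k l ω) (D k l ω)) := fun k => by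
      have h1 : Measurable[past (W k) (D k) (N k)]
          (fun ω => ∑ l ∈ Finset.range (N k), g (W k l ω) (D k l ω)) :=
        Finset.measurable_sum _ fun l hl => measurable_outcome hg (Finset.mem_range.1 hl)
      exact (h1.mono ((h k).past_le le_rfl) le_rfl).const_mul _
    refine ProbabilityMeasure.tendsto_iff_tendsto_charFun.2 fun s => ?_
    simp only [ProbabilityMeasure.coe_mk, Measure.map_id]
    rw [charFun_gaussianReal, Real.coe_toNNReal V hV]
    have hcf : ∀ k, charFun (μ.map
        (fun ω => (√(N k : ℝ))⁻¹ * ∑ l ∈ Finset.range (N k), g (W k l ω) (D k l ω))) s =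
        ∫ ω, Complex.exp (((s * (√(N k : ℝ))⁻¹) * ∑ l ∈ Finset.range (N k),
          g (W k l ω) (D k l ω) : ℝ) * Complex.I) ∂μ := by
      intro k
      rw [charFun_apply_real, integral_map (hm k).aemeasurable
        (by fun_prop)]
      congr 1 with ω
      congr 1; push_cast; ring
    simp_rw [hcf]
    have hNr : Tendsto (fun k => (N k : ℝ)) atTop atTop := tendsto_natCast_atTop_atTop.comp hN
    have hsq : ∀ k, 0 < N k → (s * (√(N k : ℝ))⁻¹) ^ 2 = s ^ 2 * (N k : ℝ)⁻¹ := by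
      intro k hk
      rw [mul_pow, inv_pow, Real.sq_sqrt (Nat.cast_nonneg _)]
    have hpow : Tendsto (fun k => (1 - (s * (√(N k : ℝ))⁻¹) ^ 2 / 2 * V) ^ N k) atTop
        (𝓝 (Real.exp (-(s ^ 2 / 2 * V)))) := by
      refine ((Real.tendsto_one_add_div_pow_exp (-(s ^ 2 / 2 * V))).comp hN).congr' ?_
      filter_upwards [hN.eventually_gt_atTop 0] with k hk
      rw [Function.comp_apply, hsq k hk]
      congr 1; ring
    have hdiff : Tendsto (fun k =>
        ∫ ω, Complex.exp (((s * (√(N k : ℝ))⁻¹) * ∑ l ∈ Finset.range (N k),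
          g (W k l ω) (D k l ω) : ℝ) * Complex.I) ∂μ -
          ((1 - (s * (√(N k : ℝ))⁻¹) ^ 2 / 2 * V : ℝ) : ℂ) ^ N k) atTop (𝓝 0) := by
      -- With `x = s/√N`, the `N` cubic errors sum to order `N^{-1/2}`, and the weights `x²/2` turn
      -- the variance errors into the average controlled by `hq`.
      have hb : Tendsto (fun k => 4 * |s| ^ 3 * (∑ d : Bool, ∫ w, |g w d| ^ 3 ∂ν) *
          (√(N k : ℝ))⁻¹ + s ^ 2 / 2 * ((N k : ℝ)⁻¹ * ∑ l ∈ Finset.range (N k),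
          ∫ ω, |designMean ν A (fun w d => g w d ^ 2) (fun j => π k l j ω) - V| ∂μ)) atTop
          (𝓝 0) := by
        have h1 : Tendsto (fun k => (√(N k : ℝ))⁻¹) atTop (𝓝 0) :=
          tendsto_inv_atTop_zero.comp (Real.tendsto_sqrt_atTop.comp hNr)
        simpa using (h1.const_mul (4 * |s| ^ 3 * (∑ d : Bool, ∫ w, |g w d| ^ 3 ∂ν))).add
          (hq.const_mul (s ^ 2 / 2))
      refine squeeze_zero_norm' ?_ hb
      -- Makes `x²V/2` at most one, so that the replacement factor has modulus at most one.
      have hsmall : ∀ᶠ k in atTop, s ^ 2 * V ≤ (N k : ℝ) := hNr.eventually_ge_atTop _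
      filter_upwards [hN.eventually_gt_atTop 0, hsmall] with k hk hk2
      have hkr : (0 : ℝ) < N k := Nat.cast_pos.2 hk
      have hx : (s * (√(N k : ℝ))⁻¹) ^ 2 = s ^ 2 * (N k : ℝ)⁻¹ := hsq k hk
      have h1 : (s * (√(N k : ℝ))⁻¹) ^ 2 / 2 * V ≤ 1 := by
        rw [hx]
        have : s ^ 2 * (N k : ℝ)⁻¹ / 2 * V = (s ^ 2 * V) / N k / 2 := by
          field_simp
        rw [this]
        have := (div_le_one hkr).2 hk2
        linarith
      have h2 : 0 ≤ (s * (√(N k : ℝ))⁻¹) ^ 2 / 2 * V := by positivity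
      refine ((h k).norm_charFun_sub_pow_le hg hg3 hQ
        (x := s * (√(N k : ℝ))⁻¹) (V := V) (abs_le.2 ⟨by linarith, by linarith⟩) le_rfl).trans_eq ?_
      rw [Finset.sum_add_distrib, ← Finset.mul_sum, hx, Finset.sum_const, Finset.card_range,
        nsmul_eq_mul]
      have h3 : |s * (√(N k : ℝ))⁻¹| ^ 3 = |s| ^ 3 * ((√(N k : ℝ))⁻¹ * (N k : ℝ)⁻¹) := by
        rw [abs_mul, mul_pow, abs_of_nonneg (by positivity : 0 ≤ (√(N k : ℝ))⁻¹)]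
        congr 1
        rw [← mul_inv, pow_succ, inv_pow, Real.sq_sqrt (Nat.cast_nonneg _), ← mul_inv, mul_comm]
      rw [h3, ← Finset.mul_sum]
      field_simp
    have h4 := hdiff.add ((Complex.continuous_ofReal.tendsto _).comp hpow)
    rw [zero_add] at h4
    convert h4 using 2
    · simp
    · simp; ring_nf

end IsSequentialTrial
end FairExperiment

namespace FairExperiment

/-! ### Stability of the design problem -/

section DesignStability

variable {m : ℕ}

/-- The gap is an explicit square over a positive quantity, which also gives strictness when the
points differ. -/
lemma inv_midpoint_le {x y : ℝ} (hx : 0 < x) (hy : 0 < y) :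
    1 / ((x + y) / 2) ≤ (1 / x + 1 / y) / 2 := by
  have : (1 / x + 1 / y) / 2 - 1 / ((x + y) / 2) = (x - y) ^ 2 / (2 * x * y * (x + y)) := by
    field_simp; ring
  have h2 : 0 ≤ (x - y) ^ 2 / (2 * x * y * (x + y)) := by positivity
  linarith

lemma inv_midpoint_lt {x y : ℝ} (hx : 0 < x) (hy : 0 < y) (h : x ≠ y) :
    1 / ((x + y) / 2) < (1 / x + 1 / y) / 2 := by
  have : (1 / x + 1 / y) / 2 - 1 / ((x + y) / 2) = (x - y) ^ 2 / (2 * x * y * (x + y)) := by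
    field_simp; ring
  have h1 : 0 < (x - y) ^ 2 := by
    have := sub_ne_zero.2 h
    positivity
  have h2 : 0 < (x - y) ^ 2 / (2 * x * y * (x + y)) := by positivity
  linarith

lemma cost_midpoint_le {a b x y : ℝ} (ha : 0 ≤ a) (hb : 0 ≤ b) (hx : 0 < x) (hy : 0 < y)
    (hx1 : x < 1) (hy1 : y < 1) :
    a / ((x + y) / 2) + b / (1 - (x + y) / 2) ≤
      ((a / x + b / (1 - x)) + (a / y + b / (1 - y))) / 2 := by
  have h1 := mul_le_mul_of_nonneg_left (inv_midpoint_le hx hy) ha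
  have h2 := mul_le_mul_of_nonneg_left (inv_midpoint_le (sub_pos.2 hx1) (sub_pos.2 hy1)) hb
  have h3 : (1 - x + (1 - y)) / 2 = 1 - (x + y) / 2 := by ring
  rw [h3] at h2
  simp only [div_eq_mul_one_div a, div_eq_mul_one_div b]
  linarith

/-- Both `1/e` and `1/(1 - e)` are strictly convex on the unit interval, so one positive coefficient
suffices. -/
lemma cost_midpoint_lt {a b x y : ℝ} (ha : 0 ≤ a) (hb : 0 ≤ b) (hab : 0 < a ∨ 0 < b) (hx : 0 < x)
    (hy : 0 < y) (hx1 : x < 1) (hy1 : y < 1) (hxy : x ≠ y) :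
    a / ((x + y) / 2) + b / (1 - (x + y) / 2) <
      ((a / x + b / (1 - x)) + (a / y + b / (1 - y))) / 2 := by
  have h1 := mul_le_mul_of_nonneg_left (inv_midpoint_le hx hy) ha
  have h2 := mul_le_mul_of_nonneg_left (inv_midpoint_le (sub_pos.2 hx1) (sub_pos.2 hy1)) hb
  have h3 : (1 - x + (1 - y)) / 2 = 1 - (x + y) / 2 := by ring
  rw [h3] at h2
  simp only [div_eq_mul_one_div a, div_eq_mul_one_div b]
  rcases hab with h | h
  · have := mul_lt_mul_of_pos_left (inv_midpoint_lt hx hy hxy) h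
    linarith
  · have h4 := mul_lt_mul_of_pos_left (inv_midpoint_lt (sub_pos.2 hx1) (sub_pos.2 hy1)
      (fun h => hxy (by linarith))) h
    rw [h3] at h4
    linarith

/-- Turns the unrelaxed welfare constraint into a half-line for `e j`, with endpoint `1/2`, chosen
by the sign of the effect. -/
lemma log_odds_nonneg_iff {x : ℝ} (hx : 0 < x) (hx1 : x < 1) :
    0 ≤ Real.log (x / (1 - x)) ↔ 1 / 2 ≤ x := by
  have h1 : 0 < 1 - x := by linarith
  rw [Real.log_nonneg_iff (by positivity), le_div_iff₀ h1]
  constructor <;> intro h <;> linarith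

lemma log_odds_nonpos_iff {x : ℝ} (hx : 0 < x) (hx1 : x < 1) :
    Real.log (x / (1 - x)) ≤ 0 ↔ x ≤ 1 / 2 := by
  have h1 : 0 < 1 - x := by linarith
  rw [Real.log_nonpos_iff (by positivity), div_le_iff₀ h1]
  constructor <;> intro h <;> linarith

/-- The log odds increase in `x`, and their values at the two ends of the feasible interval are
opposite. This bounds the welfare violation that an estimated effect can cause. -/
lemma abs_log_odds_le {c x : ℝ} (hc : 0 < c) (hx : c ≤ x) (hx1 : x ≤ 1 - c) :
    |Real.log (x / (1 - x))| ≤ Real.log ((1 - c) / c) := by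
  have h0 : 0 < x := hc.trans_le hx
  have h1 : 0 < 1 - x := by linarith
  have h2 : 0 < 1 - c := by linarith
  rw [abs_le, ← Real.log_inv, inv_div]
  constructor
  · apply Real.log_le_log (by positivity)
    rw [div_le_div_iff₀ h2 h1]
    nlinarith
  · apply Real.log_le_log (by positivity)
    rw [div_le_div_iff₀ h1 hc]
    nlinarith

/-- With zero relaxation only the signs of the log odds matter: a positive effect forces `e j ≥
1/2`, a negative one `e j ≤ 1/2`, a zero effect nothing. Each condition is preserved by midpoints.
-/
lemma mem_feasible_zero_midpoint {c₁ c₂ : ℝ} (hc₂ : 0 < c₂) {τ e e' : Fin m → ℝ}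
    (he : e ∈ feasible c₁ c₂ 0 τ) (he' : e' ∈ feasible c₁ c₂ 0 τ) :
    (fun j => (e j + e' j) / 2) ∈ feasible c₁ c₂ 0 τ := by
  obtain ⟨h1, h2, h3⟩ := he
  obtain ⟨h1', h2', h3'⟩ := he'
  refine ⟨fun j l hjl => ?_, fun j => ?_, fun j => ?_⟩
  · have := h1 j l hjl; have := h1' j l hjl
    constructor <;> linarith
  · have hb := h3 j
    have hb' := h3' j
    have ha := h2 j
    have ha' := h2' j
    rw [neg_zero] at *
    rcases lt_trichotomy (τ j) 0 with ht | ht | ht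
    · have h4 := (log_odds_nonpos_iff (by linarith) (by linarith)).1
        (nonpos_of_mul_nonneg_left ha ht)
      have h5 := (log_odds_nonpos_iff (by linarith) (by linarith)).1
        (nonpos_of_mul_nonneg_left ha' ht)
      exact mul_nonneg_of_nonpos_of_nonpos
        ((log_odds_nonpos_iff (by linarith) (by linarith)).2 (by linarith)) ht.le
    · simp [ht]
    · have h4 := (log_odds_nonneg_iff (by linarith) (by linarith)).1
        (nonneg_of_mul_nonneg_left ha ht)
      have h5 := (log_odds_nonneg_iff (by linarith) (by linarith)).1
        (nonneg_of_mul_nonneg_left ha' ht)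
      exact mul_nonneg
        ((log_odds_nonneg_iff (by linarith) (by linarith)).2 (by linarith)) ht.le
  · have := h3 j; have := h3' j
    constructor <;> linarith

/-- Solutions of the design problem agree in all groups with a positive variance. -/
lemma IsOptimal.eq_of_pos {c₁ c₂ : ℝ} (hc₂ : 0 < c₂) {p : Fin m → ℝ} {v : Fin m → Bool → ℝ}
    {τ e e' : Fin m → ℝ} (hp : ∀ j, 0 < p j) (hv : ∀ j d, 0 ≤ v j d)
    (he : IsOptimal c₁ c₂ 0 p v τ e) (he' : IsOptimal c₁ c₂ 0 p v τ e') {j : Fin m}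
    (hj : ∃ d, 0 < v j d) : e j = e' j := by
  by_contra hne
  have hb : ∀ l, 0 < e l ∧ e l < 1 := fun l =>
    ⟨hc₂.trans_le (he.1.2.2 l).1, by linarith [(he.1.2.2 l).2]⟩
  have hb' : ∀ l, 0 < e' l ∧ e' l < 1 := fun l =>
    ⟨hc₂.trans_le (he'.1.2.2 l).1, by linarith [(he'.1.2.2 l).2]⟩
  have hj' : 0 < v j true ∨ 0 < v j false := by
    obtain ⟨d, hd⟩ := hj
    cases d
    · exact Or.inr hd
    · exact Or.inl hd
  have h1 := he.2 _ (mem_feasible_zero_midpoint hc₂ he.1 he'.1)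
  have h2 := he'.2 _ (mem_feasible_zero_midpoint hc₂ he.1 he'.1)
  -- The midpoint of two solutions is feasible and would be strictly cheaper than their common
  -- optimal value.
  have h3 : objective p v (fun j => (e j + e' j) / 2) <
      (objective p v e + objective p v e') / 2 := by
    simp only [objective, ← Finset.sum_add_distrib, Finset.sum_div]
    refine Finset.sum_lt_sum (fun l _ => ?_) ⟨j, Finset.mem_univ j, ?_⟩
    · have := mul_le_mul_of_nonneg_left (cost_midpoint_le (hv l true) (hv l false) (hb l).1
        (hb' l).1 (hb l).2 (hb' l).2) (hp l).le
      linarith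
    · have := mul_lt_mul_of_pos_left (cost_midpoint_lt (hv j true) (hv j false) hj' (hb j).1
        (hb' j).1 (hb j).2 (hb' j).2 hne) (hp j)
      linarith
  linarith

lemma tendsto_objective {p : ℕ → Fin m → ℝ} {v : ℕ → Fin m → Bool → ℝ} {e : ℕ → Fin m → ℝ}
    {p' : Fin m → ℝ} {v' : Fin m → Bool → ℝ} {e' : Fin m → ℝ}
    (hp : ∀ j, Tendsto (fun l => p l j) atTop (𝓝 (p' j)))
    (hv : ∀ j d, Tendsto (fun l => v l j d) atTop (𝓝 (v' j d)))
    (he : ∀ j, Tendsto (fun l => e l j) atTop (𝓝 (e' j))) (h0 : ∀ j, e' j ≠ 0)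
    (h1 : ∀ j, e' j ≠ 1) :
    Tendsto (fun l => objective (p l) (v l) (e l)) atTop (𝓝 (objective p' v' e')) := by
  refine tendsto_finsetSum _ fun j _ => (hp j).mul (((hv j true).div (he j) (h0 j)).add
    ((hv j false).div ((he j).const_sub 1) (sub_ne_zero.2 (h1 j).symm)))

/-- Solutions of perturbed design problems converge, in all groups with a positive variance, to
the solution of the limit problem. -/
theorem tendsto_of_isOptimal {c₁ c₂ : ℝ} (hc₂ : 0 < c₂) {p : ℕ → Fin m → ℝ}
    {v : ℕ → Fin m → Bool → ℝ} {τ e : ℕ → Fin m → ℝ} {r : ℕ → ℝ}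
    {p' : Fin m → ℝ} {v' : Fin m → Bool → ℝ} {τ' e' : Fin m → ℝ}
    (hp : ∀ j, Tendsto (fun l => p l j) atTop (𝓝 (p' j)))
    (hv : ∀ j d, Tendsto (fun l => v l j d) atTop (𝓝 (v' j d)))
    (hτ : ∀ j, Tendsto (fun l => τ l j) atTop (𝓝 (τ' j)))
    (hr0 : ∀ l, 0 ≤ r l) (hr : Tendsto r atTop (𝓝 0))
    (hτ0 : ∀ j, τ' j = 0 → ∀ᶠ l in atTop, Real.log ((1 - c₂) / c₂) * |τ l j| ≤ r l)
    (hp' : ∀ j, 0 < p' j) (hv' : ∀ j d, 0 ≤ v' j d)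
    (he : ∀ l, IsOptimal c₁ c₂ (r l) (p l) (v l) (τ l) (e l))
    (he' : IsOptimal c₁ c₂ 0 p' v' τ' e') {j : Fin m} (hj : ∃ d, 0 < v' j d) :
    Tendsto (fun l => e l j) atTop (𝓝 (e' j)) := by
  -- Allocations live in a compact cube, so it is enough to identify the limits of convergent
  -- subsequences.
  refine tendsto_of_subseq_tendsto fun ns hns => ?_
  have hcpt : IsCompact (Set.pi Set.univ fun _ : Fin m => Set.Icc c₂ (1 - c₂)) :=
    isCompact_univ_pi fun _ => isCompact_Icc
  obtain ⟨ē, hē, φ, hφ, hlim⟩ := hcpt.tendsto_subseq (x := fun l => e (ns l))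
    (fun l j _ => (he (ns l)).1.2.2 j)
  have hψ : Tendsto (fun l => ns (φ l)) atTop atTop := hns.comp hφ.tendsto_atTop
  have hlim' : ∀ j, Tendsto (fun l => e (ns (φ l)) j) atTop (𝓝 (ē j)) := fun j =>
    (tendsto_pi_nhds.1 hlim) j
  have hēI : ∀ j, c₂ ≤ ē j ∧ ē j ≤ 1 - c₂ := fun j => hē j (Set.mem_univ j)
  have hē0 : ∀ j, ē j ≠ 0 := fun j => (hc₂.trans_le (hēI j).1).ne'
  have hē1 : ∀ j, ē j ≠ 1 := fun j h => by linarith [(hēI j).2]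
  have he'I : ∀ j, c₂ ≤ e' j ∧ e' j ≤ 1 - c₂ := he'.1.2.2
  have he'0 : ∀ j, e' j ≠ 0 := fun j => (hc₂.trans_le (he'I j).1).ne'
  have he'1 : ∀ j, e' j ≠ 1 := fun j h => by linarith [(he'I j).2]
  have hfeas : ē ∈ feasible c₁ c₂ 0 τ' := by
    refine ⟨fun i l hil => ⟨?_, ?_⟩, fun i => ?_, hēI⟩
    · exact ge_of_tendsto' ((hlim' i).sub (hlim' l)) fun k => ((he _).1.1 i l hil).1
    · exact le_of_tendsto' ((hlim' i).sub (hlim' l)) fun k => ((he _).1.1 i l hil).2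
    · refine le_of_tendsto_of_tendsto' (hr.comp hψ).neg (Tendsto.mul ?_ ((hτ i).comp hψ))
        fun k => (he (ns (φ k))).1.2.1 i
      refine Tendsto.log ((hlim' i).div ((hlim' i).const_sub 1) (sub_ne_zero.2 (hē1 i).symm)) ?_
      exact div_ne_zero (hē0 i) (sub_ne_zero.2 (hē1 i).symm)
  -- The oracle allocation must be an admissible competitor in the perturbed problems. A nonzero
  -- limit effect fixes the sign of the nearby effects.
  have hev : ∀ᶠ l in atTop, e' ∈ feasible c₁ c₂ (r l) (τ l) := by
    have h1 : ∀ j, ∀ᶠ l in atTop, -r l ≤ Real.log (e' j / (1 - e' j)) * τ l j := by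
      intro i
      have h2 := he'.1.2.1 i
      rw [neg_zero] at h2
      rcases lt_trichotomy (τ' i) 0 with ht | ht | ht
      · filter_upwards [(hτ i).eventually_lt_const ht] with l hl
        have h3 := mul_nonneg_of_nonpos_of_nonpos (nonpos_of_mul_nonneg_left h2 ht) hl.le
        linarith [hr0 l]
      -- At a zero limit effect the perturbed effect may have either sign; the relaxation covers the
      -- violation.
      · filter_upwards [hτ0 i ht] with l hl
        have h3 := abs_log_odds_le hc₂ (he'I i).1 (he'I i).2
        have h4 := mul_le_mul_of_nonneg_right h3 (abs_nonneg (τ l i))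
        rw [← abs_mul] at h4
        linarith [neg_abs_le (Real.log (e' i / (1 - e' i)) * τ l i)]
      · filter_upwards [(hτ i).eventually_const_lt ht] with l hl
        have h3 := mul_nonneg (nonneg_of_mul_nonneg_left h2 ht) hl.le
        linarith [hr0 l]
    filter_upwards [eventually_all.2 h1] with l hl
    exact ⟨he'.1.1, hl, he'I⟩
  have hle : objective p' v' ē ≤ objective p' v' e' := by
    refine le_of_tendsto_of_tendsto
      (tendsto_objective (fun j => (hp j).comp hψ) (fun j d => (hv j d).comp hψ) hlim' hē0 hē1)
      (tendsto_objective (fun j => (hp j).comp hψ) (fun j d => (hv j d).comp hψ)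
        (fun j => tendsto_const_nhds) he'0 he'1) ?_
    filter_upwards [hψ.eventually hev] with l hl
    exact (he _).2 e' hl
  have hopt : IsOptimal c₁ c₂ 0 p' v' τ' ē := ⟨hfeas, fun f hf => hle.trans (he'.2 f hf)⟩
  refine ⟨φ, ?_⟩
  -- The limit `ē` is optimal as well, hence agrees with `e'` in group `j`, though possibly not in
  -- groups without variance.
  rw [he'.eq_of_pos hc₂ hp' hv' hopt hj]
  exact hlim' j

end DesignStability
end FairExperiment

namespace FairExperiment

/-! ### The experiment as a sequential trial -/

namespace Experiment

variable {Ω 𝒳 : Type*} {m : ℕ} (E : Experiment Ω 𝒳 m)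

/-- The stage of the participant with running number `l`. -/
noncomputable def stageOf (l : ℕ) : ℕ := sInf {t | l < E.size (t + 1)}

/-- The position within its stage of the participant with running number `l`. -/
noncomputable def posOf (l : ℕ) : ℕ := l - E.size (E.stageOf l)

lemma size_succ (t : ℕ) : E.size (t + 1) = E.size t + E.n t := Finset.sum_range_succ _ _

lemma size_mono : Monotone E.size :=
  monotone_nat_of_le_succ fun t => by rw [size_succ]; exact Nat.le_add_right _ _

lemma stageOf_size_add {t i : ℕ} (hi : i < E.n t) : E.stageOf (E.size t + i) = t := by
  refine IsLeast.csInf_eq ⟨?_, fun s hs => ?_⟩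
  · simp only [Set.mem_ofPred_eq, size_succ]; omega
  · by_contra hlt
    have := E.size_mono (show s + 1 ≤ t by omega)
    simp only [Set.mem_ofPred_eq] at hs
    omega

lemma posOf_size_add {t i : ℕ} (hi : i < E.n t) : E.posOf (E.size t + i) = i := by
  rw [posOf, stageOf_size_add E hi, Nat.add_sub_cancel_left]

lemma exists_eq_size_add {l t : ℕ} (hl : l < E.size t) :
    ∃ s < t, ∃ i < E.n s, l = E.size s + i := by
  induction t with
  | zero => simp [size] at hl
  | succ t ih =>
    by_cases h : l < E.size t
    · obtain ⟨s, hs, i, hi, rfl⟩ := ih h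
      exact ⟨s, hs.trans (Nat.lt_succ_self t), i, hi, rfl⟩
    · rw [size_succ] at hl
      exact ⟨t, Nat.lt_succ_self t, l - E.size t, by omega, by omega⟩

lemma size_add_lt {s t i : ℕ} (hs : s < t) (hi : i < E.n s) : E.size s + i < E.size t := by
  have h1 := E.size_mono (Nat.succ_le_of_lt hs)
  rw [Nat.succ_eq_add_one, size_succ] at h1
  omega

lemma sum_flatten (F : ℕ → ℕ → ℝ) (t : ℕ) :
    ∑ s ∈ Finset.range t, ∑ i ∈ Finset.range (E.n s), F s i =
      ∑ l ∈ Finset.range (E.size t), F (E.stageOf l) (E.posOf l) := by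
  induction t with
  | zero => simp [size]
  | succ t ih =>
    rw [Finset.sum_range_succ, ih, size_succ, Finset.sum_range_add]
    congr 1
    refine Finset.sum_congr rfl fun i hi => ?_
    rw [E.stageOf_size_add (Finset.mem_range.1 hi), E.posOf_size_add (Finset.mem_range.1 hi)]

variable [MeasurableSpace 𝒳]

/-- An observed outcome is a function of the potential outcomes and the arm. The offset `i` reflects
that the probabilities of a stage are fixed before its first participant and remain known to the
later ones. -/
lemma history_le_past (t i : ℕ) :
    E.history t ≤ past (fun l => E.unit (E.stageOf l) (E.posOf l))
      (fun l => E.D (E.stageOf l) (E.posOf l)) (E.size t + i) := by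
  refine iSup₂_le fun s hs => iSup₂_le fun l hl => ?_
  rw [← measurable_iff_comap_le]
  have h1 := measurable_past (W := fun l => E.unit (E.stageOf l) (E.posOf l))
      (D := fun l => E.D (E.stageOf l) (E.posOf l))
      ((E.size_add_lt hs hl).trans_le (Nat.le_add_right (E.size t) i))
  simp only [E.stageOf_size_add hl, E.posOf_size_add hl] at h1
  have h3 : Measurable (fun q : (𝒳 × (Bool → ℝ)) × Bool => q.1.2 q.2) :=
    measurable_from_prod_countable_left
      (f := fun q : (𝒳 × (Bool → ℝ)) × Bool => q.1.2 q.2) fun d =>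
        (measurable_pi_apply d).comp measurable_snd
  have h2 : Measurable (fun q : (𝒳 × (Bool → ℝ)) × Bool => (q.1.1, q.2, q.1.2 q.2)) :=
    (measurable_fst.comp measurable_fst).prodMk (measurable_snd.prodMk h3)
  exact h2.comp h1

lemma measurable_unit_preAssignment {t i s l : ℕ} (hs : s < E.T) (hl : l < E.n s) :
    Measurable[E.preAssignment t i] (E.unit s l) := by
  rw [measurable_iff_comap_le]
  refine le_sup_of_le_left ?_
  exact le_iSup₂_of_le (f := fun (s : ℕ) (_ : s < E.T) => ⨆ (l : ℕ) (_ : l < E.n s),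
    MeasurableSpace.comap (E.unit s l) inferInstance) s hs
    (le_iSup₂_of_le (f := fun (l : ℕ) (_ : l < E.n s) =>
      MeasurableSpace.comap (E.unit s l) inferInstance) l hl le_rfl)

lemma measurable_D_preAssignment {t i s l : ℕ} (hs : s < E.T) (hl : l < E.n s)
    (h : s < t ∨ (s = t ∧ l < i)) : Measurable[E.preAssignment t i] (E.D s l) := by
  rw [measurable_iff_comap_le]
  refine le_sup_of_le_right ?_
  exact le_iSup₂_of_le (f := fun (s : ℕ) (_ : s < E.T) => ⨆ (l : ℕ) (_ : l < E.n s)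
    (_ : s < t ∨ (s = t ∧ l < i)), MeasurableSpace.comap (E.D s l) inferInstance) s hs
    (le_iSup₂_of_le (f := fun (l : ℕ) (_ : l < E.n s) => ⨆ (_ : s < t ∨ (s = t ∧ l < i)),
      MeasurableSpace.comap (E.D s l) inferInstance) l hl
      (le_iSup_of_le h le_rfl))

/-- The groups, as sets of covariates and potential outcomes. -/
abbrev groups (S : Fin m → Set 𝒳) (j : Fin m) : Set (𝒳 × (Bool → ℝ)) := Prod.fst ⁻¹' S j

lemma isMeasurablePartition_groups {S : Fin m → Set 𝒳} (hS_meas : ∀ j, MeasurableSet (S j))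
    (hS_disj : Pairwise (Function.onFun Disjoint S)) (hS_univ : ⋃ j, S j = Set.univ) :
    IsMeasurablePartition (groups S) where
  measurableSet j := measurable_fst (hS_meas j)
  disjoint i j hij := (hS_disj hij).preimage _
  iUnion_eq := by rw [← Set.preimage_iUnion, hS_univ, Set.preimage_univ]

namespace IsFairAdaptive

variable {E} [mΩ : MeasurableSpace Ω] {μ : Measure Ω} [IsProbabilityMeasure μ]
  {ν : Measure (𝒳 × (Bool → ℝ))} {S : Fin m → Set 𝒳} {c₁ c₂ : ℝ} {δ : ℕ → ℝ}

lemma measurable_unit (h : E.IsFairAdaptive S μ ν c₁ c₂ δ) {t i : ℕ} (ht : t < E.T)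
    (hi : i < E.n t) : Measurable (E.unit t i) :=
  (h.measurable_X t ht i hi).prodMk (measurable_pi_lambda _ fun d => h.measurable_Y t ht i hi d)

lemma preAssignment_le (h : E.IsFairAdaptive S μ ν c₁ c₂ δ) (t i : ℕ) :
    E.preAssignment t i ≤ mΩ := by
  refine sup_le ?_ ?_
  · exact iSup₂_le fun s hs => iSup₂_le fun l hl =>
      measurable_iff_comap_le.1 (h.measurable_unit hs hl)
  · exact iSup₂_le fun s hs => iSup₂_le fun l hl => iSup_le fun _ =>
      measurable_iff_comap_le.1 (h.measurable_D s hs l hl)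

lemma e_mem_Icc (h : E.IsFairAdaptive S μ ν c₁ c₂ δ) (hc₂ : c₂ ∈ Set.Ioo (0 : ℝ) (1 / 2)) {t : ℕ}
    (ht : t < E.T) : ∀ᵐ ω ∂μ, ∀ j, E.e t j ω ∈ Set.Icc c₂ (1 - c₂) := by
  rcases Nat.eq_zero_or_pos t with rfl | h0
  · refine ae_of_all _ fun ω j => ?_
    rw [h.e_zero]
    constructor <;> linarith [hc₂.2]
  · filter_upwards [h.e_optimal t h0 ht] with ω hω j
    exact hω.1.2.2 j

/-- The participants, enumerated in the order of their enrolment, form a sequential trial. -/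
lemma isSequentialTrial (h : E.IsFairAdaptive S μ ν c₁ c₂ δ)
    (hS : IsMeasurablePartition (groups S)) (hc₂ : c₂ ∈ Set.Ioo (0 : ℝ) (1 / 2)) :
    IsSequentialTrial μ ν (groups S) c₂ E.N (fun l => E.unit (E.stageOf l) (E.posOf l))
      (fun l => E.D (E.stageOf l) (E.posOf l)) (fun l j => E.e (E.stageOf l) j) := by
  have key : ∀ l < E.N, E.stageOf l < E.T ∧ E.posOf l < E.n (E.stageOf l) ∧
      l = E.size (E.stageOf l) + E.posOf l := by
    intro l hl
    obtain ⟨s, hs, i, hi, rfl⟩ := E.exists_eq_size_add hl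
    rw [E.posOf_size_add hi, E.stageOf_size_add hi]
    exact ⟨hs, hi, rfl⟩
  refine
  { partition := hS
    measurable_W := fun l hl => h.measurable_unit (key l hl).1 (key l hl).2.1
    measurable_D := fun l hl => h.measurable_D _ (key l hl).1 _ (key l hl).2.1
    indep := ?_
    law := fun l hl => (h.law _ (key l hl).1 _ (key l hl).2.1).map_eq
    measurable_π := fun l hl j => ?_
    mem_Icc := fun l hl => h.e_mem_Icc hc₂ (key l hl).1
    pos := hc₂.1
    randomized := fun l hl => ?_ }
  · refine h.indep.precomp (g := fun l : Fin E.N =>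
      ⟨(E.stageOf l, E.posOf l), (key l l.2).1, (key l l.2).2.1⟩) fun a b hab => ?_
    simp only [Subtype.mk.injEq, Prod.mk.injEq] at hab
    have h1 := (key a a.2).2.2
    rw [hab.1, hab.2, ← (key b b.2).2.2] at h1
    exact Fin.ext h1
  · have h1 := E.history_le_past (E.stageOf l) (E.posOf l)
    rw [← (key l hl).2.2] at h1
    exact (h.measurable_e _ (key l hl).1 j).mono h1 le_rfl
  · refine ⟨E.preAssignment (E.stageOf l) (E.posOf l), h.preAssignment_le _ _, fun k hk =>
      E.measurable_unit_preAssignment (key k hk).1 (key k hk).2.1, fun k hk => ?_,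
      h.randomized _ (key l hl).1 _ (key l hl).2.1⟩
    have hkN := hk.trans hl
    refine E.measurable_D_preAssignment (key k hkN).1 (key k hkN).2.1 ?_
    -- A smaller running number means an earlier pair in the lexicographic order, so the negation
    -- contradicts `k < l`.
    by_contra hcon
    rw [not_or, not_and_or, not_lt, not_lt] at hcon
    have h1 := (key k hkN).2.2
    have h2 := (key l hl).2.2
    rcases eq_or_lt_of_le hcon.1 with h3 | h3
    · rw [← h3] at h1
      rcases hcon.2 with h4 | h4
      · exact h4 h3.symm
      · omega
    · have := E.size_add_lt h3 (key l hl).2.1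
      omega

end IsFairAdaptive
end Experiment
end FairExperiment

namespace FairExperiment

/-! ### Sums over the participants -/

namespace Experiment

section Totals

variable {Ω 𝒳 : Type*} {m : ℕ} (E : Experiment Ω 𝒳 m)

/-- The sum of a function of covariates, outcomes and arms over the first `t` stages. -/
def total (f : 𝒳 × (Bool → ℝ) → Bool → ℝ) (t : ℕ) (ω : Ω) : ℝ :=
  ∑ s ∈ Finset.range t, ∑ i ∈ Finset.range (E.n s), f (E.unit s i ω) (E.D s i ω)

/-- The average probability of arm `d` in group `j` over the first `t` stages. -/
noncomputable def armShare (j : Fin m) (d : Bool) (t : ℕ) (ω : Ω) : ℝ :=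
  (∑ s ∈ Finset.range t, (E.n s : ℝ) * armProb d (E.e s j ω)) / E.size t

/-- The function `φ` of the outcome of participants of group `j` in arm `d`. -/
noncomputable def groupArm (S : Fin m → Set 𝒳) (j : Fin m) (d : Bool) (φ : ℝ → ℝ) (w : 𝒳 × (Bool → ℝ))
    (b : Bool) : ℝ :=
  (S j).indicator (fun _ => 1) w.1 * (if b = d then 1 else 0) * φ (w.2 d)

lemma armShare_true_add_false (j : Fin m) {t : ℕ} (ht : 0 < E.size t) (ω : Ω) :
    E.armShare j true t ω + E.armShare j false t ω = 1 := by
  have h1 : (E.size t : ℝ) ≠ 0 := by positivity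
  rw [armShare, armShare, ← add_div, ← Finset.sum_add_distrib, div_eq_one_iff_eq h1, size,
    Nat.cast_sum]
  exact Finset.sum_congr rfl fun s _ => by simp [armProb]; ring

lemma armShare_mem_Icc {c₂ : ℝ} {j : Fin m} {t : ℕ} (ht : 0 < E.size t) {ω : Ω}
    (h : ∀ s < t, E.e s j ω ∈ Set.Icc c₂ (1 - c₂)) (d : Bool) :
    E.armShare j d t ω ∈ Set.Icc c₂ (1 - c₂) := by
  have h1 : (0 : ℝ) < E.size t := by positivity
  have h2 : ∀ s < t, armProb d (E.e s j ω) ∈ Set.Icc c₂ (1 - c₂) := fun s hs => by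
    have := h s hs
    cases d
    · constructor <;> simp [armProb] <;> linarith [this.1, this.2]
    · simpa [armProb] using this
  rw [armShare, Set.mem_Icc, le_div_iff₀ h1, div_le_iff₀ h1, size, Nat.cast_sum, Finset.mul_sum,
    Finset.mul_sum]
  refine ⟨Finset.sum_le_sum fun s hs => ?_, Finset.sum_le_sum fun s hs => ?_⟩
  · rw [mul_comm]
    exact mul_le_mul_of_nonneg_left (h2 s (Finset.mem_range.1 hs)).1 (Nat.cast_nonneg _)
  · rw [mul_comm (1 - c₂)]
    exact mul_le_mul_of_nonneg_left (h2 s (Finset.mem_range.1 hs)).2 (Nat.cast_nonneg _)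

variable (S : Fin m → Set 𝒳)

lemma armCount_eq_total (j : Fin m) (d : Bool) (t : ℕ) (ω : Ω) :
    E.armCount S j d t ω = E.total (groupArm S j d fun _ => 1) t ω := by
  simp only [armCount, total, groupArm, mul_one]
  rfl

lemma groupCount_eq (j : Fin m) (t : ℕ) (ω : Ω) :
    E.groupCount S j t ω = E.armCount S j true t ω + E.armCount S j false t ω := by
  simp only [armCount, groupCount, ← Finset.sum_add_distrib]
  refine Finset.sum_congr rfl fun s _ => Finset.sum_congr rfl fun i _ => ?_
  cases h : E.D s i ω <;> simp [inArm, h]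

lemma armCount_nonneg (j : Fin m) (d : Bool) (t : ℕ) (ω : Ω) : 0 ≤ E.armCount S j d t ω := by
  refine Finset.sum_nonneg fun s _ => Finset.sum_nonneg fun i _ => mul_nonneg ?_ ?_
  · exact Set.indicator_nonneg (fun _ _ => zero_le_one) _
  · unfold inArm; split_ifs <;> simp

lemma sum_groupCount [MeasurableSpace 𝒳] (hS : IsMeasurablePartition (groups S)) (t : ℕ) (ω : Ω) :
    ∑ j, E.groupCount S j t ω = E.size t := by
  simp only [groupCount]
  rw [Finset.sum_comm, size, Nat.cast_sum]
  refine Finset.sum_congr rfl fun s _ => ?_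
  rw [Finset.sum_comm]
  have : ∀ i, ∑ j, E.inGroup S j s i ω = 1 := fun i => by
    obtain ⟨j, hj⟩ := hS.exists_mem (E.unit s i ω)
    have h1 := hS.sum_indicator hj (fun _ => 1)
    simp only [mul_one] at h1
    exact h1
  simp [this]

lemma groupArm_sub_eq (j : Fin m) (d : Bool) (a : ℝ) (s i : ℕ) (ω : Ω) :
    groupArm S j d (fun y => y - a) (E.unit s i ω) (E.D s i ω) =
      E.inGroup S j s i ω * E.inArm d s i ω * E.obs s i ω -
        a * (E.inGroup S j s i ω * E.inArm d s i ω) := by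
  simp only [groupArm, inGroup, inArm, obs, unit]
  split_ifs with h
  · rw [h]; ring
  · ring

lemma groupArm_sub_sq_eq (j : Fin m) (d : Bool) (a b : ℝ) (s i : ℕ) (ω : Ω) :
    E.inGroup S j s i ω * E.inArm d s i ω * (E.obs s i ω - b) ^ 2 =
      groupArm S j d (fun y => (y - a) ^ 2) (E.unit s i ω) (E.D s i ω) -
        2 * (b - a) * groupArm S j d (fun y => y - a) (E.unit s i ω) (E.D s i ω) +
        (b - a) ^ 2 * groupArm S j d (fun _ => 1) (E.unit s i ω) (E.D s i ω) := by
  simp only [groupArm, inGroup, inArm, obs, unit]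
  split_ifs with h
  · rw [h]; ring
  · ring

lemma armMean_sub {j : Fin m} {d : Bool} {t : ℕ} {ω : Ω} (h : E.armCount S j d t ω ≠ 0) (a : ℝ) :
    E.armMean S t j d ω - a =
      E.total (groupArm S j d fun y => y - a) t ω / E.armCount S j d t ω := by
  rw [armMean, eq_div_iff h, sub_mul, div_mul_cancel₀ _ h, total, armCount, Finset.mul_sum]
  simp_rw [groupArm_sub_eq, Finset.mul_sum, ← Finset.sum_sub_distrib]

/-- Centering at a constant `a` instead of the random arm mean leaves only sums of fixed functions,
to which the law of large numbers applies. -/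
lemma varHat_eq {j : Fin m} {d : Bool} {t : ℕ} {ω : Ω} (h : E.armCount S j d t ω ≠ 0) (a : ℝ) :
    E.varHat S t j d ω =
      E.total (groupArm S j d fun y => (y - a) ^ 2) t ω / E.armCount S j d t ω -
        (E.total (groupArm S j d fun y => y - a) t ω / E.armCount S j d t ω) ^ 2 := by
  have h1 : ∑ s ∈ Finset.range t, ∑ i ∈ Finset.range (E.n s),
      E.inGroup S j s i ω * E.inArm d s i ω * (E.obs s i ω - E.armMean S t j d ω) ^ 2 =
      E.total (groupArm S j d fun y => (y - a) ^ 2) t ω -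
        2 * (E.armMean S t j d ω - a) * E.total (groupArm S j d fun y => y - a) t ω +
        (E.armMean S t j d ω - a) ^ 2 * E.armCount S j d t ω := by
    rw [armCount_eq_total]
    simp only [total, Finset.mul_sum, ← Finset.sum_sub_distrib, ← Finset.sum_add_distrib]
    exact Finset.sum_congr rfl fun s _ => Finset.sum_congr rfl fun i _ =>
      E.groupArm_sub_sq_eq S j d a _ s i ω
  rw [varHat, h1, E.armMean_sub S h a]
  field_simp
  ring

end Totals

/-! ### Group moments in the population and conditional means of group-arm sums. -/

section Population

variable {𝒳 : Type*} [MeasurableSpace 𝒳] {m : ℕ} {S : Fin m → Set 𝒳}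
  {ν : Measure (𝒳 × (Bool → ℝ))} [IsProbabilityMeasure ν]

/-- The mean of the potential outcome `d` in group `j`. -/
noncomputable def groupMean (ν : Measure (𝒳 × (Bool → ℝ))) (S : Fin m → Set 𝒳) (j : Fin m)
    (d : Bool) : ℝ := ∫ w, w.2 d ∂(ProbabilityTheory.cond ν (groups S j))

lemma setIntegral_group_eq {j : Fin m} (hp : 0 < groupProp ν S j)
    (f : 𝒳 × (Bool → ℝ) → ℝ) : ∫ w in groups S j, f w ∂ν =
      groupProp ν S j * ∫ w, f w ∂(ProbabilityTheory.cond ν (groups S j)) := by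
  rw [ProbabilityTheory.cond, integral_smul_measure, ENNReal.toReal_inv, smul_eq_mul,
    ← mul_assoc]
  change _ = groupProp ν S j * (groupProp ν S j)⁻¹ * _
  rw [mul_inv_cancel₀ hp.ne', one_mul]

lemma memLp_cond {f : 𝒳 × (Bool → ℝ) → ℝ} {q : ENNReal} (hf : MemLp f q ν) {j : Fin m}
    (hp : 0 < groupProp ν S j) : MemLp f q (ProbabilityTheory.cond ν (groups S j)) := by
  refine (hf.restrict _).smul_measure ?_
  rw [ENNReal.inv_ne_top]
  intro h
  rw [groupProp, measureReal_def, h] at hp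
  simp at hp

lemma isProbabilityMeasure_cond {j : Fin m} (hp : 0 < groupProp ν S j) :
    IsProbabilityMeasure (ProbabilityTheory.cond ν (groups S j)) := by
  refine cond_isProbabilityMeasure fun h => ?_
  rw [groupProp, measureReal_def, h] at hp
  simp at hp

variable (hmom : ∀ d, MemLp (fun w : 𝒳 × (Bool → ℝ) => w.2 d) 4 ν)
include hmom

lemma groupEffect_eq {j : Fin m} (hp : 0 < groupProp ν S j) :
    groupEffect ν S j = groupMean ν S j true - groupMean ν S j false := by
  have h1 := isProbabilityMeasure_cond hp
  exact integral_sub ((memLp_cond (hmom true) hp).integrable (by norm_num))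
    ((memLp_cond (hmom false) hp).integrable (by norm_num))

lemma setIntegral_sub_groupMean {j : Fin m} (hp : 0 < groupProp ν S j) (d : Bool) :
    ∫ w in groups S j, (w.2 d - groupMean ν S j d) ∂ν = 0 := by
  have h1 := isProbabilityMeasure_cond hp
  rw [setIntegral_group_eq hp, integral_sub ((memLp_cond (hmom d) hp).integrable (by norm_num))
    (integrable_const _)]
  simp [groupMean]

lemma setIntegral_sub_groupMean_sq {j : Fin m} (hp : 0 < groupProp ν S j) (d : Bool) :
    ∫ w in groups S j, (w.2 d - groupMean ν S j d) ^ 2 ∂ν =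
      groupProp ν S j * groupVar ν S j d := by
  rw [setIntegral_group_eq hp, groupVar,
    variance_eq_integral (memLp_cond (hmom d) hp).aestronglyMeasurable.aemeasurable]
  rfl

lemma ate_eq (hS : IsMeasurablePartition (groups S)) (hp : ∀ j, 0 < groupProp ν S j) :
    ate ν = ∑ j, groupProp ν S j * groupEffect ν S j := by
  have h1 : Integrable (fun w : 𝒳 × (Bool → ℝ) => w.2 true - w.2 false) ν :=
    ((hmom true).integrable (by norm_num)).sub ((hmom false).integrable (by norm_num))
  rw [ate, ← setIntegral_univ, ← hS.iUnion_eq, integral_iUnion_fintype hS.measurableSet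
    hS.disjoint fun j => h1.integrableOn]
  exact Finset.sum_congr rfl fun j _ => setIntegral_group_eq (hp j) _

omit hmom

lemma sum_groupProp (hS : IsMeasurablePartition (groups S)) : ∑ j, groupProp ν S j = 1 := by
  simp only [groupProp]
  rw [← measureReal_iUnion_fintype hS.disjoint hS.measurableSet, hS.iUnion_eq]
  simp

lemma setIntegral_groupArm (hS : IsMeasurablePartition (groups S)) (j l : Fin m) (d b : Bool)
    (φ : ℝ → ℝ) : ∫ w in groups S l, groupArm S j d φ w b ∂ν =
      if l = j ∧ b = d then ∫ w in groups S j, φ (w.2 d) ∂ν else 0 := by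
  by_cases hb : b = d
  · by_cases hl : l = j
    · subst hl
      rw [if_pos ⟨rfl, hb⟩]
      refine setIntegral_congr_fun (hS.measurableSet l) fun w hw => ?_
      have : w.1 ∈ S l := hw
      simp [groupArm, this, hb]
    · rw [if_neg (fun h => hl h.1)]
      refine setIntegral_eq_zero_of_forall_eq_zero fun w hw => ?_
      have : w.1 ∉ S j := fun h => Set.disjoint_left.1 (hS.disjoint hl) hw h
      simp [groupArm, this]
  · rw [if_neg (fun h => hb h.2)]
    simp [groupArm, hb]

/-- Only arm `d` in group `j` contributes. For the centered outcome the integral is zero, so those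
sums are martingales under every adaptive allocation. -/
lemma designMean_groupArm (hS : IsMeasurablePartition (groups S)) (j : Fin m) (d : Bool)
    (φ : ℝ → ℝ) (p : Fin m → ℝ) : designMean ν (groups S) (groupArm S j d φ) p =
      armProb d (p j) * ∫ w in groups S j, φ (w.2 d) ∂ν := by
  simp only [designMean]
  rw [Finset.sum_eq_single d, Finset.sum_eq_single j]
  · rw [setIntegral_groupArm hS]; simp
  · intro l _ hl
    rw [setIntegral_groupArm hS]; simp [hl]
  · simp
  · intro b _ hb
    refine Finset.sum_eq_zero fun l _ => ?_
    rw [setIntegral_groupArm hS]; simp [hb]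
  · simp

lemma measurable_groupArm (hSm : ∀ j, MeasurableSet (S j))
    (j : Fin m) (d : Bool) {φ : ℝ → ℝ} (hφ : Measurable φ) (b : Bool) :
    Measurable (groupArm S j d φ · b) := by
  unfold groupArm
  have h1 : Measurable (fun w : 𝒳 × (Bool → ℝ) => (S j).indicator (fun _ => (1 : ℝ)) w.1) :=
    (measurable_const.indicator (hSm j)).comp measurable_fst
  have h2 : Measurable (fun w : 𝒳 × (Bool → ℝ) => φ (w.2 d)) :=
    hφ.comp ((measurable_pi_apply d).comp measurable_snd)
  exact (h1.mul_const _).mul h2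

lemma memLp_groupArm (hSm : ∀ j, MeasurableSet (S j))
    (j : Fin m) (d : Bool) {φ : ℝ → ℝ} (hφ : Measurable φ) {q : ENNReal}
    (hq : MemLp (fun w : 𝒳 × (Bool → ℝ) => φ (w.2 d)) q ν) (b : Bool) :
    MemLp (groupArm S j d φ · b) q ν := by
  refine hq.of_le (measurable_groupArm hSm j d hφ b).aestronglyMeasurable
    (ae_of_all _ fun w => ?_)
  unfold groupArm
  rw [norm_mul, norm_mul]
  refine mul_le_of_le_one_left (norm_nonneg _) (mul_le_one₀ ?_ (norm_nonneg _) ?_)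
  · by_cases h : w.1 ∈ S j <;> simp [h]
  · split_ifs <;> simp

end Population

end Experiment
end FairExperiment

namespace FairExperiment

/-! ### Consistency of the estimators -/

section InMeasure

variable {Ω : Type*} [mΩ : MeasurableSpace Ω] {μ : Measure Ω} [IsProbabilityMeasure μ]

/-- Chebyshev's inequality. -/
lemma tendstoInMeasure_zero_of_integral_sq {X : ℕ → Ω → ℝ} (hX : ∀ k, MemLp (X k) 2 μ)
    (h : Tendsto (fun k => ∫ ω, X k ω ^ 2 ∂μ) atTop (𝓝 0)) :
    TendstoInMeasure μ X atTop (fun _ => 0) := by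
  rw [tendstoInMeasure_iff_measureReal_norm]
  intro ε hε
  have h1 : Tendsto (fun k => (ε ^ 2)⁻¹ * ∫ ω, X k ω ^ 2 ∂μ) atTop (𝓝 0) := by
    simpa using h.const_mul ((ε ^ 2)⁻¹)
  refine squeeze_zero (fun k => measureReal_nonneg) (fun k => ?_) h1
  have h2 := mul_meas_ge_le_integral_of_nonneg (ae_of_all μ fun ω => sq_nonneg (X k ω))
    (hX k).integrable_sq (ε ^ 2)
  rw [inv_mul_eq_div, le_div_iff₀ (by positivity), mul_comm]
  refine le_trans (mul_le_mul_of_nonneg_left (measureReal_mono fun ω hω => ?_) (by positivity)) h2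
  simp only [sub_zero, Set.mem_ofPred_eq] at hω ⊢
  rw [← sq_abs (X k ω)]
  exact pow_le_pow_left₀ hε.le hω 2

/-- An `L²`-bounded sequence is bounded in probability, so multiplying it by a sequence that tends
to zero in probability preserves that limit. -/
lemma tendstoInMeasure_mul_of_integral_sq_le {X R : ℕ → Ω → ℝ} {C : ℝ}
    (hX : ∀ᶠ k in atTop, MemLp (X k) 2 μ ∧ ∫ ω, X k ω ^ 2 ∂μ ≤ C)
    (hR : TendstoInMeasure μ R atTop (fun _ => 0)) :
    TendstoInMeasure μ (fun k ω => X k ω * R k ω) atTop (fun _ => 0) := by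
  rw [tendstoInMeasure_iff_measureReal_norm] at hR ⊢
  simp only [sub_zero] at hR ⊢
  intro ε hε
  have hC : 0 ≤ C := by
    obtain ⟨k, -, hk⟩ := hX.exists
    exact (integral_nonneg fun ω => sq_nonneg _).trans hk
  rw [Metric.tendsto_nhds]
  intro η hη
  -- The level `K` makes `|X k| ≥ K` improbable by Chebyshev; off that event `R k` has to exceed `ε
  -- / K`.
  obtain ⟨K, hK⟩ : ∃ K : ℝ, 0 < K ∧ C / K ^ 2 < η / 2 := by
    have h1 : Tendsto (fun K : ℝ => C / K ^ 2) atTop (𝓝 0) :=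
      tendsto_const_nhds.div_atTop (tendsto_pow_atTop two_ne_zero)
    exact ((eventually_gt_atTop 0).and (h1.eventually_lt_const (by positivity))).exists
  have h2 := (hR (ε / K) (div_pos hε hK.1)).eventually_lt_const (show 0 < η / 2 by positivity)
  filter_upwards [hX, h2] with k hk h3
  have h4 : μ.real {ω | K ^ 2 ≤ X k ω ^ 2} ≤ C / K ^ 2 := by
    have h5 := mul_meas_ge_le_integral_of_nonneg (ae_of_all μ fun ω => sq_nonneg (X k ω))
      hk.1.integrable_sq (K ^ 2)
    rw [le_div_iff₀ (pow_pos hK.1 2), mul_comm]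
    exact h5.trans hk.2
  have h6 : μ.real {ω | ε ≤ ‖X k ω * R k ω‖} ≤
      μ.real {ω | K ^ 2 ≤ X k ω ^ 2} + μ.real {ω | ε / K ≤ ‖R k ω‖} := by
    refine (measureReal_mono fun ω hω => ?_).trans (measureReal_union_le _ _)
    simp only [Set.mem_ofPred_eq, Set.mem_union] at hω ⊢
    by_contra! hcon
    rw [norm_mul] at hω
    have h7 : ‖X k ω‖ < K := by
      rw [Real.norm_eq_abs]
      exact abs_lt_of_sq_lt_sq hcon.1 hK.1.le
    have h8 : ‖X k ω‖ * ‖R k ω‖ ≤ K * ‖R k ω‖ :=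
      mul_le_mul_of_nonneg_right h7.le (norm_nonneg _)
    have h9 : K * ‖R k ω‖ < K * (ε / K) := mul_lt_mul_of_pos_left hcon.2 hK.1
    rw [mul_div_cancel₀ _ hK.1.ne'] at h9
    linarith
  rw [Real.dist_eq, sub_zero, abs_of_nonneg measureReal_nonneg]
  linarith [hK.2]

/-- Successive extraction of almost surely convergent subsequences; finiteness of the index set
makes a common one possible. -/
lemma exists_strictMono_forall_ae_tendsto {ι : Type*} [Fintype ι] {X : ι → ℕ → Ω → ℝ}
    {Y : ι → Ω → ℝ} (h : ∀ i, TendstoInMeasure μ (X i) atTop (Y i)) :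
    ∃ φ : ℕ → ℕ, StrictMono φ ∧
      ∀ᵐ ω ∂μ, ∀ i, Tendsto (fun k => X i (φ k) ω) atTop (𝓝 (Y i ω)) := by
  classical
  have key : ∀ s : Finset ι, ∃ φ : ℕ → ℕ, StrictMono φ ∧
      ∀ᵐ ω ∂μ, ∀ i ∈ s, Tendsto (fun k => X i (φ k) ω) atTop (𝓝 (Y i ω)) := by
    intro s
    induction s using Finset.induction_on with
    | empty => exact ⟨id, strictMono_id, by simp⟩
    | insert i s his ih =>
      obtain ⟨φ, hφ, hs⟩ := ih
      obtain ⟨ψ, hψ, hi⟩ := ((h i).comp hφ.tendsto_atTop).exists_seq_tendsto_ae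
      refine ⟨φ ∘ ψ, hφ.comp hψ, ?_⟩
      filter_upwards [hs, hi] with ω h1 h2 l hl
      rcases Finset.mem_insert.1 hl with rfl | hl
      · exact h2
      · exact (h1 l hl).comp hψ.tendsto_atTop
  obtain ⟨φ, hφ, hs⟩ := key Finset.univ
  exact ⟨φ, hφ, hs.mono fun ω hω i => hω i (Finset.mem_univ i)⟩

end InMeasure

/-! ### Laws of large numbers along subsequences and their pathwise consequences. -/

namespace Experiment

variable {Ω 𝒳 : Type*} [mΩ : MeasurableSpace Ω] [MeasurableSpace 𝒳] {m : ℕ} {μ : Measure Ω}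
  [IsProbabilityMeasure μ] {ν : Measure (𝒳 × (Bool → ℝ))} [IsProbabilityMeasure ν]
  {S : Fin m → Set 𝒳} {c₁ c₂ : ℝ} {δ : ℕ → ℝ}

lemma IsFairAdaptive.integral_total_sub_sq_le {E : Experiment Ω 𝒳 m}
    (h : E.IsFairAdaptive S μ ν c₁ c₂ δ) (hS : IsMeasurablePartition (groups S))
    (hc₂ : c₂ ∈ Set.Ioo (0 : ℝ) (1 / 2)) {f : 𝒳 × (Bool → ℝ) → Bool → ℝ}
    (hf : ∀ d, Measurable (f · d)) (hf2 : ∀ d, MemLp (f · d) 2 ν) {t : ℕ} (ht : t ≤ E.T) :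
    MemLp (fun ω => E.total f t ω - ∑ s ∈ Finset.range t,
      (E.n s : ℝ) * designMean ν (groups S) f (fun j => E.e s j ω)) 2 μ ∧
    ∫ ω, (E.total f t ω - ∑ s ∈ Finset.range t,
      (E.n s : ℝ) * designMean ν (groups S) f (fun j => E.e s j ω)) ^ 2 ∂μ ≤
      E.size t * IsSequentialTrial.deviationBound ν f := by
  have h1 := (h.isSequentialTrial hS hc₂).integral_sum_deviation_sq_le hf hf2 (E.size_mono ht)
  have h2 : ∀ ω, E.total f t ω - ∑ s ∈ Finset.range t,
      (E.n s : ℝ) * designMean ν (groups S) f (fun j => E.e s j ω) =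
      ∑ l ∈ Finset.range (E.size t), IsSequentialTrial.deviation ν (groups S)
        (fun l => E.unit (E.stageOf l) (E.posOf l)) (fun l => E.D (E.stageOf l) (E.posOf l))
        (fun l j => E.e (E.stageOf l) j) f l ω := by
    intro ω
    have h3 := E.sum_flatten (fun s i => f (E.unit s i ω) (E.D s i ω) -
      designMean ν (groups S) f (fun j => E.e s j ω)) t
    simp only [Finset.sum_sub_distrib, Finset.sum_const, Finset.card_range, nsmul_eq_mul] at h3
    rw [total, h3]
    simp only [IsSequentialTrial.deviation, Finset.sum_sub_distrib]
  simp_rw [h2]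
  exact h1

/-- The normalization `a` is kept free because two are needed: the sample size, for consistency, and
the sample size times `δ`, for the rate that the welfare relaxation requires. -/
lemma tendstoInMeasure_total_sub {E : ℕ → Experiment Ω 𝒳 m}
    (hE : ∀ k, (E k).IsFairAdaptive S μ ν c₁ c₂ δ) (hS : IsMeasurablePartition (groups S))
    (hc₂ : c₂ ∈ Set.Ioo (0 : ℝ) (1 / 2)) {f : 𝒳 × (Bool → ℝ) → Bool → ℝ}
    (hf : ∀ d, Measurable (f · d)) (hf2 : ∀ d, MemLp (f · d) 2 ν) {t : ℕ → ℕ}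
    (ht : ∀ k, t k ≤ (E k).T) {a : ℕ → ℝ}
    (ha : Tendsto (fun k => ((E k).size (t k) : ℝ) / a k ^ 2) atTop (𝓝 0)) :
    TendstoInMeasure μ (fun k ω => ((E k).total f (t k) ω - ∑ s ∈ Finset.range (t k),
      ((E k).n s : ℝ) * designMean ν (groups S) f (fun j => (E k).e s j ω)) / a k) atTop
      (fun _ => 0) := by
  refine tendstoInMeasure_zero_of_integral_sq (fun k => ?_) ?_
  · simp_rw [div_eq_mul_inv]
    exact ((hE k).integral_total_sub_sq_le hS hc₂ hf hf2 (ht k)).1.mul_const _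
  · have h1 := ha.mul_const (IsSequentialTrial.deviationBound ν f)
    rw [zero_mul] at h1
    refine squeeze_zero (fun k => integral_nonneg fun ω => sq_nonneg _) (fun k => ?_) h1
    simp_rw [div_pow]
    rw [integral_div, div_mul_eq_mul_div]
    exact div_le_div_of_nonneg_right
      ((hE k).integral_total_sub_sq_le hS hc₂ hf hf2 (ht k)).2 (sq_nonneg _)

/-- The sums that determine the estimators behave as in the law of large numbers. -/
structure IsRegular (E : ℕ → Experiment Ω 𝒳 m) (t : ℕ → ℕ) (S : Fin m → Set 𝒳)
    (ν : Measure (𝒳 × (Bool → ℝ))) (c₂ : ℝ) (δ : ℕ → ℝ) (ω : Ω) : Prop where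
  size_atTop : Tendsto (fun k => (E k).size (t k)) atTop atTop
  share_mem : ∀ᶠ k in atTop, ∀ j d, (E k).armShare j d (t k) ω ∈ Set.Icc c₂ (1 - c₂)
  count : ∀ j d, Tendsto (fun k => (E k).armCount S j d (t k) ω / (E k).size (t k) -
    groupProp ν S j * (E k).armShare j d (t k) ω) atTop (𝓝 0)
  centered : ∀ j d, Tendsto (fun k => (E k).total
    (groupArm S j d fun y => y - groupMean ν S j d) (t k) ω / (E k).size (t k)) atTop (𝓝 0)
  square : ∀ j d, Tendsto (fun k => (E k).total
    (groupArm S j d fun y => (y - groupMean ν S j d) ^ 2) (t k) ω / (E k).size (t k) -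
    groupProp ν S j * groupVar ν S j d * (E k).armShare j d (t k) ω) atTop (𝓝 0)
  centered_scaled : ∀ j d, Tendsto (fun k => (E k).total
    (groupArm S j d fun y => y - groupMean ν S j d) (t k) ω /
      ((E k).size (t k) * δ ((E k).size (t k)))) atTop (𝓝 0)

lemma IsRegular.comp {E : ℕ → Experiment Ω 𝒳 m} {t : ℕ → ℕ} {ω : Ω}
    (h : IsRegular E t S ν c₂ δ ω) {φ : ℕ → ℕ} (hφ : Tendsto φ atTop atTop) :
    IsRegular (E ∘ φ) (t ∘ φ) S ν c₂ δ ω where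
  size_atTop := h.size_atTop.comp hφ
  share_mem := hφ.eventually h.share_mem
  count j d := (h.count j d).comp hφ
  centered j d := (h.centered j d).comp hφ
  square j d := (h.square j d).comp hφ
  centered_scaled j d := (h.centered_scaled j d).comp hφ

lemma memLp_four_sub (hmom : ∀ d, MemLp (fun w : 𝒳 × (Bool → ℝ) => w.2 d) 4 ν) (d : Bool)
    (a : ℝ) : MemLp (fun w : 𝒳 × (Bool → ℝ) => w.2 d - a) 4 ν := (hmom d).sub (memLp_const a)

lemma memLp_two_sub_sq (hmom : ∀ d, MemLp (fun w : 𝒳 × (Bool → ℝ) => w.2 d) 4 ν) (d : Bool)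
    (a : ℝ) : MemLp (fun w : 𝒳 × (Bool → ℝ) => (w.2 d - a) ^ 2) 2 ν := by
  have h1 := memLp_four_sub hmom d a
  have h3 : AEStronglyMeasurable (fun w : 𝒳 × (Bool → ℝ) => (w.2 d - a) ^ 2) ν :=
    h1.aestronglyMeasurable.pow 2
  rw [memLp_two_iff_integrable_sq h3]
  have h2 := h1.integrable_norm_pow (p := 4) (by norm_num)
  refine h2.congr (ae_of_all _ fun w => ?_)
  change ‖w.2 d - a‖ ^ 4 = ((w.2 d - a) ^ 2) ^ 2
  rw [← pow_mul, Real.norm_eq_abs]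
  exact (Even.pow_abs (by decide) _)

/-- Along a subsequence, the sums behave almost surely as in the law of large numbers. -/
lemma exists_strictMono_isRegular {E : ℕ → Experiment Ω 𝒳 m}
    (hE : ∀ k, (E k).IsFairAdaptive S μ ν c₁ c₂ δ) (hS : IsMeasurablePartition (groups S))
    (hSm : ∀ j, MeasurableSet (S j)) (hc₂ : c₂ ∈ Set.Ioo (0 : ℝ) (1 / 2))
    (hp : ∀ j, 0 < groupProp ν S j)
    (hmom : ∀ d, MemLp (fun w : 𝒳 × (Bool → ℝ) => w.2 d) 4 ν)
    (hδ_rate : Tendsto (fun x : ℕ => √(x : ℝ) * δ x) atTop atTop) {t : ℕ → ℕ}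
    (ht : ∀ k, t k ≤ (E k).T) (hsize : Tendsto (fun k => (E k).size (t k)) atTop atTop) :
    ∃ φ : ℕ → ℕ, StrictMono φ ∧ ∀ᵐ ω ∂μ, IsRegular (E ∘ φ) (t ∘ φ) S ν c₂ δ ω := by
  have hsr : Tendsto (fun k => ((E k).size (t k) : ℝ)) atTop atTop :=
    tendsto_natCast_atTop_atTop.comp hsize
  have ha : Tendsto (fun k => ((E k).size (t k) : ℝ) / ((E k).size (t k) : ℝ) ^ 2) atTop
      (𝓝 0) := by
    refine (tendsto_inv_atTop_zero.comp hsr).congr' ?_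
    filter_upwards [hsr.eventually_gt_atTop 0] with k hk
    simp only [Function.comp_apply]
    field_simp
  -- The ratio equals `1 / (√size · δ)²`, so this is where the rate of `δ` enters.
  have ha' : Tendsto (fun k => ((E k).size (t k) : ℝ) /
      (((E k).size (t k) : ℝ) * δ ((E k).size (t k))) ^ 2) atTop (𝓝 0) := by
    have h1 := hδ_rate.comp hsize
    have h2 : Tendsto (fun x : ℝ => (x ^ 2)⁻¹) atTop (𝓝 0) :=
      tendsto_inv_atTop_zero.comp (tendsto_pow_atTop two_ne_zero)
    refine (h2.comp h1).congr' ?_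
    filter_upwards [hsr.eventually_gt_atTop 0] with k hk
    simp only [Function.comp_apply]
    rw [mul_pow, mul_pow, Real.sq_sqrt hk.le, pow_two ((E k).size (t k) : ℝ), mul_assoc,
      div_mul_cancel_left₀ hk.ne']
  have hmeas : ∀ j d, Measurable fun y : ℝ => y - groupMean ν S j d := fun j d => by fun_prop
  have hmeas2 : ∀ j d, Measurable fun y : ℝ => (y - groupMean ν S j d) ^ 2 := fun j d => by
    fun_prop
  have hX0 := fun (j : Fin m) (d : Bool) => tendstoInMeasure_total_sub hE hS hc₂
    (measurable_groupArm hSm j d (φ := fun _ => 1) measurable_const)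
    (memLp_groupArm hSm j d measurable_const (memLp_const 1)) ht ha
  have hX1 := fun (j : Fin m) (d : Bool) => tendstoInMeasure_total_sub hE hS hc₂
    (measurable_groupArm hSm j d (hmeas j d))
    (memLp_groupArm hSm j d (hmeas j d)
      ((memLp_four_sub hmom d (groupMean ν S j d)).mono_exponent (by norm_num))) ht ha
  have hX2 := fun (j : Fin m) (d : Bool) => tendstoInMeasure_total_sub hE hS hc₂
    (measurable_groupArm hSm j d (hmeas2 j d))
    (memLp_groupArm hSm j d (hmeas2 j d) (memLp_two_sub_sq hmom d (groupMean ν S j d))) ht ha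
  have hX3 := fun (j : Fin m) (d : Bool) => tendstoInMeasure_total_sub hE hS hc₂
    (measurable_groupArm hSm j d (hmeas j d))
    (memLp_groupArm hSm j d (hmeas j d)
      ((memLp_four_sub hmom d (groupMean ν S j d)).mono_exponent (by norm_num))) ht ha'
  -- The four families of sums are made to converge along nested subsequences; the earlier limits
  -- survive each refinement.
  obtain ⟨φ₀, hφ₀, h0⟩ := exists_strictMono_forall_ae_tendsto fun q : Fin m × Bool => hX0 q.1 q.2
  obtain ⟨φ₁, hφ₁, h1⟩ := exists_strictMono_forall_ae_tendsto fun q : Fin m × Bool =>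
    (hX1 q.1 q.2).comp hφ₀.tendsto_atTop
  obtain ⟨φ₂, hφ₂, h2⟩ := exists_strictMono_forall_ae_tendsto fun q : Fin m × Bool =>
    (hX2 q.1 q.2).comp (hφ₀.comp hφ₁).tendsto_atTop
  obtain ⟨φ₃, hφ₃, h3⟩ := exists_strictMono_forall_ae_tendsto fun q : Fin m × Bool =>
    (hX3 q.1 q.2).comp ((hφ₀.comp hφ₁).comp hφ₂).tendsto_atTop
  refine ⟨((φ₀ ∘ φ₁) ∘ φ₂) ∘ φ₃, ((hφ₀.comp hφ₁).comp hφ₂).comp hφ₃, ?_⟩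
  have hφ : Tendsto (((φ₀ ∘ φ₁) ∘ φ₂) ∘ φ₃) atTop atTop :=
    (((hφ₀.comp hφ₁).comp hφ₂).comp hφ₃).tendsto_atTop
  have he : ∀ᵐ ω ∂μ, ∀ k, ∀ s, s < (E k).T → ∀ j, (E k).e s j ω ∈ Set.Icc c₂ (1 - c₂) := by
    simp only [ae_all_iff]
    intro k s hs
    exact ae_all_iff.1 ((hE k).e_mem_Icc hc₂ hs)
  have hset : ∀ j, ∫ _ in groups S j, (1 : ℝ) ∂ν = groupProp ν S j := by
    intro j
    simp [groupProp]
  filter_upwards [h0, h1, h2, h3, he] with ω g0 g1 g2 g3 ge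
  refine ⟨hsize.comp hφ, ?_, fun j d => ?_, fun j d => ?_, fun j d => ?_, fun j d => ?_⟩
  · filter_upwards [(hsize.comp hφ).eventually_gt_atTop 0] with k hk j d
    exact armShare_mem_Icc _ hk (fun s hs => ge _ s (hs.trans_le (ht _)) j) d
  · have := (g0 (j, d)).comp ((hφ₁.comp hφ₂).comp hφ₃).tendsto_atTop
    refine this.congr fun k => ?_
    simp only [Function.comp_apply, designMean_groupArm hS, hset, sub_div, armCount_eq_total,
      armShare, ← mul_assoc, ← Finset.sum_mul]
    ring
  · have := (g1 (j, d)).comp (hφ₂.comp hφ₃).tendsto_atTop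
    refine this.congr fun k => ?_
    simp only [Function.comp_apply, designMean_groupArm hS, setIntegral_sub_groupMean hmom (hp _),
      mul_zero, Finset.sum_const_zero, sub_zero]
  · have := (g2 (j, d)).comp hφ₃.tendsto_atTop
    refine this.congr fun k => ?_
    simp only [Function.comp_apply, designMean_groupArm hS,
      setIntegral_sub_groupMean_sq hmom (hp _), sub_div, armShare, ← mul_assoc, ← Finset.sum_mul]
    ring
  · refine (g3 (j, d)).congr fun k => ?_
    simp only [Function.comp_apply, designMean_groupArm hS, setIntegral_sub_groupMean hmom (hp _),
      mul_zero, Finset.sum_const_zero, sub_zero]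

namespace IsRegular

variable {E : ℕ → Experiment Ω 𝒳 m} {t : ℕ → ℕ} {ω : Ω}

lemma size_pos (h : IsRegular E t S ν c₂ δ ω) : ∀ᶠ k in atTop, (0 : ℝ) < (E k).size (t k) :=
  (h.size_atTop.eventually_gt_atTop 0).mono fun _ hk => Nat.cast_pos.2 hk

/-- The average arm probability is at least `c₂`; half of the resulting lower bound absorbs the
vanishing error. -/
lemma count_ge (h : IsRegular E t S ν c₂ δ ω) (hc₂ : 0 < c₂) {j : Fin m}
    (hp : 0 < groupProp ν S j) (d : Bool) : ∀ᶠ k in atTop,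
      groupProp ν S j * c₂ / 2 ≤ (E k).armCount S j d (t k) ω / (E k).size (t k) := by
  have h1 : -(groupProp ν S j * c₂ / 2) < 0 := by
    have := mul_pos hp hc₂
    linarith
  filter_upwards [(h.count j d).eventually_const_lt h1, h.share_mem] with k h2 h3
  have h4 := mul_le_mul_of_nonneg_left (h3 j d).1 hp.le
  linarith

lemma count_ne_zero (h : IsRegular E t S ν c₂ δ ω) (hc₂ : 0 < c₂) {j : Fin m}
    (hp : 0 < groupProp ν S j) (d : Bool) :
    ∀ᶠ k in atTop, (E k).armCount S j d (t k) ω ≠ 0 := by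
  filter_upwards [h.count_ge hc₂ hp d] with k hk h0
  rw [h0, zero_div] at hk
  have := mul_pos hp hc₂
  linarith

lemma tendsto_pHat (h : IsRegular E t S ν c₂ δ ω) (j : Fin m) :
    Tendsto (fun k => (E k).pHat S (t k) j ω) atTop (𝓝 (groupProp ν S j)) := by
  have h1 := ((h.count j true).add (h.count j false)).add_const (groupProp ν S j)
  rw [add_zero, zero_add] at h1
  refine h1.congr' ?_
  filter_upwards [h.size_atTop.eventually_gt_atTop 0] with k hk
  have h2 := (E k).armShare_true_add_false j hk ω
  rw [pHat, groupCount_eq, add_div]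
  linear_combination (-groupProp ν S j) * h2

/-- Division by the number of observations instead of the number of participants. -/
lemma tendsto_div_count (h : IsRegular E t S ν c₂ δ ω) (hc₂ : 0 < c₂) {j : Fin m}
    (hp : 0 < groupProp ν S j) (d : Bool) {x : ℕ → ℝ} {a : ℝ}
    (hx : Tendsto (fun k => x k / (E k).size (t k) -
      groupProp ν S j * a * (E k).armShare j d (t k) ω) atTop (𝓝 0)) :
    Tendsto (fun k => x k / (E k).armCount S j d (t k) ω) atTop (𝓝 a) := by
  -- Subtracting `a` times the expansion of the count cancels the arm share, which therefore need
  -- not converge.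
  have h1 := hx.sub ((h.count j d).const_mul a)
  rw [mul_zero, sub_zero] at h1
  have hκ : 0 < groupProp ν S j * c₂ / 2 := by have := mul_pos hp hc₂; linarith
  rw [tendsto_iff_norm_sub_tendsto_zero]
  have h2 := (h1.norm).const_mul (groupProp ν S j * c₂ / 2)⁻¹
  rw [norm_zero, mul_zero] at h2
  refine squeeze_zero' (Eventually.of_forall fun _ => norm_nonneg _) ?_ h2
  filter_upwards [h.count_ge hc₂ hp d, h.size_pos, h.count_ne_zero hc₂ hp d] with k h3 h4 h5
  have h6 : x k / (E k).armCount S j d (t k) ω - a =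
      ((E k).armCount S j d (t k) ω / (E k).size (t k))⁻¹ * (x k / (E k).size (t k) -
      groupProp ν S j * a * (E k).armShare j d (t k) ω - a * ((E k).armCount S j d (t k) ω /
      (E k).size (t k) - groupProp ν S j * (E k).armShare j d (t k) ω)) := by
    field_simp
    ring
  rw [h6, norm_mul]
  refine mul_le_mul_of_nonneg_right ?_ (norm_nonneg _)
  rw [Real.norm_of_nonneg (inv_nonneg.2 (hκ.le.trans h3))]
  exact inv_anti₀ hκ h3

lemma tendsto_centered_div (h : IsRegular E t S ν c₂ δ ω) (hc₂ : 0 < c₂) {j : Fin m}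
    (hp : 0 < groupProp ν S j) (d : Bool) : Tendsto (fun k => (E k).total
      (groupArm S j d fun y => y - groupMean ν S j d) (t k) ω / (E k).armCount S j d (t k) ω)
      atTop (𝓝 0) := by
  refine h.tendsto_div_count hc₂ hp d ?_
  simpa using h.centered j d

lemma tendsto_armMean (h : IsRegular E t S ν c₂ δ ω) (hc₂ : 0 < c₂) {j : Fin m}
    (hp : 0 < groupProp ν S j) (d : Bool) : Tendsto (fun k => (E k).armMean S (t k) j d ω) atTop
      (𝓝 (groupMean ν S j d)) := by
  have h1 := (h.tendsto_centered_div hc₂ hp d).add_const (groupMean ν S j d)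
  rw [zero_add] at h1
  refine h1.congr' ?_
  filter_upwards [h.count_ne_zero hc₂ hp d] with k hk
  rw [← armMean_sub _ S hk, sub_add_cancel]

lemma tendsto_tauHat (h : IsRegular E t S ν c₂ δ ω) (hc₂ : 0 < c₂)
    (hmom : ∀ d, MemLp (fun w : 𝒳 × (Bool → ℝ) => w.2 d) 4 ν) {j : Fin m}
    (hp : 0 < groupProp ν S j) :
    Tendsto (fun k => (E k).tauHat S (t k) j ω) atTop (𝓝 (groupEffect ν S j)) := by
  rw [groupEffect_eq hmom hp]
  exact (h.tendsto_armMean hc₂ hp true).sub (h.tendsto_armMean hc₂ hp false)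

lemma tendsto_varHat (h : IsRegular E t S ν c₂ δ ω) (hc₂ : 0 < c₂) {j : Fin m}
    (hp : 0 < groupProp ν S j) (d : Bool) :
    Tendsto (fun k => (E k).varHat S (t k) j d ω) atTop (𝓝 (groupVar ν S j d)) := by
  have h1 := (h.tendsto_div_count hc₂ hp d (h.square j d)).sub
    ((h.tendsto_centered_div hc₂ hp d).pow 2)
  rw [zero_pow two_ne_zero, sub_zero] at h1
  refine h1.congr' ?_
  filter_upwards [h.count_ne_zero hc₂ hp d] with k hk
  rw [varHat_eq _ S hk]

/-- With a zero effect the estimate is pure noise, negligible against `δ`. This supplies the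
condition on vanishing effects in `tendsto_of_isOptimal`. -/
lemma tendsto_tauHat_div (h : IsRegular E t S ν c₂ δ ω) (hc₂ : 0 < c₂)
    (hmom : ∀ d, MemLp (fun w : 𝒳 × (Bool → ℝ) => w.2 d) 4 ν) {j : Fin m}
    (hp : 0 < groupProp ν S j) (hτ : groupEffect ν S j = 0) :
    Tendsto (fun k => (E k).tauHat S (t k) j ω / δ ((E k).size (t k))) atTop (𝓝 0) := by
  have key : ∀ d, Tendsto (fun k => ((E k).armMean S (t k) j d ω - groupMean ν S j d) /
      δ ((E k).size (t k))) atTop (𝓝 0) := by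
    intro d
    have h1 := h.tendsto_div_count hc₂ hp d (a := 0) (x := fun k => (E k).total
      (groupArm S j d fun y => y - groupMean ν S j d) (t k) ω / δ ((E k).size (t k))) (by
        refine (h.centered_scaled j d).congr fun k => ?_
        rw [div_div, mul_comm]; ring)
    refine h1.congr' ?_
    filter_upwards [h.count_ne_zero hc₂ hp d] with k hk
    rw [armMean_sub _ S hk, div_right_comm]
  have h2 := (key true).sub (key false)
  rw [sub_zero] at h2
  refine h2.congr fun k => ?_
  rw [groupEffect_eq hmom hp] at hτ
  rw [← sub_div, tauHat]
  congr 1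
  linear_combination -hτ

end IsRegular

end Experiment
end FairExperiment

namespace FairExperiment

/-! ### Convergence of the treatment probabilities -/

namespace Experiment

variable {Ω 𝒳 : Type*} [mΩ : MeasurableSpace Ω] [MeasurableSpace 𝒳] {m : ℕ} {μ : Measure Ω}
  [IsProbabilityMeasure μ] {ν : Measure (𝒳 × (Bool → ℝ))} [IsProbabilityMeasure ν]
  {S : Fin m → Set 𝒳} {c₁ c₂ : ℝ} {δ : ℕ → ℝ}

lemma groupVar_nonneg (j : Fin m) (d : Bool) : 0 ≤ groupVar ν S j d := variance_nonneg _ _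

lemma IsFairAdaptive.le_size {E : Experiment Ω 𝒳 m} (h : E.IsFairAdaptive S μ ν c₁ c₂ δ) {t : ℕ}
    (ht : t ≤ E.T) : t ≤ E.size t := by
  have h1 : ∑ s ∈ Finset.range t, 1 ≤ E.size t := Finset.sum_le_sum fun s hs =>
    h.n_pos s ((Finset.mem_range.1 hs).trans_le ht)
  simpa using h1

lemma IsFairAdaptive.measurable_prob {E : Experiment Ω 𝒳 m} (h : E.IsFairAdaptive S μ ν c₁ c₂ δ)
    (hS : IsMeasurablePartition (groups S)) (hc₂ : c₂ ∈ Set.Ioo (0 : ℝ) (1 / 2)) {t : ℕ}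
    (ht : t < E.T) (j : Fin m) : Measurable (E.e t j) := by
  refine (h.measurable_e t ht j).mono ((E.history_le_past t 0).trans
    ((h.isSequentialTrial hS hc₂).past_le ?_)) le_rfl
  exact E.size_mono ht.le

/-- Along a subsequence, the treatment probabilities converge almost surely. -/
lemma exists_strictMono_tendsto_prob {E : ℕ → Experiment Ω 𝒳 m}
    (hE : ∀ k, (E k).IsFairAdaptive S μ ν c₁ c₂ δ) (hS : IsMeasurablePartition (groups S))
    (hSm : ∀ j, MeasurableSet (S j)) (hc₂ : c₂ ∈ Set.Ioo (0 : ℝ) (1 / 2))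
    (hp : ∀ j, 0 < groupProp ν S j)
    (hmom : ∀ d, MemLp (fun w : 𝒳 × (Bool → ℝ) => w.2 d) 4 ν)
    (hδ_nonneg : ∀ x, 0 ≤ δ x) (hδ_lim : Tendsto δ atTop (𝓝 0))
    (hδ_rate : Tendsto (fun x : ℕ => √(x : ℝ) * δ x) atTop atTop) {eStar : Fin m → ℝ}
    (heStar : IsOptimal c₁ c₂ 0 (groupProp ν S) (groupVar ν S) (groupEffect ν S) eStar)
    {t : ℕ → ℕ} (ht1 : ∀ k, 1 ≤ t k) (ht : ∀ k, t k < (E k).T)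
    (hsize : Tendsto (fun k => (E k).size (t k)) atTop atTop) :
    ∃ φ : ℕ → ℕ, StrictMono φ ∧ ∀ᵐ ω ∂μ, ∀ j, (∃ d, 0 < groupVar ν S j d) →
      Tendsto (fun k => (E (φ k)).e (t (φ k)) j ω) atTop (𝓝 (eStar j)) := by
  obtain ⟨φ, hφ, hreg⟩ := exists_strictMono_isRegular hE hS hSm hc₂ hp hmom hδ_rate
    (fun k => (ht k).le) hsize
  refine ⟨φ, hφ, ?_⟩
  have hopt : ∀ᵐ ω ∂μ, ∀ k, IsOptimal c₁ c₂ (δ ((E k).size (t k)))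
      (fun j => (E k).pHat S (t k) j ω) (fun j d => (E k).varHat S (t k) j d ω)
      (fun j => (E k).tauHat S (t k) j ω) (fun j => (E k).e (t k) j ω) :=
    ae_all_iff.2 fun k => (hE k).e_optimal (t k) (ht1 k) (ht k)
  filter_upwards [hreg, hopt] with ω h1 h2 j hj
  refine tendsto_of_isOptimal hc₂.1 (fun j => h1.tendsto_pHat j)
    (fun j d => h1.tendsto_varHat hc₂.1 (hp j) d) (fun j => h1.tendsto_tauHat hc₂.1 hmom (hp j))
    (fun l => hδ_nonneg _) (hδ_lim.comp h1.size_atTop) (fun i hi => ?_) hp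
    (fun i d => groupVar_nonneg i d) (fun l => h2 (φ l)) heStar hj
  have hL : 0 ≤ Real.log ((1 - c₂) / c₂) := by
    refine Real.log_nonneg ?_
    rw [le_div_iff₀ hc₂.1]
    linarith [hc₂.2]
  set L := Real.log ((1 - c₂) / c₂)
  have h3 := (h1.tendsto_tauHat_div hc₂.1 hmom (hp i) hi).abs
  rw [abs_zero] at h3
  -- An estimate below `δ / (L + 1)` times `L` stays below `δ`; the added one keeps the denominator
  -- positive from `0 ≤ L` alone.
  have h4 : (0 : ℝ) < 1 / (L + 1) := by positivity
  -- Since `δ` is only assumed nonnegative, its eventual positivity is read off from the rate.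
  have h5 : ∀ᶠ k in atTop, 0 < √(((E ∘ φ) k).size ((t ∘ φ) k) : ℝ) *
      δ (((E ∘ φ) k).size ((t ∘ φ) k)) :=
    (hδ_rate.comp h1.size_atTop).eventually_gt_atTop 0
  filter_upwards [h3.eventually_lt_const h4, h5] with k h6 h7
  have h8 : 0 < δ (((E ∘ φ) k).size ((t ∘ φ) k)) := pos_of_mul_pos_right h7 (Real.sqrt_nonneg _)
  rw [abs_div, abs_of_pos h8, div_lt_div_iff₀ h8 (by positivity)] at h6
  have h9 := abs_nonneg (((E ∘ φ) k).tauHat S ((t ∘ φ) k) i ω)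
  nlinarith

/-- The treatment probabilities converge in mean as the number of previous participants grows. -/
lemma exists_forall_integral_prob_le {E : ℕ → Experiment Ω 𝒳 m}
    (hE : ∀ k, (E k).IsFairAdaptive S μ ν c₁ c₂ δ) (hS : IsMeasurablePartition (groups S))
    (hSm : ∀ j, MeasurableSet (S j)) (hc₂ : c₂ ∈ Set.Ioo (0 : ℝ) (1 / 2))
    (hp : ∀ j, 0 < groupProp ν S j)
    (hmom : ∀ d, MemLp (fun w : 𝒳 × (Bool → ℝ) => w.2 d) 4 ν)
    (hδ_nonneg : ∀ x, 0 ≤ δ x) (hδ_lim : Tendsto δ atTop (𝓝 0))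
    (hδ_rate : Tendsto (fun x : ℕ => √(x : ℝ) * δ x) atTop atTop) {eStar : Fin m → ℝ}
    (heStar : IsOptimal c₁ c₂ 0 (groupProp ν S) (groupVar ν S) (groupEffect ν S) eStar)
    {j : Fin m} (hj : ∃ d, 0 < groupVar ν S j d) {η : ℝ} (hη : 0 < η) :
    ∃ M : ℕ, 1 ≤ M ∧ ∀ k t, M ≤ t → t < (E k).T → ∫ ω, |(E k).e t j ω - eStar j| ∂μ ≤ η := by
  by_contra! hcon
  -- Counterexamples for all `M`, possibly from different experiments, are assembled into a new
  -- sequence. Their stages tend to infinity, hence so do the numbers of previous participants, and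
  -- the subsequence theorem together with dominated convergence gives a contradiction. This makes
  -- `M` uniform in `k`.
  choose k t hMt htT hlt using fun M : ℕ => hcon (M + 1) (Nat.le_add_left 1 M)
  have hsize : Tendsto (fun M => (E (k M)).size (t M)) atTop atTop := by
    refine tendsto_atTop_mono (fun M => ?_) tendsto_id
    exact (Nat.le_succ M).trans ((hMt M).trans ((hE _).le_size (htT M).le))
  obtain ⟨φ, hφ, hlim⟩ := exists_strictMono_tendsto_prob (fun M => hE (k M)) hS hSm hc₂ hp hmom
    hδ_nonneg hδ_lim hδ_rate heStar (fun M => (Nat.le_add_left 1 M).trans (hMt M)) htT hsize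
  have h1 : Tendsto (fun M => ∫ ω, |(E (k (φ M))).e (t (φ M)) j ω - eStar j| ∂μ) atTop
      (𝓝 (∫ _, (0 : ℝ) ∂μ)) := by
    refine tendsto_integral_of_dominated_convergence (fun _ => 1) (fun M => ?_)
      (integrable_const 1) (fun M => ?_) ?_
    · have := (hE (k (φ M))).measurable_prob hS hc₂ (htT (φ M)) j
      exact ((this.sub_const _).abs).aestronglyMeasurable
    · filter_upwards [(hE (k (φ M))).e_mem_Icc hc₂ (htT (φ M))] with ω hω
      have h2 := hω j
      have h3 := heStar.1.2.2 j
      rw [Real.norm_eq_abs, abs_abs, abs_le]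
      constructor <;> linarith [h2.1, h2.2, h3.1, h3.2, hc₂.1]
    · filter_upwards [hlim] with ω hω
      have := ((hω j hj).sub_const (eStar j)).abs
      simpa using this
  rw [integral_zero] at h1
  obtain ⟨M, hM⟩ := (h1.eventually_lt_const hη).exists
  exact absurd (hlt (φ M)) (not_lt.2 hM.le)

lemma integral_abs_prob_sub_le_one {E : Experiment Ω 𝒳 m} (hE : E.IsFairAdaptive S μ ν c₁ c₂ δ)
    (hc₂ : c₂ ∈ Set.Ioo (0 : ℝ) (1 / 2)) {a : ℝ} (ha : a ∈ Set.Icc c₂ (1 - c₂)) {t : ℕ}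
    (ht : t < E.T) (j : Fin m) : ∫ ω, |E.e t j ω - a| ∂μ ≤ 1 := by
  have h1 : ∀ᵐ ω ∂μ, ‖|E.e t j ω - a|‖ ≤ 1 := by
    filter_upwards [hE.e_mem_Icc hc₂ ht] with ω hω
    have h2 := hω j
    rw [Real.norm_eq_abs, abs_abs, abs_le]
    constructor <;> linarith [h2.1, h2.2, ha.1, ha.2, hc₂.1]
  have h3 := norm_integral_le_of_norm_le_const h1
  simp only [probReal_univ, mul_one] at h3
  exact (le_abs_self _).trans h3

/-- The treatment probabilities converge on average over all participants. -/
lemma tendsto_average_prob {E : ℕ → Experiment Ω 𝒳 m}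
    (hE : ∀ k, (E k).IsFairAdaptive S μ ν c₁ c₂ δ) (hS : IsMeasurablePartition (groups S))
    (hSm : ∀ j, MeasurableSet (S j)) (hc₂ : c₂ ∈ Set.Ioo (0 : ℝ) (1 / 2))
    (hp : ∀ j, 0 < groupProp ν S j)
    (hmom : ∀ d, MemLp (fun w : 𝒳 × (Bool → ℝ) => w.2 d) 4 ν)
    (hδ_nonneg : ∀ x, 0 ≤ δ x) (hδ_lim : Tendsto δ atTop (𝓝 0))
    (hδ_rate : Tendsto (fun x : ℕ => √(x : ℝ) * δ x) atTop atTop) {eStar : Fin m → ℝ}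
    (heStar : IsOptimal c₁ c₂ 0 (groupProp ν S) (groupVar ν S) (groupEffect ν S) eStar)
    (hT : Tendsto (fun k => (E k).T) atTop atTop)
    (hstage : ∃ c : ℝ, 1 ≤ c ∧ ∀ k, ∀ t < (E k).T,
      ((E k).N : ℝ) / (c * (E k).T) ≤ (E k).n t ∧ ((E k).n t : ℝ) ≤ c * (E k).N / (E k).T)
    {j : Fin m} (hj : ∃ d, 0 < groupVar ν S j d) :
    Tendsto (fun k => ((E k).N : ℝ)⁻¹ * ∑ t ∈ Finset.range (E k).T,
      ((E k).n t : ℝ) * ∫ ω, |(E k).e t j ω - eStar j| ∂μ) atTop (𝓝 0) := by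
  obtain ⟨c, hc1, hst⟩ := hstage
  have hTr : Tendsto (fun k => ((E k).T : ℝ)) atTop atTop :=
    tendsto_natCast_atTop_atTop.comp hT
  rw [Metric.tendsto_nhds]
  intro η hη
  obtain ⟨M, -, hM⟩ := exists_forall_integral_prob_le hE hS hSm hc₂ hp hmom hδ_nonneg hδ_lim
    hδ_rate heStar hj (show 0 < η / 2 by positivity)
  have h1 : Tendsto (fun k => (M * c) / ((E k).T : ℝ)) atTop (𝓝 0) :=
    tendsto_const_nhds.div_atTop hTr
  filter_upwards [h1.eventually_lt_const (show 0 < η / 2 by positivity),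
    hTr.eventually_gt_atTop 0] with k hk hTk
  have hN : 0 < (E k).N := by
    have := (hE k).le_size (le_refl (E k).T)
    have h2 : 0 < (E k).T := by exact_mod_cast hTk
    exact h2.trans_le this
  have hNr : (0 : ℝ) < (E k).N := Nat.cast_pos.2 hN
  have hnn : ∀ t, 0 ≤ ∫ ω, |(E k).e t j ω - eStar j| ∂μ := fun t =>
    integral_nonneg fun ω => abs_nonneg _
  -- Before stage `M` the mean error is bounded by one and a stage has at most `cN/T` participants,
  -- so these stages contribute at most a share `Mc/T`; afterwards the mean error is at most `η/2`.
  have hterm : ∀ t ∈ Finset.range (E k).T,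
      ((E k).n t : ℝ) * ∫ ω, |(E k).e t j ω - eStar j| ∂μ ≤
      (E k).n t * (η / 2) + (if t < M then c * (E k).N / (E k).T else 0) := by
    intro t ht
    have ht := Finset.mem_range.1 ht
    split_ifs with htM
    · have h3 := integral_abs_prob_sub_le_one (hE k) hc₂ (heStar.1.2.2 j) ht j
      have h4 := mul_le_mul_of_nonneg_left h3 (Nat.cast_nonneg ((E k).n t) (α := ℝ))
      have h5 := (hst k t ht).2
      have h6 : 0 ≤ ((E k).n t : ℝ) * (η / 2) := by positivity
      linarith
    · rw [add_zero]
      exact mul_le_mul_of_nonneg_left (hM k t (not_lt.1 htM) ht) (Nat.cast_nonneg _)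
  have hsum := Finset.sum_le_sum hterm
  rw [Finset.sum_add_distrib, ← Finset.sum_mul] at hsum
  have hNsum : (∑ t ∈ Finset.range (E k).T, ((E k).n t : ℝ)) = (E k).N := by
    rw [N, size, Nat.cast_sum]
  have hsmall : ∑ t ∈ Finset.range (E k).T, (if t < M then c * (E k).N / (E k).T else 0) ≤
      M * (c * (E k).N / (E k).T) := by
    rw [← Finset.sum_filter, Finset.sum_const, nsmul_eq_mul]
    refine mul_le_mul_of_nonneg_right ?_ (by positivity)
    have : ((Finset.range (E k).T).filter (· < M)) ⊆ Finset.range M := fun t ht =>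
      Finset.mem_range.2 (Finset.mem_filter.1 ht).2
    have := Finset.card_le_card this
    rw [Finset.card_range] at this
    exact_mod_cast this
  rw [Real.dist_eq, sub_zero, abs_of_nonneg (mul_nonneg (inv_nonneg.2 hNr.le)
    (Finset.sum_nonneg fun t _ => mul_nonneg (Nat.cast_nonneg _) (hnn t)))]
  rw [hNsum] at hsum
  have h7 : ((E k).N : ℝ)⁻¹ * ∑ t ∈ Finset.range (E k).T,
      ((E k).n t : ℝ) * ∫ ω, |(E k).e t j ω - eStar j| ∂μ ≤
      ((E k).N : ℝ)⁻¹ * ((E k).N * (η / 2) + M * (c * (E k).N / (E k).T)) :=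
    mul_le_mul_of_nonneg_left (by linarith) (inv_nonneg.2 hNr.le)
  refine h7.trans_lt ?_
  have h8 : ((E k).N : ℝ)⁻¹ * ((E k).N * (η / 2) + M * (c * (E k).N / (E k).T)) =
      η / 2 + M * c / (E k).T := by
    field_simp
  rw [h8]
  linarith

lemma abs_armProb_sub (d : Bool) (a b : ℝ) : |armProb d a - armProb d b| = |a - b| := by
  cases d
  · simp only [armProb, Bool.false_eq_true, if_false]
    rw [sub_sub_sub_cancel_left, abs_sub_comm]
  · simp [armProb]

lemma integrable_abs_prob_sub {E : Experiment Ω 𝒳 m} (hE : E.IsFairAdaptive S μ ν c₁ c₂ δ)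
    (hS : IsMeasurablePartition (groups S)) (hc₂ : c₂ ∈ Set.Ioo (0 : ℝ) (1 / 2)) (a : ℝ) {t : ℕ}
    (ht : t < E.T) (j : Fin m) : Integrable (fun ω => |E.e t j ω - a|) μ := by
  refine Integrable.abs ((Integrable.of_bound
    (hE.measurable_prob hS hc₂ ht j).aestronglyMeasurable 1 ?_).sub (integrable_const a))
  filter_upwards [hE.e_mem_Icc hc₂ ht] with ω hω
  have h2 := hω j
  rw [Real.norm_eq_abs, abs_le]
  constructor <;> linarith [h2.1, h2.2, hc₂.1]

/-- The average treatment probabilities converge in probability. -/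
lemma tendstoInMeasure_armShare {E : ℕ → Experiment Ω 𝒳 m}
    (hE : ∀ k, (E k).IsFairAdaptive S μ ν c₁ c₂ δ) (hS : IsMeasurablePartition (groups S))
    (hc₂ : c₂ ∈ Set.Ioo (0 : ℝ) (1 / 2)) {j : Fin m} {a : ℝ}
    (hT : Tendsto (fun k => (E k).T) atTop atTop)
    (havg : Tendsto (fun k => ((E k).N : ℝ)⁻¹ * ∑ t ∈ Finset.range (E k).T,
      ((E k).n t : ℝ) * ∫ ω, |(E k).e t j ω - a| ∂μ) atTop (𝓝 0)) (d : Bool) :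
    TendstoInMeasure μ (fun k ω => (E k).armShare j d (E k).T ω - armProb d a) atTop
      (fun _ => 0) := by
  rw [tendstoInMeasure_iff_measureReal_norm]
  intro ε hε
  have h1 := havg.const_mul ε⁻¹
  rw [mul_zero] at h1
  refine squeeze_zero' (Eventually.of_forall fun k => measureReal_nonneg) ?_ h1
  filter_upwards [hT.eventually_gt_atTop 0] with k hTk
  have hN : 0 < (E k).N := hTk.trans_le ((hE k).le_size (le_refl _))
  have hNr : (0 : ℝ) < (E k).N := Nat.cast_pos.2 hN
  have hNsum : (∑ t ∈ Finset.range (E k).T, ((E k).n t : ℝ)) = (E k).N := by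
    rw [N, size, Nat.cast_sum]
  have hint : Integrable (fun ω => ((E k).N : ℝ)⁻¹ * ∑ t ∈ Finset.range (E k).T,
      ((E k).n t : ℝ) * |(E k).e t j ω - a|) μ :=
    (integrable_finsetSum _ fun t ht => (integrable_abs_prob_sub (hE k) hS hc₂ a
      (Finset.mem_range.1 ht) j).const_mul _).const_mul _
  -- Markov's inequality for the weighted average of the absolute errors, which dominates the error
  -- of the average.
  have h2 := mul_meas_ge_le_integral_of_nonneg (ae_of_all μ fun ω =>
    (by positivity : 0 ≤ ((E k).N : ℝ)⁻¹ * ∑ t ∈ Finset.range (E k).T,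
      ((E k).n t : ℝ) * |(E k).e t j ω - a|)) hint ε
  rw [integral_const_mul, integral_finsetSum _ fun t ht => (integrable_abs_prob_sub (hE k) hS hc₂ a
      (Finset.mem_range.1 ht) j).const_mul _] at h2
  simp_rw [integral_const_mul] at h2
  rw [inv_mul_eq_div, le_div_iff₀ hε, mul_comm]
  refine le_trans (mul_le_mul_of_nonneg_left (measureReal_mono fun ω hω => ?_) hε.le) h2
  simp only [sub_zero, Set.mem_ofPred_eq] at hω ⊢
  refine hω.trans ?_
  have h3 : (E k).armShare j d (E k).T ω - armProb d a = ((E k).N : ℝ)⁻¹ *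
      ∑ t ∈ Finset.range (E k).T, ((E k).n t : ℝ) *
        (armProb d ((E k).e t j ω) - armProb d a) := by
    simp_rw [mul_sub]
    rw [Finset.sum_sub_distrib, ← Finset.sum_mul, hNsum, armShare]
    change _ / ((E k).N : ℝ) - _ = _
    field_simp
  rw [h3, norm_mul, Real.norm_of_nonneg (inv_nonneg.2 hNr.le)]
  refine mul_le_mul_of_nonneg_left ((norm_sum_le _ _).trans (Finset.sum_le_sum fun t _ => ?_))
    (inv_nonneg.2 hNr.le)
  rw [norm_mul, Real.norm_of_nonneg (Nat.cast_nonneg _), Real.norm_eq_abs, abs_armProb_sub]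

/-! ### Linear statistics -/

/-- The summand of a linear statistic. -/
noncomputable def linearStat (ν : Measure (𝒳 × (Bool → ℝ))) (S : Fin m → Set 𝒳)
    (a : Fin m → Bool → ℝ) (c : Fin m → ℝ) (w : 𝒳 × (Bool → ℝ)) (b : Bool) : ℝ :=
  ∑ j, (S j).indicator (fun _ => (1 : ℝ)) w.1 * (a j b * (w.2 b - groupMean ν S j b) + c j)

variable {a : Fin m → Bool → ℝ} {c : Fin m → ℝ}

lemma linearStat_of_mem (hS : IsMeasurablePartition (groups S)) {w : 𝒳 × (Bool → ℝ)} {j : Fin m}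
    (hw : w ∈ groups S j) (b : Bool) :
    linearStat ν S a c w b = a j b * (w.2 b - groupMean ν S j b) + c j :=
  hS.sum_indicator hw fun j => a j b * (w.2 b - groupMean ν S j b) + c j

lemma measurable_linearStat (hSm : ∀ j, MeasurableSet (S j)) (b : Bool) :
    Measurable (linearStat ν S a c · b) := by
  refine Finset.measurable_sum _ fun j _ => ?_
  have h1 : Measurable (fun w : 𝒳 × (Bool → ℝ) => (S j).indicator (fun _ => (1 : ℝ)) w.1) :=
    (measurable_const.indicator (hSm j)).comp measurable_fst
  have h2 : Measurable (fun w : 𝒳 × (Bool → ℝ) => w.2 b) :=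
    (measurable_pi_apply b).comp measurable_snd
  exact h1.mul (((h2.sub_const _).const_mul _).add_const _)

lemma memLp_linearStat (hSm : ∀ j, MeasurableSet (S j))
    (hmom : ∀ d, MemLp (fun w : 𝒳 × (Bool → ℝ) => w.2 d) 4 ν) (b : Bool) :
    MemLp (linearStat ν S a c · b) 4 ν := by
  refine memLp_finsetSum _ fun j _ => ?_
  have h1 : Measurable (fun w : 𝒳 × (Bool → ℝ) => (S j).indicator (fun _ => (1 : ℝ)) w.1) :=
    (measurable_const.indicator (hSm j)).comp measurable_fst
  have h2 : MemLp (fun w : 𝒳 × (Bool → ℝ) => a j b * (w.2 b - groupMean ν S j b) + c j) 4 ν :=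
    ((memLp_four_sub hmom b _).const_mul _).add (memLp_const _)
  refine h2.of_le (h1.aestronglyMeasurable.mul h2.aestronglyMeasurable) (ae_of_all _ fun w => ?_)
  rw [norm_mul]
  refine mul_le_of_le_one_left (norm_nonneg _) ?_
  by_cases h : w.1 ∈ S j <;> simp [h]

lemma total_linearStat (E : Experiment Ω 𝒳 m) (t : ℕ) (ω : Ω) :
    E.total (linearStat ν S a c) t ω = ∑ j, ((∑ d : Bool, a j d *
      E.total (groupArm S j d fun y => y - groupMean ν S j d) t ω) +
        c j * E.groupCount S j t ω) := by
  have h1 : ∀ s i, linearStat ν S a c (E.unit s i ω) (E.D s i ω) = ∑ j, ((∑ d : Bool, a j d *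
      groupArm S j d (fun y => y - groupMean ν S j d) (E.unit s i ω) (E.D s i ω)) +
        c j * E.inGroup S j s i ω) := by
    intro s i
    refine Finset.sum_congr rfl fun j _ => ?_
    simp only [groupArm, inGroup, unit]
    cases E.D s i ω <;> simp <;> ring
  simp only [total, h1, groupCount, Finset.mul_sum, Finset.sum_add_distrib]
  congr 1
  · simp_rw [Finset.sum_comm (s := Finset.range (E.n _)) (t := (Finset.univ : Finset (Fin m)))]
    rw [Finset.sum_comm]
    refine Finset.sum_congr rfl fun j _ => ?_
    simp_rw [Finset.sum_comm (s := Finset.range (E.n _)) (t := (Finset.univ : Finset Bool))]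
    rw [Finset.sum_comm]
  · simp_rw [Finset.sum_comm (s := Finset.range (E.n _)) (t := (Finset.univ : Finset (Fin m)))]
    rw [Finset.sum_comm]

lemma setIntegral_linearStat (hS : IsMeasurablePartition (groups S))
    (hp : ∀ j, 0 < groupProp ν S j)
    (hmom : ∀ d, MemLp (fun w : 𝒳 × (Bool → ℝ) => w.2 d) 4 ν) (j : Fin m) (b : Bool) :
    ∫ w in groups S j, linearStat ν S a c w b ∂ν = groupProp ν S j * c j := by
  rw [setIntegral_congr_fun (hS.measurableSet j) fun w hw => linearStat_of_mem hS hw b]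
  have h1 := (memLp_four_sub hmom b (groupMean ν S j b)).integrable (by norm_num)
  rw [integral_add (h1.const_mul _).integrableOn (integrable_const _).integrableOn,
    integral_const_mul, setIntegral_sub_groupMean hmom (hp j)]
  simp [groupProp]

lemma setIntegral_linearStat_sq (hS : IsMeasurablePartition (groups S))
    (hp : ∀ j, 0 < groupProp ν S j)
    (hmom : ∀ d, MemLp (fun w : 𝒳 × (Bool → ℝ) => w.2 d) 4 ν) (j : Fin m) (b : Bool) :
    ∫ w in groups S j, linearStat ν S a c w b ^ 2 ∂ν =
      groupProp ν S j * (a j b ^ 2 * groupVar ν S j b + c j ^ 2) := by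
  have h0 : ∀ w ∈ groups S j, linearStat ν S a c w b ^ 2 =
      a j b ^ 2 * (w.2 b - groupMean ν S j b) ^ 2 +
        (2 * a j b * c j * (w.2 b - groupMean ν S j b) + c j ^ 2) := fun w hw => by
    rw [linearStat_of_mem hS hw b]; ring
  rw [setIntegral_congr_fun (hS.measurableSet j) h0]
  have h1 := (memLp_four_sub hmom b (groupMean ν S j b)).integrable (by norm_num)
  have h2 := (memLp_two_sub_sq hmom b (groupMean ν S j b)).integrable (by norm_num)
  have h3 : Integrable (fun w => 2 * a j b * c j * (w.2 b - groupMean ν S j b) + c j ^ 2) ν :=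
    (h1.const_mul _).add (integrable_const _)
  rw [integral_add (h2.const_mul _).integrableOn h3.integrableOn,
    integral_add (h1.const_mul _).integrableOn (integrable_const _).integrableOn,
    integral_const_mul, integral_const_mul, setIntegral_sub_groupMean hmom (hp j),
    setIntegral_sub_groupMean_sq hmom (hp j)]
  simp [groupProp]
  ring

/-- The outcome part is centered within each group and arm, and `c j` is the same in both arms, so
the mean is zero for every allocation. This is the martingale property needed by the central limit
theorem. -/
lemma designMean_linearStat (hS : IsMeasurablePartition (groups S))
    (hp : ∀ j, 0 < groupProp ν S j)
    (hmom : ∀ d, MemLp (fun w : 𝒳 × (Bool → ℝ) => w.2 d) 4 ν)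
    (hc : ∑ j, groupProp ν S j * c j = 0) (p : Fin m → ℝ) :
    designMean ν (groups S) (linearStat ν S a c) p = 0 := by
  simp only [designMean, setIntegral_linearStat hS hp hmom, Fintype.sum_bool, smul_eq_mul]
  rw [← Finset.sum_add_distrib, ← hc]
  refine Finset.sum_congr rfl fun j _ => ?_
  simp [armProb]; ring

/-- The asymptotic variance of a linear statistic for treatment probabilities `e`. -/
noncomputable def linearVar (ν : Measure (𝒳 × (Bool → ℝ))) (S : Fin m → Set 𝒳)
    (a : Fin m → Bool → ℝ) (c e : Fin m → ℝ) : ℝ :=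
  ∑ j, groupProp ν S j * ((∑ d : Bool, a j d ^ 2 * armProb d (e j) * groupVar ν S j d) + c j ^ 2)

lemma designMean_linearStat_sq (hS : IsMeasurablePartition (groups S))
    (hp : ∀ j, 0 < groupProp ν S j)
    (hmom : ∀ d, MemLp (fun w : 𝒳 × (Bool → ℝ) => w.2 d) 4 ν) (p : Fin m → ℝ) :
    designMean ν (groups S) (fun w b => linearStat ν S a c w b ^ 2) p = linearVar ν S a c p := by
  simp only [designMean, setIntegral_linearStat_sq hS hp hmom, Fintype.sum_bool, smul_eq_mul,
    linearVar]
  rw [← Finset.sum_add_distrib]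
  refine Finset.sum_congr rfl fun j _ => ?_
  simp [armProb]; ring

/-- The conditional variance is Lipschitz in the allocation, with weight zero in groups without
variance. Convergence of the allocation is thus needed only where the oracle is unique. -/
lemma abs_linearVar_sub_le (e e' : Fin m → ℝ) :
    |linearVar ν S a c e - linearVar ν S a c e'| ≤
      ∑ j, |groupProp ν S j| * (∑ d : Bool, a j d ^ 2 * groupVar ν S j d) * |e j - e' j| := by
  simp only [linearVar, ← Finset.sum_sub_distrib, ← mul_sub, add_sub_add_right_eq_sub]
  refine (Finset.abs_sum_le_sum_abs _ _).trans (Finset.sum_le_sum fun j _ => ?_)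
  rw [abs_mul, mul_assoc, Finset.sum_mul]
  refine mul_le_mul_of_nonneg_left ((Finset.abs_sum_le_sum_abs _ _).trans
    (Finset.sum_le_sum fun d _ => ?_)) (abs_nonneg _)
  have h1 : a j d ^ 2 * armProb d (e j) * groupVar ν S j d -
      a j d ^ 2 * armProb d (e' j) * groupVar ν S j d =
      a j d ^ 2 * groupVar ν S j d * (armProb d (e j) - armProb d (e' j)) := by ring
  rw [h1, abs_mul, abs_armProb_sub,
    abs_of_nonneg (mul_nonneg (sq_nonneg _) (groupVar_nonneg j d))]

/-- Asymptotic normality of linear statistics. -/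
lemma tendstoInDistribution_linearStat {E : ℕ → Experiment Ω 𝒳 m}
    (hE : ∀ k, (E k).IsFairAdaptive S μ ν c₁ c₂ δ) (hS : IsMeasurablePartition (groups S))
    (hSm : ∀ j, MeasurableSet (S j)) (hc₂ : c₂ ∈ Set.Ioo (0 : ℝ) (1 / 2))
    (hp : ∀ j, 0 < groupProp ν S j)
    (hmom : ∀ d, MemLp (fun w : 𝒳 × (Bool → ℝ) => w.2 d) 4 ν) {eStar : Fin m → ℝ}
    (heI : ∀ j, eStar j ∈ Set.Icc c₂ (1 - c₂))
    (hT : Tendsto (fun k => (E k).T) atTop atTop)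
    (havg : ∀ j, (∃ d, 0 < groupVar ν S j d) →
      Tendsto (fun k => ((E k).N : ℝ)⁻¹ * ∑ t ∈ Finset.range (E k).T,
        ((E k).n t : ℝ) * ∫ ω, |(E k).e t j ω - eStar j| ∂μ) atTop (𝓝 0))
    (hc : ∑ j, groupProp ν S j * c j = 0) :
    TendstoInDistribution
      (fun k ω => (√((E k).N : ℝ))⁻¹ * (E k).total (linearStat ν S a c) (E k).T ω) atTop
      (id : ℝ → ℝ) (fun _ => μ) (gaussianReal 0 (linearVar ν S a c eStar).toNNReal) := by
  have hN : Tendsto (fun k => (E k).N) atTop atTop :=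
    tendsto_atTop_mono (fun k => (hE k).le_size le_rfl) hT
  have hV : 0 ≤ linearVar ν S a c eStar := Finset.sum_nonneg fun j _ =>
    mul_nonneg (hp j).le (add_nonneg (Finset.sum_nonneg fun d _ => mul_nonneg (mul_nonneg
      (sq_nonneg _) (armProb_nonneg hc₂.1 (heI j) d)) (groupVar_nonneg j d)) (sq_nonneg _))
  have key := IsSequentialTrial.tendstoInDistribution_sum
    (fun k => (hE k).isSequentialTrial hS hc₂) hN
    (measurable_linearStat (ν := ν) (a := a) (c := c) hSm)
    (fun d => (memLp_linearStat hSm hmom d).mono_exponent (by norm_num))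
    (designMean_linearStat hS hp hmom hc) hV ?_
  · refine key.congr (fun k => ae_of_all _ fun ω => ?_) (ae_of_all _ fun _ => rfl)
    change _ = (√((E k).N : ℝ))⁻¹ * (E k).total (linearStat ν S a c) (E k).T ω
    rw [total, sum_flatten]
    rfl
  · have hlim : Tendsto (fun k => ∑ j, |groupProp ν S j| * (∑ d : Bool, a j d ^ 2 *
        groupVar ν S j d) * (((E k).N : ℝ)⁻¹ * ∑ t ∈ Finset.range (E k).T,
        ((E k).n t : ℝ) * ∫ ω, |(E k).e t j ω - eStar j| ∂μ)) atTop (𝓝 0) := by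
      rw [← Finset.sum_const_zero (ι := Fin m) (s := Finset.univ)]
      refine tendsto_finsetSum _ fun j _ => ?_
      -- In a degenerate group the coefficient is zero, so nothing is required of the allocation
      -- there.
      by_cases hj : ∃ d, 0 < groupVar ν S j d
      · simpa using (havg j hj).const_mul _
      · push Not at hj
        have h0 : ∀ d, groupVar ν S j d = 0 := fun d => le_antisymm (hj d) (groupVar_nonneg j d)
        simp [h0]
    refine squeeze_zero (fun k => mul_nonneg (by positivity) (Finset.sum_nonneg fun l _ =>
      integral_nonneg fun ω => abs_nonneg _)) (fun k => ?_) hlim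
    have h1 : ∀ j, ((E k).N : ℝ)⁻¹ * ∑ t ∈ Finset.range (E k).T,
        ((E k).n t : ℝ) * ∫ ω, |(E k).e t j ω - eStar j| ∂μ = ((E k).N : ℝ)⁻¹ *
        ∑ l ∈ Finset.range (E k).N, ∫ ω, |(E k).e ((E k).stageOf l) j ω - eStar j| ∂μ := by
      intro j
      have h2 := (E k).sum_flatten (fun t _ => ∫ ω, |(E k).e t j ω - eStar j| ∂μ) (E k).T
      simp only [Finset.sum_const, Finset.card_range, nsmul_eq_mul] at h2
      rw [h2, N]
    simp_rw [h1]
    simp_rw [← mul_assoc, mul_comm _ ((E k).N : ℝ)⁻¹, mul_assoc, ← Finset.mul_sum]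
    refine mul_le_mul_of_nonneg_left ?_ (by positivity)
    simp_rw [Finset.mul_sum]
    rw [Finset.sum_comm]
    refine Finset.sum_le_sum fun l hl => ?_
    have hst : (E k).stageOf l < (E k).T := by
      obtain ⟨s, hs, i, hi, rfl⟩ := (E k).exists_eq_size_add (Finset.mem_range.1 hl)
      rwa [(E k).stageOf_size_add hi]
    simp_rw [designMean_linearStat_sq hS hp hmom]
    have hi : ∀ j, Integrable (fun ω => |groupProp ν S j| * (∑ d : Bool, a j d ^ 2 *
        groupVar ν S j d) * |(E k).e ((E k).stageOf l) j ω - eStar j|) μ := fun j =>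
      (integrable_abs_prob_sub (hE k) hS hc₂ _ hst j).const_mul _
    calc _ ≤ ∫ ω, ∑ j, |groupProp ν S j| * (∑ d : Bool, a j d ^ 2 *
        groupVar ν S j d) * |(E k).e ((E k).stageOf l) j ω - eStar j| ∂μ :=
          integral_mono_of_nonneg (ae_of_all _ fun ω => abs_nonneg _)
            (integrable_finsetSum _ fun j _ => hi j)
            (ae_of_all _ fun ω => abs_linearVar_sub_le _ _)
      _ = _ := by
          rw [integral_finsetSum _ fun j _ => hi j]
          refine Finset.sum_congr rfl fun j _ => ?_
          rw [integral_const_mul]; ring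

end Experiment
end FairExperiment

namespace FairExperiment

/-! ### Coverage of normal confidence intervals -/

/-- A jump of the distribution function is the mass of a point. -/
lemma continuous_cdf (P : Measure ℝ) [IsProbabilityMeasure P] [NullSingletonClass P] :
    Continuous (cdf P) := by
  refine continuous_iff_continuousAt.2 fun x => ?_
  rw [(monotone_cdf P).continuousAt_iff_leftLim_eq_rightLim, StieltjesFunction.rightLim_eq]
  have h1 : P {x} = 0 := measure_singleton x
  rw [← measure_cdf P, StieltjesFunction.measure_singleton, ENNReal.ofReal_eq_zero] at h1
  exact le_antisymm ((monotone_cdf P).leftLim_le le_rfl) (by linarith)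

lemma nullSingletonClass_standardGaussian : NullSingletonClass (gaussianReal 0 1) :=
  nullSingletonClass_gaussianReal one_ne_zero

/-- By continuity the set defining the quantile is closed, so its infimum belongs to it; a point
where the distribution function equals `u`, from the intermediate value theorem, gives the other
inequality. -/
lemma cdf_normalQuantile {u : ℝ} (hu : u ∈ Set.Ioo (0 : ℝ) 1) :
    cdf (gaussianReal 0 1) (normalQuantile u) = u := by
  have h0 := nullSingletonClass_standardGaussian
  have hc := continuous_cdf (gaussianReal 0 1)
  obtain ⟨x, hx⟩ := (isPreconnected_univ.intermediate_value_Ioo (l₁ := atBot) (l₂ := atTop)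
    (by simp) (by simp) hc.continuousOn (tendsto_cdf_atBot _) (tendsto_cdf_atTop _)) hu
  have hne : {x : ℝ | u ≤ cdf (gaussianReal 0 1) x}.Nonempty := ⟨x, hx.2.ge⟩
  have hbdd : BddBelow {x : ℝ | u ≤ cdf (gaussianReal 0 1) x} := by
    obtain ⟨b, hb⟩ := ((tendsto_cdf_atBot (gaussianReal 0 1)).eventually_lt_const hu.1).exists
    refine ⟨b, fun y hy => ?_⟩
    by_contra! hlt
    exact absurd (hy.trans ((monotone_cdf _) hlt.le)) (not_le.2 hb)
  have hcl : IsClosed {x : ℝ | u ≤ cdf (gaussianReal 0 1) x} := isClosed_le continuous_const hc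
  refine le_antisymm ?_ (hcl.csInf_mem hne hbdd)
  exact ((monotone_cdf _) (csInf_le hbdd hx.2.ge)).trans hx.2.le

lemma measureReal_abs_le_normalQuantile {α : ℝ} (hα : α ∈ Set.Ioo (0 : ℝ) 1) :
    (gaussianReal 0 1).real {x | |x| ≤ normalQuantile (1 - α / 2)} = 1 - α := by
  have h0 := nullSingletonClass_standardGaussian
  set z := normalQuantile (1 - α / 2) with hz
  have h1 : (gaussianReal 0 1).real (Set.Iic z) = 1 - α / 2 := by
    rw [← cdf_eq_real]
    exact cdf_normalQuantile ⟨by linarith [hα.2], by linarith [hα.1]⟩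
  have h2 : (gaussianReal 0 1).real (Set.Iio (-z)) = α / 2 := by
    have h3 : (gaussianReal 0 1).map (fun x => -x) = gaussianReal 0 1 := by
      rw [gaussianReal_map_neg, neg_zero]
    rw [← h3, map_measureReal_apply measurable_neg measurableSet_Iio]
    have h4 : (fun x : ℝ => -x) ⁻¹' Set.Iio (-z) = (Set.Iic z)ᶜ := by
      ext x; simp
    rw [h4, probReal_compl_eq_one_sub measurableSet_Iic, h1]
    ring
  -- Otherwise monotonicity would give `1 - α/2 ≤ α/2`, contrary to `α < 1`. The inclusion behind
  -- the difference of probabilities below needs it.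
  have hz0 : -z ≤ z := by
    by_contra! hlt
    have h5 : (gaussianReal 0 1).real (Set.Iic z) ≤ (gaussianReal 0 1).real (Set.Iio (-z)) :=
      measureReal_mono fun x hx => lt_of_le_of_lt hx hlt
    rw [h1, h2] at h5
    linarith [hα.2]
  have h6 : {x | |x| ≤ z} = Set.Iic z \ Set.Iio (-z) := by
    ext x
    simp [abs_le, and_comm]
  rw [h6, measureReal_sdiff (show Set.Iio (-z) ⊆ Set.Iic z from fun x hx => (le_of_lt hx).trans hz0)
    measurableSet_Iio, h1, h2]
  ring

lemma measureReal_gaussian_abs_le {α v : ℝ} (hα : α ∈ Set.Ioo (0 : ℝ) 1) (hv : 0 < v) :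
    (gaussianReal 0 v.toNNReal).real {x | |x| ≤ normalQuantile (1 - α / 2) * √v} = 1 - α := by
  have h1 : (gaussianReal 0 1).map (√v * ·) = gaussianReal 0 v.toNNReal := by
    rw [gaussianReal_map_const_mul, mul_zero, mul_one]
    congr 1
    ext
    simp [Real.sq_sqrt hv.le, hv.le]
  rw [← h1, map_measureReal_apply (by fun_prop)
    (measurableSet_le (by fun_prop) measurable_const), ← measureReal_abs_le_normalQuantile hα]
  congr 1
  ext x
  have h2 : 0 < √v := Real.sqrt_pos.2 hv
  simp only [Set.mem_preimage, Set.mem_ofPred_eq, abs_mul, abs_of_pos h2]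
  rw [mul_comm, mul_le_mul_iff_left₀ h2]

/-- Slutsky's theorem for the continuous map `(x, y) ↦ |x| - z√y`. The event is that this is
nonpositive, and the limit law gives no mass to the boundary point zero because `v > 0`. -/
lemma tendsto_measureReal_abs_le {Ω : Type*} [MeasurableSpace Ω] {μ : Measure Ω}
    [IsProbabilityMeasure μ] {X V : ℕ → Ω → ℝ} {v α : ℝ} (hv : 0 < v)
    (hα : α ∈ Set.Ioo (0 : ℝ) 1)
    (hX : TendstoInDistribution X atTop (id : ℝ → ℝ) (fun _ => μ) (gaussianReal 0 v.toNNReal))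
    (hVm : ∀ k, AEMeasurable (V k) μ) (hV : TendstoInMeasure μ V atTop (fun _ => v)) :
    Tendsto (fun k => μ.real {ω | |X k ω| ≤ normalQuantile (1 - α / 2) * √(V k ω)}) atTop
      (𝓝 (1 - α)) := by
  set z := normalQuantile (1 - α / 2)
  have h1 := hX.continuous_comp_prodMk_of_tendstoInMeasure_const
    (g := fun q : ℝ × ℝ => |q.1| - z * √q.2) (by fun_prop) hV hVm
  have hg : Measurable fun x : ℝ => |x| - z * √v := by fun_prop
  have hna : NullSingletonClass (gaussianReal 0 v.toNNReal) :=
    nullSingletonClass_gaussianReal (by simpa using hv)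
  have hset : {x : ℝ | |x| - z * √v = 0} ⊆ {z * √v, -(z * √v)} := fun x hx => by
    have h2 : |x| = z * √v := sub_eq_zero.1 hx
    rcases abs_choice x with h3 | h3
    · left; rw [← h2, h3]
    · right; rw [Set.mem_singleton_iff, ← h2, h3, neg_neg]
  have key := ProbabilityMeasure.tendsto_measure_of_null_frontier_of_tendsto' h1.tendsto
    (E := Set.Iic 0) (by
      rw [frontier_Iic]
      change (gaussianReal 0 v.toNNReal).map (fun x : ℝ => |x| - z * √v) {0} = 0
      rw [Measure.map_apply hg (measurableSet_singleton 0)]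
      exact measure_mono_null hset (((Set.finite_singleton _).insert _).measure_zero _))
  have hprob := Measure.isProbabilityMeasure_map (μ := gaussianReal 0 v.toNNReal) hg.aemeasurable
  have hlim := (ENNReal.tendsto_toReal (measure_ne_top ((gaussianReal 0 v.toNNReal).map
    fun x : ℝ => |x| - z * √v) (Set.Iic 0))).comp key
  have e2 : ((gaussianReal 0 v.toNNReal).map (fun x : ℝ => |x| - z * √v) (Set.Iic 0)).toReal =
      1 - α := by
    rw [Measure.map_apply hg measurableSet_Iic, ← measureReal_gaussian_abs_le hα hv,
      measureReal_def]
    congr 2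
    ext x
    simp [z]
  rw [← e2]
  refine hlim.congr fun k => ?_
  change (μ.map (fun ω => |X k ω| - z * √(V k ω)) (Set.Iic 0)).toReal = _
  rw [Measure.map_apply_of_aemeasurable (h1.forall_aemeasurable k) measurableSet_Iic,
    measureReal_def]
  congr 2
  ext ω
  simp

lemma mem_confInterval_iff {α a w θ : ℝ} {N : ℕ} (hN : 0 < N) :
    θ ∈ confInterval α a w N ↔ |√(N : ℝ) * (a - θ)| ≤ normalQuantile (1 - α / 2) * √w := by
  have h1 : 0 < √(N : ℝ) := Real.sqrt_pos.2 (Nat.cast_pos.2 hN)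
  rw [confInterval, ← Real.closedBall_eq_Icc, Metric.mem_closedBall, dist_comm, Real.dist_eq,
    le_div_iff₀ h1, abs_mul, abs_of_pos h1, mul_comm]

/-- Intervals around asymptotically normal estimators have asymptotically nominal coverage. -/
lemma tendsto_coverage {Ω : Type*} [MeasurableSpace Ω] {μ : Measure Ω}
    [IsProbabilityMeasure μ] {N : ℕ → ℕ} (hN : Tendsto N atTop atTop) {A V : ℕ → Ω → ℝ}
    {θ v α : ℝ} (hv : 0 < v) (hα : α ∈ Set.Ioo (0 : ℝ) 1)
    (hX : TendstoInDistribution (fun k ω => √(N k : ℝ) * (A k ω - θ)) atTop (id : ℝ → ℝ)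
      (fun _ => μ) (gaussianReal 0 v.toNNReal))
    (hVm : ∀ k, AEMeasurable (V k) μ) (hV : TendstoInMeasure μ V atTop (fun _ => v)) :
    Tendsto (fun k => μ.real {ω | θ ∈ confInterval α (A k ω) (V k ω) (N k)}) atTop
      (𝓝 (1 - α)) := by
  refine (tendsto_measureReal_abs_le hv hα hX hVm hV).congr' ?_
  filter_upwards [hN.eventually_gt_atTop 0] with k hk
  simp_rw [mem_confInterval_iff hk]

/-! ### Measurability of the estimators -/

namespace Experiment

section Measurability

variable {Ω 𝒳 : Type*} [mΩ : MeasurableSpace Ω] [MeasurableSpace 𝒳] {m : ℕ} {μ : Measure Ω}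
  [IsProbabilityMeasure μ] {ν : Measure (𝒳 × (Bool → ℝ))} {S : Fin m → Set 𝒳} {c₁ c₂ : ℝ}
  {δ : ℕ → ℝ} {E : Experiment Ω 𝒳 m}

namespace IsFairAdaptive

lemma measurable_total (h : E.IsFairAdaptive S μ ν c₁ c₂ δ) {f : 𝒳 × (Bool → ℝ) → Bool → ℝ}
    (hf : ∀ d, Measurable (f · d)) : Measurable (E.total f E.T) := by
  refine Finset.measurable_sum _ fun t ht => Finset.measurable_sum _ fun i hi => ?_
  have ht := Finset.mem_range.1 ht
  have hi := Finset.mem_range.1 hi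
  have h1 : Measurable (fun q : (𝒳 × (Bool → ℝ)) × Bool => f q.1 q.2) :=
    measurable_from_prod_countable_left (f := fun q : (𝒳 × (Bool → ℝ)) × Bool => f q.1 q.2) hf
  exact h1.comp ((h.measurable_unit ht hi).prodMk (h.measurable_D t ht i hi))

variable (hSm : ∀ j, MeasurableSet (S j))
include hSm

lemma measurable_inGroup (h : E.IsFairAdaptive S μ ν c₁ c₂ δ) {t i : ℕ} (ht : t < E.T)
    (hi : i < E.n t) (j : Fin m) : Measurable (E.inGroup S j t i) :=
  (measurable_const.indicator (hSm j)).comp (h.measurable_X t ht i hi)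

lemma measurable_armWeight (h : E.IsFairAdaptive S μ ν c₁ c₂ δ) {t i : ℕ} (ht : t < E.T)
    (hi : i < E.n t) (j : Fin m) (d : Bool) :
    Measurable (fun ω => E.inGroup S j t i ω * E.inArm d t i ω) :=
  (h.measurable_inGroup hSm ht hi j).mul (Measurable.ite
    (h.measurable_D t ht i hi (measurableSet_singleton d)) measurable_const measurable_const)

omit hSm in
lemma measurable_obs (h : E.IsFairAdaptive S μ ν c₁ c₂ δ) {t i : ℕ} (ht : t < E.T)
    (hi : i < E.n t) : Measurable (E.obs t i) := by
  have h1 : Measurable (fun q : (𝒳 × (Bool → ℝ)) × Bool => q.1.2 q.2) :=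
    measurable_from_prod_countable_left
      (f := fun q : (𝒳 × (Bool → ℝ)) × Bool => q.1.2 q.2) fun d =>
        (measurable_pi_apply d).comp measurable_snd
  exact h1.comp ((h.measurable_unit ht hi).prodMk (h.measurable_D t ht i hi))

lemma measurable_groupCount (h : E.IsFairAdaptive S μ ν c₁ c₂ δ) (j : Fin m) :
    Measurable (E.groupCount S j E.T) :=
  Finset.measurable_sum _ fun _ ht => Finset.measurable_sum _ fun _ hi =>
    h.measurable_inGroup hSm (Finset.mem_range.1 ht) (Finset.mem_range.1 hi) j

lemma measurable_armCount (h : E.IsFairAdaptive S μ ν c₁ c₂ δ) (j : Fin m) (d : Bool) :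
    Measurable (E.armCount S j d E.T) :=
  Finset.measurable_sum _ fun _ ht => Finset.measurable_sum _ fun _ hi =>
    h.measurable_armWeight hSm (Finset.mem_range.1 ht) (Finset.mem_range.1 hi) j d

lemma measurable_pHat (h : E.IsFairAdaptive S μ ν c₁ c₂ δ) (j : Fin m) :
    Measurable (E.pHat S E.T j) := (h.measurable_groupCount hSm j).div_const _

lemma measurable_armMean (h : E.IsFairAdaptive S μ ν c₁ c₂ δ) (j : Fin m) (d : Bool) :
    Measurable (E.armMean S E.T j d) := by
  refine Measurable.div ?_ (h.measurable_armCount hSm j d)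
  refine Finset.measurable_sum _ fun t ht => Finset.measurable_sum _ fun i hi => ?_
  have ht := Finset.mem_range.1 ht
  have hi := Finset.mem_range.1 hi
  exact (h.measurable_armWeight hSm ht hi j d).mul (h.measurable_obs ht hi)

lemma measurable_tauHat (h : E.IsFairAdaptive S μ ν c₁ c₂ δ) (j : Fin m) :
    Measurable (E.tauHat S E.T j) :=
  (h.measurable_armMean hSm j true).sub (h.measurable_armMean hSm j false)

lemma measurable_varHat (h : E.IsFairAdaptive S μ ν c₁ c₂ δ) (j : Fin m) (d : Bool) :
    Measurable (E.varHat S E.T j d) := by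
  refine Measurable.div ?_ (h.measurable_armCount hSm j d)
  refine Finset.measurable_sum _ fun t ht => Finset.measurable_sum _ fun i hi => ?_
  have ht := Finset.mem_range.1 ht
  have hi := Finset.mem_range.1 hi
  exact (h.measurable_armWeight hSm ht hi j d).mul
    (((h.measurable_obs ht hi).sub (h.measurable_armMean hSm j d)).pow_const 2)

lemma measurable_ateHat (h : E.IsFairAdaptive S μ ν c₁ c₂ δ) : Measurable (E.ateHat S) :=
  Finset.measurable_sum _ fun j _ => (h.measurable_pHat hSm j).mul (h.measurable_tauHat hSm j)

lemma measurable_groupVarEst (h : E.IsFairAdaptive S μ ν c₁ c₂ δ) (j : Fin m) :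
    Measurable (E.groupVarEst S j) := by
  have h1 : Measurable (E.eHat S j) :=
    (h.measurable_armCount hSm j true).div (h.measurable_groupCount hSm j)
  exact (measurable_const.div (h.measurable_pHat hSm j)).mul
    (((h.measurable_varHat hSm j true).div h1).add
      ((h.measurable_varHat hSm j false).div (measurable_const.sub h1)))

lemma measurable_ateVarEst (h : E.IsFairAdaptive S μ ν c₁ c₂ δ) : Measurable (E.ateVarEst S) :=
  (Finset.measurable_sum _ fun j _ => ((h.measurable_pHat hSm j).pow_const 2).mul
    (h.measurable_groupVarEst hSm j)).add
    (Finset.measurable_sum _ fun j _ => (h.measurable_pHat hSm j).mul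
      (((h.measurable_tauHat hSm j).sub (h.measurable_ateHat hSm)).pow_const 2))

end IsFairAdaptive

end Measurability

/-! ### Consistency of the variance estimators -/

variable {Ω 𝒳 : Type*} [mΩ : MeasurableSpace Ω] [MeasurableSpace 𝒳] {m : ℕ} {μ : Measure Ω}
  [IsProbabilityMeasure μ] {ν : Measure (𝒳 × (Bool → ℝ))} [IsProbabilityMeasure ν]
  {S : Fin m → Set 𝒳} {c₁ c₂ : ℝ} {δ : ℕ → ℝ}

/-- The sums over all participants behave as in the law of large numbers, and the average
treatment probabilities approach `e` in the groups with random outcomes. -/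
structure IsRegularWith (E : ℕ → Experiment Ω 𝒳 m) (S : Fin m → Set 𝒳)
    (ν : Measure (𝒳 × (Bool → ℝ))) (c₂ : ℝ) (δ : ℕ → ℝ) (e : Fin m → ℝ) (ω : Ω) : Prop where
  regular : IsRegular E (fun k => (E k).T) S ν c₂ δ ω
  share : ∀ j, (∃ d, 0 < groupVar ν S j d) → ∀ d, Tendsto
    (fun k => (E k).armShare j d (E k).T ω) atTop (𝓝 (armProb d (e j)))

namespace IsRegularWith

variable {E : ℕ → Experiment Ω 𝒳 m} {e : Fin m → ℝ} {ω : Ω}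

lemma armProb_pos (hc₂ : 0 < c₂) {a : ℝ} (ha : a ∈ Set.Icc c₂ (1 - c₂)) (d : Bool) :
    0 < armProb d a := by
  cases d <;> simp [armProb] <;> linarith [ha.1, ha.2]

/-- Positive variance is required because only then is the limiting arm share known. -/
lemma tendsto_size_div (h : IsRegularWith E S ν c₂ δ e ω) (hc₂ : 0 < c₂) {j : Fin m}
    (hp : 0 < groupProp ν S j) (he : e j ∈ Set.Icc c₂ (1 - c₂)) {d : Bool}
    (hd : 0 < groupVar ν S j d) :
    Tendsto (fun k => ((E k).N : ℝ) / (E k).armCount S j d (E k).T ω) atTop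
      (𝓝 (1 / (groupProp ν S j * armProb d (e j)))) := by
  have ha := armProb_pos hc₂ he d
  refine h.regular.tendsto_div_count hc₂ hp d ?_
  have h1 := ((h.share j ⟨d, hd⟩ d).const_mul
    (groupProp ν S j * (1 / (groupProp ν S j * armProb d (e j))))).const_sub 1
  have h2 : 1 - groupProp ν S j * (1 / (groupProp ν S j * armProb d (e j))) * armProb d (e j) =
      0 := by field_simp; ring
  rw [h2] at h1
  refine h1.congr' ?_
  filter_upwards [h.regular.size_pos] with k hk
  rw [N, div_self hk.ne']

/-- If the arm has zero variance, the limit is zero whatever the allocation does, since the arm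
count stays proportional to the sample size; otherwise the arm share converges. -/
lemma tendsto_varHat_div (h : IsRegularWith E S ν c₂ δ e ω) (hc₂ : 0 < c₂) {j : Fin m}
    (hp : 0 < groupProp ν S j) (he : e j ∈ Set.Icc c₂ (1 - c₂)) (d : Bool) :
    Tendsto (fun k => (E k).varHat S (E k).T j d ω /
      ((E k).armCount S j d (E k).T ω / (E k).groupCount S j (E k).T ω)) atTop
      (𝓝 (groupVar ν S j d / armProb d (e j))) := by
  have ha := armProb_pos hc₂ he d
  simp_rw [div_div_eq_mul_div]
  refine h.regular.tendsto_div_count hc₂ hp d ?_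
  have h1 := (h.regular.tendsto_varHat hc₂ hp d).mul (h.regular.tendsto_pHat j)
  have h2 : Tendsto (fun k => groupProp ν S j * (groupVar ν S j d / armProb d (e j)) *
      (E k).armShare j d (E k).T ω) atTop (𝓝 (groupVar ν S j d * groupProp ν S j)) := by
    rcases (groupVar_nonneg (ν := ν) (S := S) j d).eq_or_lt with h0 | h0
    · simp [← h0]
    · have h3 := (h.share j ⟨d, h0⟩ d).const_mul
        (groupProp ν S j * (groupVar ν S j d / armProb d (e j)))
      have h4 : groupProp ν S j * (groupVar ν S j d / armProb d (e j)) * armProb d (e j) =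
        groupVar ν S j d * groupProp ν S j := by field_simp
      rwa [h4] at h3
  have h5 := h1.sub h2
  rw [sub_self] at h5
  refine h5.congr fun k => ?_
  rw [pHat, mul_div_assoc]

lemma tendsto_groupVarEst (h : IsRegularWith E S ν c₂ δ e ω) (hc₂ : 0 < c₂) {j : Fin m}
    (hp : 0 < groupProp ν S j) (he : e j ∈ Set.Icc c₂ (1 - c₂)) :
    Tendsto (fun k => (E k).groupVarEst S j ω) atTop (𝓝 (groupAsympVar ν S j (e j))) := by
  have h1 := (tendsto_const_nhds (x := (1 : ℝ))).div (h.regular.tendsto_pHat j) hp.ne'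
  refine (h1.mul ((h.tendsto_varHat_div hc₂ hp he true).add
    (h.tendsto_varHat_div hc₂ hp he false))).congr' ?_
  filter_upwards [h.regular.count_ne_zero hc₂ hp true] with k hk
  have h2 := (E k).armCount_nonneg S j true (E k).T ω
  have h3 := (E k).armCount_nonneg S j false (E k).T ω
  have h4 := (E k).groupCount_eq S j (E k).T ω
  have h5 : 0 < (E k).armCount S j true (E k).T ω := lt_of_le_of_ne h2 (Ne.symm hk)
  -- The fraction of controls is the complement of the treated fraction only in a nonempty group;
  -- for an empty group `0/0 = 0` would break this.
  have h6 : 1 - (E k).eHat S j ω =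
      (E k).armCount S j false (E k).T ω / (E k).groupCount S j (E k).T ω := by
    have h7 : (E k).groupCount S j (E k).T ω ≠ 0 := by rw [h4]; positivity
    rw [eHat, eq_div_iff h7, sub_mul, div_mul_cancel₀ _ h7, h4]
    ring
  rw [groupVarEst, h6]
  rfl

lemma tendsto_ateHat (h : IsRegularWith E S ν c₂ δ e ω) (hc₂ : 0 < c₂)
    (hS : IsMeasurablePartition (groups S)) (hp : ∀ j, 0 < groupProp ν S j)
    (hmom : ∀ d, MemLp (fun w : 𝒳 × (Bool → ℝ) => w.2 d) 4 ν) :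
    Tendsto (fun k => (E k).ateHat S ω) atTop (𝓝 (ate ν)) := by
  rw [ate_eq hmom hS hp]
  exact tendsto_finsetSum _ fun j _ => (h.regular.tendsto_pHat j).mul
    (h.regular.tendsto_tauHat hc₂ hmom (hp j))

lemma tendsto_ateVarEst (h : IsRegularWith E S ν c₂ δ e ω) (hc₂ : 0 < c₂)
    (hS : IsMeasurablePartition (groups S)) (hp : ∀ j, 0 < groupProp ν S j)
    (hmom : ∀ d, MemLp (fun w : 𝒳 × (Bool → ℝ) => w.2 d) 4 ν)
    (he : ∀ j, e j ∈ Set.Icc c₂ (1 - c₂)) :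
    Tendsto (fun k => (E k).ateVarEst S ω) atTop (𝓝 (ateAsympVar ν S e)) := by
  refine (tendsto_finsetSum _ fun j _ => ((h.regular.tendsto_pHat j).pow 2).mul
    (h.tendsto_groupVarEst hc₂ (hp j) (he j))).add (tendsto_finsetSum _ fun j _ =>
    (h.regular.tendsto_pHat j).mul (((h.regular.tendsto_tauHat hc₂ hmom (hp j)).sub
      (h.tendsto_ateHat hc₂ hS hp hmom)).pow 2))

end IsRegularWith

/-- A sequence of fair adaptive experiments on a growing number of participants whose treatment
probabilities approach `e` in the groups with random outcomes. -/
structure IsStable (E : ℕ → Experiment Ω 𝒳 m) (S : Fin m → Set 𝒳) (μ : Measure Ω)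
    (ν : Measure (𝒳 × (Bool → ℝ))) (c₁ c₂ : ℝ) (δ : ℕ → ℝ) (e : Fin m → ℝ) : Prop where
  fair : ∀ k, (E k).IsFairAdaptive S μ ν c₁ c₂ δ
  partition : IsMeasurablePartition (groups S)
  measurableSet : ∀ j, MeasurableSet (S j)
  feasible : c₂ ∈ Set.Ioo (0 : ℝ) (1 / 2)
  prop_pos : ∀ j, 0 < groupProp ν S j
  moment : ∀ d, MemLp (fun w : 𝒳 × (Bool → ℝ) => w.2 d) 4 ν
  rate : Tendsto (fun x : ℕ => √(x : ℝ) * δ x) atTop atTop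
  stages : Tendsto (fun k => (E k).T) atTop atTop
  mem_Icc : ∀ j, e j ∈ Set.Icc c₂ (1 - c₂)
  average : ∀ j, (∃ d, 0 < groupVar ν S j d) →
    Tendsto (fun k => ((E k).N : ℝ)⁻¹ * ∑ t ∈ Finset.range (E k).T,
      ((E k).n t : ℝ) * ∫ ω, |(E k).e t j ω - e j| ∂μ) atTop (𝓝 0)

namespace IsStable

variable {E : ℕ → Experiment Ω 𝒳 m} {e : Fin m → ℝ}

lemma tendsto_N (h : IsStable E S μ ν c₁ c₂ δ e) : Tendsto (fun k => (E k).N) atTop atTop :=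
  tendsto_atTop_mono (fun k => (h.fair k).le_size le_rfl) h.stages

/-- Convergence in probability follows from convergence along all regular subsequences. -/
lemma tendstoInMeasure (h : IsStable E S μ ν c₁ c₂ δ e) {X : ℕ → Ω → ℝ} {a : ℝ}
    (hX : ∀ k, Measurable (X k))
    (hlim : ∀ (φ : ℕ → ℕ) (ω : Ω), IsRegularWith (E ∘ φ) S ν c₂ δ e ω →
      Tendsto (fun k => X (φ k) ω) atTop (𝓝 a)) :
    TendstoInMeasure μ X atTop (fun _ => a) := by
  -- Convergence in probability means that every subsequence has a further one converging almost
  -- surely; along suitable refinements almost every path is regular and `hlim` applies.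
  rw [exists_seq_tendstoInMeasure_atTop_iff fun k => (hX k).aestronglyMeasurable]
  intro ns hns
  obtain ⟨φ, hφ, hreg⟩ := exists_strictMono_isRegular (fun k => h.fair (ns k)) h.partition
    h.measurableSet h.feasible h.prop_pos h.moment h.rate (t := fun k => (E (ns k)).T)
    (fun k => le_rfl) (h.tendsto_N.comp hns.tendsto_atTop)
  have hsh : ∀ q : {j // ∃ d, 0 < groupVar ν S j d} × Bool, TendstoInMeasure μ
      (fun k ω => (E k).armShare q.1.1 q.2 (E k).T ω - armProb q.2 (e q.1.1)) atTop
      (fun _ => 0) := fun q =>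
    tendstoInMeasure_armShare h.fair h.partition h.feasible h.stages (h.average q.1.1 q.1.2) q.2
  classical
  obtain ⟨ψ, hψ, hsh⟩ := exists_strictMono_forall_ae_tendsto fun q =>
    (hsh q).comp (hns.comp hφ).tendsto_atTop
  refine ⟨φ ∘ ψ, hφ.comp hψ, ?_⟩
  filter_upwards [hreg, hsh] with ω h1 h2
  refine hlim (ns ∘ φ ∘ ψ) ω ⟨h1.comp hψ.tendsto_atTop, fun j hj d => ?_⟩
  have h3 := (h2 (⟨j, hj⟩, d)).add_const (armProb d (e j))
  rw [zero_add] at h3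
  exact h3.congr fun k => sub_add_cancel _ _

lemma tendstoInMeasure_groupVarEst (h : IsStable E S μ ν c₁ c₂ δ e) (j : Fin m) :
    TendstoInMeasure μ (fun k => (E k).groupVarEst S j) atTop
      (fun _ => groupAsympVar ν S j (e j)) :=
  h.tendstoInMeasure (fun k => (h.fair k).measurable_groupVarEst h.measurableSet j)
    fun _ _ hω => hω.tendsto_groupVarEst h.feasible.1 (h.prop_pos j) (h.mem_Icc j)

lemma tendstoInMeasure_ateVarEst (h : IsStable E S μ ν c₁ c₂ δ e) :
    TendstoInMeasure μ (fun k => (E k).ateVarEst S) atTop (fun _ => ateAsympVar ν S e) :=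
  h.tendstoInMeasure (fun k => (h.fair k).measurable_ateVarEst h.measurableSet)
    fun _ _ hω => hω.tendsto_ateVarEst h.feasible.1 h.partition h.prop_pos h.moment h.mem_Icc

end IsStable

end Experiment
end FairExperiment

namespace FairExperiment

/-! ### Asymptotic normality of the estimators -/

section InMeasure

variable {Ω : Type*} [MeasurableSpace Ω] {μ : Measure Ω} [IsProbabilityMeasure μ]

lemma tendstoInMeasure_zero_add {X Y : ℕ → Ω → ℝ} (hX : TendstoInMeasure μ X atTop (fun _ => 0))
    (hY : TendstoInMeasure μ Y atTop (fun _ => 0)) :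
    TendstoInMeasure μ (fun k ω => X k ω + Y k ω) atTop (fun _ => 0) := by
  rw [tendstoInMeasure_iff_measureReal_norm] at hX hY ⊢
  simp only [sub_zero] at hX hY ⊢
  intro ε hε
  have h1 := (hX (ε / 2) (by positivity)).add (hY (ε / 2) (by positivity))
  rw [add_zero] at h1
  refine squeeze_zero (fun _ => measureReal_nonneg) (fun k => ?_) h1
  refine (measureReal_mono fun ω hω => ?_).trans (measureReal_union_le _ _)
  simp only [Set.mem_ofPred_eq, Set.mem_union] at hω ⊢
  by_contra! hcon
  linarith [norm_add_le (X k ω) (Y k ω), hcon.1, hcon.2]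

lemma tendstoInMeasure_zero_sum {ι : Type*} (s : Finset ι) {X : ι → ℕ → Ω → ℝ}
    (hX : ∀ i ∈ s, TendstoInMeasure μ (X i) atTop (fun _ => 0)) :
    TendstoInMeasure μ (fun k ω => ∑ i ∈ s, X i k ω) atTop (fun _ => 0) := by
  classical
  induction s using Finset.induction_on with
  | empty =>
    simp only [Finset.sum_empty]
    exact tendstoInMeasure_of_tendsto_ae (fun _ => aestronglyMeasurable_const)
      (ae_of_all _ fun _ => tendsto_const_nhds)
  | insert i s his ih =>
    simp only [Finset.sum_insert his]
    exact tendstoInMeasure_zero_add (hX i (Finset.mem_insert_self i s))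
      (ih fun l hl => hX l (Finset.mem_insert_of_mem hl))

end InMeasure

namespace Experiment

variable {Ω 𝒳 : Type*} [mΩ : MeasurableSpace Ω] [MeasurableSpace 𝒳] {m : ℕ} {μ : Measure Ω}
  [IsProbabilityMeasure μ] {ν : Measure (𝒳 × (Bool → ℝ))} [IsProbabilityMeasure ν]
  {S : Fin m → Set 𝒳} {c₁ c₂ : ℝ} {δ : ℕ → ℝ}

/-- The sign of an arm in the treatment effect. -/
def armSign (d : Bool) : ℝ := if d then 1 else -1

/-- The centered and scaled sum of the outcomes of group `j` in arm `d`. -/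
noncomputable def scaledSum (E : Experiment Ω 𝒳 m) (S : Fin m → Set 𝒳)
    (ν : Measure (𝒳 × (Bool → ℝ))) (j : Fin m) (d : Bool) (ω : Ω) : ℝ :=
  (√(E.N : ℝ))⁻¹ * E.total (groupArm S j d fun y => y - groupMean ν S j d) E.T ω

/-- With zero variance the outcome equals its group mean almost surely, so the centered summands
vanish and so does the bound on their second moment. -/
lemma deviationBound_centered_eq_zero (hS : IsMeasurablePartition (groups S))
    (hmom : ∀ d, MemLp (fun w : 𝒳 × (Bool → ℝ) => w.2 d) 4 ν) {j : Fin m}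
    (hp : 0 < groupProp ν S j) {d : Bool} (hd : groupVar ν S j d = 0) :
    IsSequentialTrial.deviationBound ν
      (groupArm S j d fun y => y - groupMean ν S j d) = 0 := by
  have h1 := setIntegral_sub_groupMean_sq hmom hp d
  rw [hd, mul_zero, integral_eq_zero_iff_of_nonneg (fun w => sq_nonneg _)
    ((memLp_two_sub_sq hmom d _).integrable (by norm_num)).integrableOn,
    Filter.EventuallyEq, ae_restrict_iff' (hS.measurableSet j)] at h1
  have h2 : ∀ b, ∀ᵐ w ∂ν, groupArm S j d (fun y => y - groupMean ν S j d) w b = 0 := by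
    intro b
    filter_upwards [h1] with w hw
    by_cases hj : w.1 ∈ S j
    · have h3 : w.2 d - groupMean ν S j d = 0 := by simpa using hw hj
      simp [groupArm, h3]
    · simp [groupArm, hj]
  have h3 : ∀ b, ∫ w, (groupArm S j d fun y => y - groupMean ν S j d) w b ^ 2 ∂ν = 0 := fun b =>
    integral_eq_zero_of_ae ((h2 b).mono fun w hw => by simp [hw])
  have h4 : ∀ b, ∫ w, ‖(groupArm S j d fun y => y - groupMean ν S j d) w b‖ ∂ν = 0 := fun b =>
    integral_eq_zero_of_ae ((h2 b).mono fun w hw => by simp [hw])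
  simp only [IsSequentialTrial.deviationBound, h3, h4, Finset.sum_const_zero]
  norm_num

lemma IsFairAdaptive.integral_scaledSum_sq_le {E : Experiment Ω 𝒳 m}
    (h : E.IsFairAdaptive S μ ν c₁ c₂ δ) (hS : IsMeasurablePartition (groups S))
    (hSm : ∀ j, MeasurableSet (S j)) (hc₂ : c₂ ∈ Set.Ioo (0 : ℝ) (1 / 2))
    (hmom : ∀ d, MemLp (fun w : 𝒳 × (Bool → ℝ) => w.2 d) 4 ν) {j : Fin m}
    (hp : 0 < groupProp ν S j) (d : Bool) :
    MemLp (E.scaledSum S ν j d) 2 μ ∧ ∫ ω, E.scaledSum S ν j d ω ^ 2 ∂μ ≤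
      IsSequentialTrial.deviationBound ν (groupArm S j d fun y => y - groupMean ν S j d) := by
  have hm : Measurable fun y : ℝ => y - groupMean ν S j d := by fun_prop
  have h1 := h.integral_total_sub_sq_le hS hc₂ (measurable_groupArm hSm j d hm)
    (memLp_groupArm hSm j d hm
      ((memLp_four_sub hmom d (groupMean ν S j d)).mono_exponent (by norm_num))) (le_refl E.T)
  simp only [designMean_groupArm hS, setIntegral_sub_groupMean hmom hp, mul_zero,
    Finset.sum_const_zero, sub_zero] at h1
  refine ⟨h1.1.const_mul _, ?_⟩
  simp only [scaledSum, mul_pow, inv_pow, Real.sq_sqrt (Nat.cast_nonneg (α := ℝ) E.N)]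
  rw [integral_const_mul]
  -- For `N = 0` the scaling factor is `0⁻¹ = 0` and only nonnegativity of the bound is needed.
  rcases Nat.eq_zero_or_pos E.N with h0 | h0
  · rw [h0, Nat.cast_zero, inv_zero, zero_mul]
    unfold IsSequentialTrial.deviationBound
    have : ∀ b, 0 ≤ ∫ w, (groupArm S j d fun y => y - groupMean ν S j d) w b ^ 2 ∂ν := fun b =>
      integral_nonneg fun w => sq_nonneg _
    positivity
  · have h2 : (0 : ℝ) < E.N := Nat.cast_pos.2 h0
    rw [inv_mul_le_iff₀ h2]
    exact h1.2

namespace IsStable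

variable {E : ℕ → Experiment Ω 𝒳 m} {e : Fin m → ℝ}

/-- In a degenerate arm the scaled sum is zero almost surely and the factor `R` may be arbitrary;
otherwise the scaled sum is bounded in `L²` and `R` vanishes in probability. -/
lemma tendstoInMeasure_scaledSum_mul (h : IsStable E S μ ν c₁ c₂ δ e) (j : Fin m) (d : Bool)
    {R : ℕ → Ω → ℝ}
    (hR : 0 < groupVar ν S j d → TendstoInMeasure μ R atTop (fun _ => 0)) :
    TendstoInMeasure μ (fun k ω => (E k).scaledSum S ν j d ω * R k ω) atTop (fun _ => 0) := by
  have h1 := fun k => (h.fair k).integral_scaledSum_sq_le h.partition h.measurableSet h.feasible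
    h.moment (h.prop_pos j) d
  rcases (groupVar_nonneg (ν := ν) (S := S) j d).eq_or_lt with h0 | h0
  · rw [deviationBound_centered_eq_zero h.partition h.moment (h.prop_pos j) h0.symm] at h1
    have h2 : ∀ k, (E k).scaledSum S ν j d =ᵐ[μ] fun _ => 0 := fun k => by
      have h3 := (integral_eq_zero_iff_of_nonneg (fun ω => sq_nonneg _)
        (h1 k).1.integrable_sq).1 (le_antisymm (h1 k).2 (integral_nonneg fun ω => sq_nonneg _))
      filter_upwards [h3] with ω hω
      exact pow_eq_zero_iff two_ne_zero |>.1 hω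
    refine TendstoInMeasure.congr_left (f := fun _ _ => (0 : ℝ)) (fun k => ?_)
      (tendstoInMeasure_of_tendsto_ae (fun _ => aestronglyMeasurable_const)
      (ae_of_all _ fun _ => tendsto_const_nhds))
    filter_upwards [h2 k] with ω hω
    rw [hω, zero_mul]
  · exact tendstoInMeasure_mul_of_integral_sq_le (Eventually.of_forall h1) (hR h0)

/-- Asymptotic normality of weighted sums of the estimated group effects. -/
lemma tendstoInDistribution (h : IsStable E S μ ν c₁ c₂ δ e) {X : ℕ → Ω → ℝ}
    (hX : ∀ k, Measurable (X k)) {W : ℕ → Fin m → Ω → ℝ} {w c : Fin m → ℝ}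
    (hW : ∀ k j, Measurable (W k j))
    (hWlim : ∀ (φ : ℕ → ℕ) (ω : Ω), IsRegularWith (E ∘ φ) S ν c₂ δ e ω →
      ∀ j, Tendsto (fun k => W (φ k) j ω) atTop (𝓝 (w j)))
    (hc : ∑ j, groupProp ν S j * c j = 0)
    (hXW : ∀ k ω, 0 < (E k).N → X k ω = √((E k).N : ℝ) * ∑ j,
      (W k j ω * ((E k).tauHat S (E k).T j ω - groupEffect ν S j) +
        c j * (E k).pHat S (E k).T j ω)) :
    TendstoInDistribution X atTop (id : ℝ → ℝ) (fun _ => μ)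
      (gaussianReal 0 (∑ j, w j ^ 2 * groupAsympVar ν S j (e j) +
        ∑ j, groupProp ν S j * c j ^ 2).toNNReal) := by
  have hpos := fun j d => IsRegularWith.armProb_pos h.feasible.1 (h.mem_Icc j) d
  -- The coefficient contains the limit of the sample size over the arm count, so squaring it and
  -- weighting by the arm probability leaves `1/(p_j² armProb)`.
  set a : Fin m → Bool → ℝ := fun j d =>
    w j * armSign d * (1 / (groupProp ν S j * armProb d (e j))) with ha
  have hvar : linearVar ν S a c e = ∑ j, w j ^ 2 * groupAsympVar ν S j (e j) +
        ∑ j, groupProp ν S j * c j ^ 2 := by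
    rw [linearVar, ← Finset.sum_add_distrib]
    refine Finset.sum_congr rfl fun j _ => ?_
    have h1 := h.prop_pos j
    have h2 := hpos j true
    have h3 := hpos j false
    rw [groupAsympVar]
    change _ = w j ^ 2 * (1 / groupProp ν S j * (groupVar ν S j true / armProb true (e j) +
      groupVar ν S j false / armProb false (e j))) + _
    simp only [ha, Fintype.sum_bool, armSign]
    field_simp
    simp
  rw [← hvar]
  -- The difference between the actual random coefficient of each scaled sum and its limit.
  set R : ℕ → Fin m → Bool → Ω → ℝ := fun k j d ω => armSign d *
    (W k j ω * ((E k).N / (E k).armCount S j d (E k).T ω) -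
      w j * (1 / (groupProp ν S j * armProb d (e j)))) with hRdef
  have hRm : ∀ k j d, Measurable (R k j d) := fun k j d =>
    (((hW k j).mul (measurable_const.div
      ((h.fair k).measurable_armCount h.measurableSet j d))).sub_const _).const_mul _
  have hR : ∀ j d, 0 < groupVar ν S j d →
      TendstoInMeasure μ (fun k => R k j d) atTop (fun _ => 0) := fun j d hd =>
    h.tendstoInMeasure (fun k => hRm k j d) fun φ ω hω => by
      have h1 := ((((hWlim φ ω hω j).mul (hω.tendsto_size_div h.feasible.1 (h.prop_pos j)
        (h.mem_Icc j) hd)).sub_const (w j * (1 / (groupProp ν S j * armProb d (e j)))))).const_mul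
        (armSign d)
      rwa [sub_self, mul_zero] at h1
  set L : ℕ → Ω → ℝ := fun k ω =>
    (√((E k).N : ℝ))⁻¹ * (E k).total (linearStat ν S a c) (E k).T ω with hL
  have hLm : ∀ k, Measurable (L k) := fun k =>
    ((h.fair k).measurable_total (measurable_linearStat h.measurableSet)).const_mul _
  have hGm : ∀ k j d, Measurable ((E k).scaledSum S ν j d) := fun k j d =>
    ((h.fair k).measurable_total (measurable_groupArm h.measurableSet j d
      (by fun_prop : Measurable fun y : ℝ => y - groupMean ν S j d))).const_mul _
  set Q : ℕ → Ω → ℝ := fun k ω => ∑ j, ∑ d, (E k).scaledSum S ν j d ω * R k j d ω with hQ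
  have hQm : ∀ k, Measurable (Q k) := fun k => Finset.measurable_sum _ fun j _ =>
    Finset.measurable_sum _ fun d _ => (hGm k j d).mul (hRm k j d)
  have hQlim : TendstoInMeasure μ Q atTop (fun _ => 0) :=
    tendstoInMeasure_zero_sum _ fun j _ => tendstoInMeasure_zero_sum _ fun d _ =>
      h.tendstoInMeasure_scaledSum_mul j d (hR j d)
  -- When all arms are observed, the statistic is exactly its linearization `L` plus the remainder
  -- `Q`.
  have key : ∀ k ω, 0 < (E k).N → (∀ j d, (E k).armCount S j d (E k).T ω ≠ 0) →
      X k ω - L k ω - Q k ω = 0 := by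
    intro k ω hN hcount
    have hNr : (0 : ℝ) < (E k).N := Nat.cast_pos.2 hN
    have hs : 0 < √((E k).N : ℝ) := Real.sqrt_pos.2 hNr
    have hs2 : √((E k).N : ℝ) * √((E k).N : ℝ) = (E k).N := Real.mul_self_sqrt hNr.le
    rw [hXW k ω hN]
    simp only [hL, hQ, total_linearStat, Finset.mul_sum, ← Finset.sum_sub_distrib]
    refine Finset.sum_eq_zero fun j _ => ?_
    rw [groupEffect_eq h.moment (h.prop_pos j), tauHat, sub_sub_sub_comm,
      armMean_sub _ S (hcount j true), armMean_sub _ S (hcount j false)]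
    simp only [Fintype.sum_bool, hRdef, ha, scaledSum, pHat, armSign]
    change √((E k).N : ℝ) * (_ + c j * ((E k).groupCount S j (E k).T ω / ((E k).N : ℝ))) - _ - _ = _
    have h1 := hcount j true
    have h2 := hcount j false
    have hinv : (√((E k).N : ℝ))⁻¹ = √((E k).N : ℝ) / (E k).N := by
      rw [eq_div_iff hNr.ne', inv_mul_eq_div, div_eq_iff hs.ne', hs2]
    rw [hinv]
    set s := √((E k).N : ℝ)
    set n := ((E k).N : ℝ)
    simp only [Bool.false_eq_true, if_true, if_false]
    have h3 := (h.prop_pos j).ne'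
    have h4 := (hpos j true).ne'
    have h5 := (hpos j false).ne'
    field_simp
    ring
  -- Along a regular path every arm is eventually observed, so the difference is eventually exactly
  -- zero.
  have hdiff : TendstoInMeasure μ (fun k ω => X k ω - L k ω - Q k ω) atTop (fun _ => 0) := by
    refine h.tendstoInMeasure (fun k => ((hX k).sub (hLm k)).sub (hQm k)) fun φ ω hω => ?_
    refine tendsto_const_nhds.congr' ?_
    have h1 : ∀ᶠ k in atTop, ∀ j d, ((E ∘ φ) k).armCount S j d ((E ∘ φ) k).T ω ≠ 0 :=
      eventually_all.2 fun j => eventually_all.2 fun d =>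
        hω.regular.count_ne_zero h.feasible.1 (h.prop_pos j) d
    filter_upwards [hω.regular.size_atTop.eventually_gt_atTop 0, h1] with k hk hk'
    exact (key (φ k) ω hk hk').symm
  have hclt := tendstoInDistribution_linearStat (a := a) h.fair h.partition h.measurableSet
    h.feasible h.prop_pos h.moment h.mem_Icc h.stages h.average hc
  refine tendstoInDistribution_of_tendstoInMeasure_sub X id hclt ?_ fun k => (hX k).aemeasurable
  refine (tendstoInMeasure_zero_add hdiff hQlim).congr_left fun k => ae_of_all _ fun ω => ?_
  simp only [Pi.sub_apply, sub_add_cancel]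
  rfl

lemma tendstoInDistribution_tauHat (h : IsStable E S μ ν c₁ c₂ δ e) (j : Fin m) :
    TendstoInDistribution
      (fun k ω => √((E k).N : ℝ) * ((E k).tauHat S (E k).T j ω - groupEffect ν S j)) atTop
      (id : ℝ → ℝ) (fun _ => μ) (gaussianReal 0 (groupAsympVar ν S j (e j)).toNNReal) := by
  have key := h.tendstoInDistribution
    (X := fun k ω => √((E k).N : ℝ) * ((E k).tauHat S (E k).T j ω - groupEffect ν S j))
    (W := fun _ l _ => if l = j then 1 else 0) (w := fun l => if l = j then 1 else 0)
    (c := fun _ => 0)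
    (fun k => (((h.fair k).measurable_tauHat h.measurableSet j).sub_const _).const_mul _)
    (fun _ _ => measurable_const) (fun _ _ _ _ => tendsto_const_nhds) (by simp)
    (fun k ω _ => by simp)
  simpa using key

/-- The error is `∑ p̂_j (τ̂_j - τ_j) + ∑ (τ_j - τ) p̂_j`, because the estimated proportions sum to
one. The second sum has centered coefficients and yields the between-group variance. -/
lemma tendstoInDistribution_ateHat (h : IsStable E S μ ν c₁ c₂ δ e) :
    TendstoInDistribution
      (fun k ω => √((E k).N : ℝ) * ((E k).ateHat S ω - ate ν)) atTop
      (id : ℝ → ℝ) (fun _ => μ) (gaussianReal 0 (ateAsympVar ν S e).toNNReal) := by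
  refine h.tendstoInDistribution
    (W := fun k j => (E k).pHat S (E k).T j) (w := groupProp ν S)
    (c := fun j => groupEffect ν S j - ate ν)
    (fun k => (((h.fair k).measurable_ateHat h.measurableSet).sub_const _).const_mul _)
    (fun k j => (h.fair k).measurable_pHat h.measurableSet j)
    (fun φ ω hω j => hω.regular.tendsto_pHat j) ?_ fun k ω hN => ?_
  · simp only [mul_sub, Finset.sum_sub_distrib, ← Finset.sum_mul, sum_groupProp h.partition,
      ← ate_eq h.moment h.partition h.prop_pos, one_mul, sub_self]
  · have hNr : ((E k).N : ℝ) ≠ 0 := Nat.cast_ne_zero.2 hN.ne'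
    have h1 : ∑ j, (E k).pHat S (E k).T j ω = 1 := by
      simp only [pHat, ← Finset.sum_div]
      rw [sum_groupCount _ _ h.partition]
      exact div_self hNr
    congr 1
    have h2 : ∀ j, (E k).pHat S (E k).T j ω * ((E k).tauHat S (E k).T j ω - groupEffect ν S j) +
        (groupEffect ν S j - ate ν) * (E k).pHat S (E k).T j ω =
        (E k).pHat S (E k).T j ω * (E k).tauHat S (E k).T j ω -
          (E k).pHat S (E k).T j ω * ate ν := fun j => by ring
    simp only [h2, Finset.sum_sub_distrib, ← Finset.sum_mul, h1, one_mul]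
    rfl

end IsStable

end Experiment
end FairExperiment

/-! ### Assembly of the main theorem. -/

theorem mainTheorem2 {Ω : Type*} [MeasurableSpace Ω] (μ : Measure Ω) [IsProbabilityMeasure μ]
    {𝒳 : Type*} [MeasurableSpace 𝒳] (ν : Measure (𝒳 × (Bool → ℝ))) [IsProbabilityMeasure ν]
    {m : ℕ} (S : Fin m → Set 𝒳) (hS_meas : ∀ j, MeasurableSet (S j))
    (hS_disj : Pairwise (Function.onFun Disjoint S)) (hS_univ : ⋃ j, S j = Set.univ)
    (c₁ c₂ : ℝ) (hc₁ : c₁ ∈ Set.Ioo (0 : ℝ) 1) (hc₂ : c₂ ∈ Set.Ioo (0 : ℝ) (1 / 2))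
    (δ : ℕ → ℝ) (hδ_nonneg : ∀ x, 0 ≤ δ x) (hδ_lim : Tendsto δ atTop (𝓝 0))
    (hδ_rate : Tendsto (fun x : ℕ => √(x : ℝ) * δ x) atTop atTop)
    (E : ℕ → Experiment Ω 𝒳 m)
    (hE : ∀ k, (E k).IsFairAdaptive S μ ν c₁ c₂ δ)
    (hT : Tendsto (fun k => (E k).T) atTop atTop)
    (hmoment : ∀ d, MemLp (fun w : 𝒳 × (Bool → ℝ) => w.2 d) 4 ν)
    (hprop : ∃ ε > 0, ∀ j, ε ≤ groupProp ν S j)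
    (hstage : ∃ c : ℝ, 1 ≤ c ∧ ∀ k, ∀ t < (E k).T,
      ((E k).N : ℝ) / (c * (E k).T) ≤ (E k).n t ∧ ((E k).n t : ℝ) ≤ c * (E k).N / (E k).T)
    (eStar : Fin m → ℝ)
    (heStar : IsOptimal c₁ c₂ 0 (groupProp ν S) (groupVar ν S) (groupEffect ν S) eStar) :
    (∀ j, TendstoInDistribution
      (fun k ω => √((E k).N : ℝ) * ((E k).tauHat S (E k).T j ω - groupEffect ν S j)) atTop
      (id : ℝ → ℝ) (fun _ => μ) (gaussianReal 0 (groupAsympVar ν S j (eStar j)).toNNReal)) ∧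
    TendstoInDistribution
      (fun k ω => √((E k).N : ℝ) * ((E k).ateHat S ω - ate ν)) atTop
      (id : ℝ → ℝ) (fun _ => μ) (gaussianReal 0 (ateAsympVar ν S eStar).toNNReal) ∧
    (∀ j, TendstoInMeasure μ (fun k => (E k).groupVarEst S j) atTop
      (fun _ => groupAsympVar ν S j (eStar j))) ∧
    TendstoInMeasure μ (fun k => (E k).ateVarEst S) atTop (fun _ => ateAsympVar ν S eStar) ∧
    (∀ α ∈ Set.Ioo (0 : ℝ) 1,
      (∀ j, 0 < groupAsympVar ν S j (eStar j) →
        Tendsto (fun k => μ.real {ω | groupEffect ν S j ∈ confInterval α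
            ((E k).tauHat S (E k).T j ω) ((E k).groupVarEst S j ω) (E k).N})
          atTop (𝓝 (1 - α))) ∧
      (0 < ateAsympVar ν S eStar →
        Tendsto (fun k => μ.real {ω | ate ν ∈ confInterval α
            ((E k).ateHat S ω) ((E k).ateVarEst S ω) (E k).N})
          atTop (𝓝 (1 - α)))) := by
  have hS := Experiment.isMeasurablePartition_groups hS_meas hS_disj hS_univ
  have hp : ∀ j, 0 < groupProp ν S j := fun j => by
    obtain ⟨ε, hε, h⟩ := hprop
    exact hε.trans_le (h j)
  have h : Experiment.IsStable E S μ ν c₁ c₂ δ eStar :=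
    { fair := hE
      partition := hS
      measurableSet := hS_meas
      feasible := hc₂
      prop_pos := hp
      moment := hmoment
      rate := hδ_rate
      stages := hT
      mem_Icc := heStar.1.2.2
      average := fun j hj => Experiment.tendsto_average_prob hE hS hS_meas hc₂ hp hmoment
        hδ_nonneg hδ_lim hδ_rate heStar hT hstage hj }
  refine ⟨h.tendstoInDistribution_tauHat, h.tendstoInDistribution_ateHat,
    h.tendstoInMeasure_groupVarEst, h.tendstoInMeasure_ateVarEst,
    fun α hα => ⟨fun j hj => ?_, fun hv => ?_⟩⟩
  · exact tendsto_coverage h.tendsto_N hj hα (h.tendstoInDistribution_tauHat j)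
      (fun k => ((hE k).measurable_groupVarEst hS_meas j).aemeasurable)
      (h.tendstoInMeasure_groupVarEst j)
  · exact tendsto_coverage h.tendsto_N hv hα h.tendstoInDistribution_ateHat
      (fun k => ((hE k).measurable_ateVarEst hS_meas).aemeasurable) h.tendstoInMeasure_ateVarEst
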